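/- Let $l\ge 1$, $1\le k\le l$ and $0\le m\le l-k$ be integers. **Setting.** Let $x_1,\dots,x_{l+1}$ be complex coordinates, $x_0=0$, $\xi_j=e^{2\pi i(x_j-x_{j-1})}+e^{-2\pi i(x_j-x_{j-1})}$ for $1\le j\le l$, $d_j=\min(j,k)$, and let $\sigma_j$ be the elementary symmetric polynomials. Put $$y^j=e^{2\pi i d_jx_{l+1}}\sigma_j(\xi_1,\dots,\xi_l)\ (1\le j\le l),\qquad y^{l+1}=2\pi i\,x_{l+1}.$$ These are coordinates on (a covering of an open part of) the orbit space of the extended affine Weyl group of type $C_l$ with chosen simple root $\alpha_k$; weighted degrees are determined by $\deg y^j=d_j$ $(j\le l)$, $\deg y^{l+1}=0$, $\deg e^{y^{l+1}}=1$. The bilinear form $(dx_s,dx_n)=\frac{\min(s,n)}{4\pi^2}$ $(s,n\le l)$, $(dx_s,dx_{l+1})=0$ $(s\le l)$, $(dx_{l+1},dx_{l+1})=-\frac1{4k\pi^2}$ induces a well-defined form $g^{ij}(y)=\sum_{a,b}\frac{\partial y^i}{\partial x_a}\frac{\partial y^j}{\partial x_b}(dx_a,dx_b)$. Let $\eta^{ij}=\mathcal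 L_e g^{ij}$, where $e=\sum_{j=k}^l c_j\,\partial/\partial y^j$ and $\sum_{j=k}^lc_ju^{l-j}=(u+2)^m(u-2)^{l-k-m}$. **Coordinates $\tau$.** Let $\theta^0=e^{ky^{l+1}}$, $\theta^j=y^je^{(k-j)y^{l+1}}$ for $1\le j<k$, $\theta^j=y^j$ for $k\le j\le l$, and define $\varpi^j$ from $\tau^1,\dots,\tau^{l+1}$ by the same formulas. The coordinates $\tau$ are defined by $\tau^{l+1}=y^{l+1}$ and the identity in $u$ $$\sum_{j=0}^l\theta^ju^{l-j}=\sum_{j=0}^{l-m}\varpi^j(u+2)^m(u-2)^{l-m-j}-\sum_{j=l-m+1}^l\varpi^j(u+2)^{l-j}(u-2)^{j-k-1}.$$ **Coordinates $z$.** Call $z$ *normalizing* if $z^j=\tau^j+p_j(\tau^1,\dots,\tau^{j-1},e^{\tau^{l+1}})$ for $1\le j\le k$ with $p_j$ a weighted homogeneous polynomial of degree $d_j$ ($\deg\tau^i=d_i$, $\deg e^{\tau^{l+1}}=1$), $z^j=\tau^j+\sum_{s=j+1}^{l-m}c^j_s\tau^s$ for $k<j\le l-m$, $z^j=\tau^j+\sum_{s=j+1}^{l}c^j_s\tau^s$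 for $l-m<j\le l$ (with constants $c^j_s$), $z^{l+1}=\tau^{l+1}$, and if the only nonzero entries of $(\eta^{ij}(z))=(\eta(dz^i,dz^j))$ are: $k$ for $i,j<k$, $i+j=k$; $1$ for $\{i,j\}=\{k,l+1\}$; and, for each of the two blocks $(b,e)=(k,l-m)$ and $(b,e)=(l-m,l)$ and $b<i,j\le e$ with $i+j-b-1\le e$, the entry $4(i+j-2b-1)\,z^{i+j-b-1}$. **Coordinates $w$.** For normalizing $z$ put $w^i=z^i$ for $i\le k$ and $i=l+1$, and for each nonempty block $(b,e)$ as above $$w^e=(z^e)^{\frac1{2(e-b)}},\qquad w^{b+1}=z^{b+1}(z^e)^{-\frac1{2(e-b)}},\qquad w^s=z^s(z^e)^{-\frac{s-b}{e-b}}\ (b+1<s<e),$$ on open sets where $z^e\ne0$ for each nonempty block and where a holomorphic branch $r$ of $(z^e)^{1/(2(e-b))}$ is chosen, powers being read as $(z^e)^{-1/(2(e-b))}=r^{-1}$, $(z^e)^{-(s-b)/(e-b)}=r^{-2(s-b)}$. The degrees of the $w^i$ are those resulting from $\deg z^j=d_j$ $(j\le l)$; in particular $\deg w^s=\frac{k(e-s)}{e-b}$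 for $b+1<s<e$. **Theorem.** The form $g$ and the coordinates $\tau$ are well defined, and normalizing coordinates $z$ exist. There are polynomials $h_j$ (with $k+1\le j\le l-m-1$ or $l-m+1\le j\le l-1$) such that $h_{l-m-1}=0$ if $k+1\le l-m-1$; $h_{l-1}=0$ if $l-m+1\le l-1$; $h_j$ is a polynomial in $w^{j+1},\dots,w^{l-m-1}$, weighted homogeneous of degree $\frac{k(l-m-j)}{l-m-k}$, for $k+1\le j\le l-m-1$; $h_s$ is a polynomial in $w^{s+1},\dots,w^{l-1}$, weighted homogeneous of degree $\frac{k(l-s)}{m}$, for $l-m+1\le s\le l-1$; and such that the following holds for every normalizing $z$. 1. Every point at which $z^{l-m}\ne0$ (required only if $k<l-m$) and $z^l\neq0$ (required only if $m>0$) has an open neighbourhood on which holomorphic branches as above exist. 2. For every open set $U$ with such branches, the functions $$\begin{aligned} &t^i=w^i\quad(1\le i\le k,\ i=l+1),\\ &t^{l-m}=w^{l-m}\ (\text{if }k<l-m),\qquad t^l=w^l\ (\text{if }m>0),\\ &t^{k+1}=w^{k+1}+w^{l-m}h_{k+1}(w^{k+2},\dots,w^{l-m-1})\quad(\text{if }k+1<l-m),\\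 &t^j=w^{l-m}\bigl(w^j+h_j(w^{j+1},\dots,w^{l-m-1})\bigr)\quad(k+2\le j\le l-m-1),\\ &t^{l-m+1}=w^{l-m+1}+w^l\,h_{l-m+1}(w^{l-m+2},\dots,w^{l-1})\quad(\text{if }m>1),\\ &t^s=w^l\bigl(w^s+h_s(w^{s+1},\dots,w^{l-1})\bigr)\quad(l-m+2\le s\le l-1) \end{aligned}$$ are flat coordinates of the metric $\eta$ on $U$: they are holomorphic and injective on $U$ with nowhere vanishing Jacobian, and the matrix $(\eta(dt^i,dt^j))$ is constant and nondegenerate. Moreover each $t^i$ is algebraic in $\tau^1,\dots,\tau^{l+1},e^{\tau^{l+1}}$: it satisfies on $U$ a nontrivial polynomial equation with coefficients in $\mathbb C[\tau^1,\dots,\tau^{l+1},e^{\tau^{l+1}}]$. -/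

import Mathlib

namespace ExtAffineC

noncomputable section

open Polynomial

/-- `ℂ^{l+1}`.  It carries either the (complexified) linear coordinates `x_1, …, x_{l+1}` of
`V ⊕ ℝ`, or the coordinates `y^1, …, y^{l+1}` of the covering of the orbit space. The entry with
index `a : Fin (l+1)` is the coordinate number `a + 1`. -/
abbrev Pt (l : ℕ) : Type := Fin (l + 1) → ℂ

/-- The coordinate number `j`, for `1 ≤ j ≤ l + 1`. -/
def coord (l j : ℕ) (p : Pt l) : ℂ :=
  if h : j - 1 < l + 1 then p ⟨j - 1, h⟩ else 0

/-- The partial derivative with respect to the coordinate with index `a`. -/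
def pd {l : ℕ} (f : Pt l → ℂ) (a : Fin (l + 1)) (p : Pt l) : ℂ :=
  fderiv ℂ f p (Pi.single a 1)

/-- Contravariant 2-tensor fields, given by their components. -/
abbrev Tensor2 (l : ℕ) : Type := Fin (l + 1) → Fin (l + 1) → Pt l → ℂ

/-- The value `G(df, dh) = ∑ G^{ab} ∂_a f ∂_b h` of a contravariant 2-tensor field. -/
def pairing {l : ℕ} (G : Tensor2 l) (f h : Pt l → ℂ) (p : Pt l) : ℂ :=
  ∑ a, ∑ b, G a b p * pd f a p * pd h b p

/-- The Lie derivative of a contravariant 2-tensor field along the vector field `X`. -/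
def lieDeriv {l : ℕ} (X : Fin (l + 1) → Pt l → ℂ) (G : Tensor2 l) : Tensor2 l :=
  fun i j p => ∑ s, (X s p * pd (G i j) s p - G s j p * pd (X i) s p - G i s p * pd (X j) s p)

/-! ### The orbit space of the extended affine Weyl group of type `C_l` with chosen root `α_k` -/

/-- `v_j = x_j - x_{j-1}`, with `x_0 = 0`. -/
def vCoord (l j : ℕ) (x : Pt l) : ℂ :=
  coord l j x - (if j = 1 then 0 else coord l (j - 1) x)

/-- `ξ_j = e^{2πi v_j} + e^{-2πi v_j}`. -/
def xi (l j : ℕ) (x : Pt l) : ℂ :=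
  Complex.exp (2 * Real.pi * Complex.I * vCoord l j x) +
    Complex.exp (-(2 * Real.pi * Complex.I * vCoord l j x))

/-- `d_j = (ω_j, ω_k)`, which is `min j k` for `C_l`. -/
def dDeg (k j : ℕ) : ℕ := min j k

/-- The basic invariants `e^{2πi d_j x_{l+1}} σ_j(ξ_1, …, ξ_l)`, for `1 ≤ j ≤ l`. -/
def yTilde (l k j : ℕ) (x : Pt l) : ℂ :=
  Complex.exp (2 * Real.pi * Complex.I * dDeg k j * coord l (l + 1) x) *
    ((Finset.Icc 1 l).val.map (fun i => xi l i x)).esymm j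

/-- The projection `x ↦ y`: `y^j` is the `j`-th basic invariant for `j ≤ l`, and
`y^{l+1} = 2πi x_{l+1}`. -/
def proj (l k : ℕ) (x : Pt l) : Pt l := fun a =>
  if a.val + 1 ≤ l then yTilde l k (a.val + 1) x
  else 2 * Real.pi * Complex.I * coord l (l + 1) x

/-- The metric on the cotangent spaces of `V ⊕ ℝ`: `(dx_s, dx_n) = min(s,n)/(4π²)` for
`s, n ≤ l`, `(dx_s, dx_{l+1}) = 0` for `s ≤ l` and `(dx_{l+1}, dx_{l+1}) = -1/(4kπ²)`. -/
def metricX (l k : ℕ) : Tensor2 l := fun a b _ =>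
  if a.val + 1 ≤ l ∧ b.val + 1 ≤ l then (min (a.val + 1) (b.val + 1) : ℕ) / (4 * Real.pi ^ 2)
  else if a.val + 1 = l + 1 ∧ b.val + 1 = l + 1 then -1 / (4 * k * Real.pi ^ 2)
  else 0

/-- `g` is the form `g^{ij}(y) = ∑ (∂y^i/∂x^a) (∂y^j/∂x^b) (dx^a, dx^b)` induced by the
projection.  The projection is onto, so there is at most one such `g`. -/
def IsIntersectionForm (l k : ℕ) (g : Tensor2 l) : Prop :=
  ∀ x i j, g i j (proj l k x) =
    pairing (metricX l k) (fun x' => proj l k x' i) (fun x' => proj l k x' j) x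

/-- `c_j`, where `∑_{j=k}^l c_j u^{l-j} = (u+2)^m (u-2)^{l-k-m}`. -/
def cCoef (l k m j : ℕ) : ℂ :=
  ((X + C 2) ^ m * (X - C 2) ^ (l - k - m) : ℂ[X]).coeff (l - j)

/-- The vector field `e = ∑_{j=k}^l c_j ∂/∂y^j`. -/
def unityField (l k m : ℕ) : Fin (l + 1) → Pt l → ℂ := fun a _ =>
  if k ≤ a.val + 1 ∧ a.val + 1 ≤ l then cCoef l k m (a.val + 1) else 0

/-- `η^{ij} = L_e g^{ij}`. -/
def etaForm (l k m : ℕ) (g : Tensor2 l) : Tensor2 l := lieDeriv (unityField l k m) g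

/-! ### The coordinates `τ`, `z`, `w`, `t`

A system of functions is a family `f : ℕ → Pt l → ℂ` of functions of the point `y`; its members
`f 1, …, f (l+1)` are the ones that matter. -/

/-- For a system `f^1, …, f^{l+1}`: the functions `e^{k f^{l+1}}` for `j = 0`,
`f^j e^{(k-j) f^{l+1}}` for `1 ≤ j ≤ k-1`, and `f^j` for `k ≤ j ≤ l`. For `f = y` these are the
`θ^j`, and for `f = τ` the `ϖ^j`. -/
def twist (l k : ℕ) (f : ℕ → Pt l → ℂ) (j : ℕ) (y : Pt l) : ℂ :=
  if j = 0 then Complex.exp (k * f (l + 1) y)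
  else if j < k then f j y * Complex.exp (((k : ℂ) - j) * f (l + 1) y)
  else f j y

/-- `τ^1, …, τ^{l+1}` are the coordinates defined by `τ^{l+1} = y^{l+1}` and the polynomial
identity in `u` that expresses the `θ^j` through the `ϖ^j`. -/
def IsTau (l k m : ℕ) (τ : ℕ → Pt l → ℂ) : Prop :=
  ∀ y, τ (l + 1) y = coord l (l + 1) y ∧
    (∑ j ∈ Finset.Icc 0 l, C (twist l k (coord l) j y) * X ^ (l - j) : ℂ[X]) =
      (∑ j ∈ Finset.Icc 0 (l - m),
        C (twist l k τ j y) * ((X + C 2) ^ m * (X - C 2) ^ (l - m - j))) -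
      ∑ j ∈ Finset.Icc (l - m + 1) l,
        C (twist l k τ j y) * ((X + C 2) ^ (l - j) * (X - C 2) ^ (j - k - 1))

/-- The entry `(i, j)`, `b < i, j ≤ e`, of a block in the normal form: `4 s z^{b+s}` with
`s = (i-b) + (j-b) - 1`, and `0` if `b + s > e`. -/
def blockEntry {l : ℕ} (b e : ℕ) (z : ℕ → Pt l → ℂ) (i j : ℕ) (y : Pt l) : ℂ :=
  if i + j - b - 1 ≤ e then 4 * ((i + j - 2 * b - 1 : ℕ) : ℂ) * z (i + j - b - 1) y else 0

/-- The normal form of the matrix `(η^{ij}(z))`. -/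
def normalForm (l k m : ℕ) (z : ℕ → Pt l → ℂ) (i j : ℕ) (y : Pt l) : ℂ :=
  if i < k ∧ j < k then (if i + j = k then (k : ℂ) else 0)
  else if (i = k ∧ j = l + 1) ∨ (i = l + 1 ∧ j = k) then 1
  else if (k < i ∧ i ≤ l - m) ∧ (k < j ∧ j ≤ l - m) then blockEntry k (l - m) z i j y
  else if (l - m < i ∧ i ≤ l) ∧ (l - m < j ∧ j ≤ l) then blockEntry (l - m) l z i j y
  else 0

/-- `z^j` in terms of `τ`, of polynomials `p_j` (whose variable `0` stands for `e^{τ^{l+1}}`, and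
whose variable `i ≥ 1` for `τ^i`) and of constants `c^j_s`. -/
def zCoord (l k m : ℕ) (τ : ℕ → Pt l → ℂ) (p : ℕ → MvPolynomial ℕ ℂ) (c : ℕ → ℕ → ℂ)
    (j : ℕ) (y : Pt l) : ℂ :=
  if j ≤ k then
    τ j y + MvPolynomial.eval (fun i => if i = 0 then Complex.exp (τ (l + 1) y) else τ i y) (p j)
  else if j ≤ l - m then τ j y + ∑ s ∈ Finset.Icc (j + 1) (l - m), c j s * τ s y
  else if j ≤ l then τ j y + ∑ s ∈ Finset.Icc (j + 1) l, c j s * τ s y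
  else τ j y

/-- `z` is a system of coordinates of the triangular shape above, where `p_j` is a weighted
homogeneous polynomial of degree `d_j` in `e^{τ^{l+1}}, τ^1, …, τ^{j-1}`
(with `deg τ^i = d_i` and `deg e^{τ^{l+1}} = 1`), which brings `η` to the normal form. -/
def IsZ (l k m : ℕ) (η : Tensor2 l) (τ z : ℕ → Pt l → ℂ) : Prop :=
  (∃ (p : ℕ → MvPolynomial ℕ ℂ) (c : ℕ → ℕ → ℂ),
    (∀ j, 1 ≤ j → j ≤ k → (∀ i ∈ (p j).vars, i < j) ∧
      (p j).IsWeightedHomogeneous (fun i => if i = 0 then 1 else dDeg k i) (dDeg k j)) ∧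
    z = zCoord l k m τ p c) ∧
  ∀ i j, 1 ≤ i → i ≤ l + 1 → 1 ≤ j → j ≤ l + 1 → ∀ y,
    pairing η (z i) (z j) y = normalForm l k m z i j y

/-- `r` is a holomorphic branch on `U` of `(z^e)^{1/(2(e-b))}`, where `z^e` has no zero on `U`
(no condition if the block `b+1, …, e` is empty). -/
def IsBranch {l : ℕ} (b e : ℕ) (z : ℕ → Pt l → ℂ) (U : Set (Pt l)) (r : Pt l → ℂ) : Prop :=
  b < e → DifferentiableOn ℂ r U ∧ ∀ y ∈ U, z e y ≠ 0 ∧ r y ^ (2 * (e - b)) = z e y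

/-- The coordinates `w^s` for `s` in the block `b+1, …, e`, where `r = (z^e)^{1/(2(e-b))}`:
`w^e = r`, `w^{b+1} = z^{b+1} (z^e)^{-1/(2(e-b))}` and `w^s = z^s (z^e)^{-(s-b)/(e-b)}` for
`b + 1 < s < e`. -/
def wBlock {l : ℕ} (b e : ℕ) (z : ℕ → Pt l → ℂ) (r : Pt l → ℂ) (s : ℕ) (y : Pt l) : ℂ :=
  if s = e then r y
  else if s = b + 1 then z s y * (r y)⁻¹
  else z s y * (r y ^ (2 * (s - b)))⁻¹

/-- The coordinates `w^1, …, w^{l+1}`, with `r₁ = (z^{l-m})^{1/(2(l-m-k))}` and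
`r₂ = (z^l)^{1/(2m)}`. -/
def wCoord (l k m : ℕ) (z : ℕ → Pt l → ℂ) (r₁ r₂ : Pt l → ℂ) (s : ℕ) (y : Pt l) : ℂ :=
  if s ≤ k then z s y
  else if s ≤ l - m then wBlock k (l - m) z r₁ s y
  else if s ≤ l then wBlock (l - m) l z r₂ s y
  else z s y

/-- The degrees of `w^s` in the block `b+1, …, e`, where all `z^s` have degree `k`. -/
def wBlockDeg (k b e s : ℕ) : ℚ :=
  if s = e then (k : ℚ) / (2 * ((e : ℚ) - b))
  else if s = b + 1 then (k : ℚ) - k / (2 * ((e : ℚ) - b))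
  else (k : ℚ) - k * ((s : ℚ) - b) / ((e : ℚ) - b)

/-- The degrees of `w^1, …, w^{l+1}` that result from `deg y^j = d_j`, `deg y^{l+1} = 0`. -/
def wDeg (l k m s : ℕ) : ℚ :=
  if s ≤ k then s
  else if s ≤ l - m then wBlockDeg k k (l - m) s
  else if s ≤ l then wBlockDeg k (l - m) l s
  else 0

/-- The requirements on the polynomials `h_j`, `b + 1 ≤ j ≤ e - 1`, of a block: `h_{e-1} = 0`, and
`h_j` is a polynomial in `w^{j+1}, …, w^{e-1}` which is weighted homogeneous of degree
`k (e-j)/(e-b)`. -/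
def IsBlockPoly (k b e : ℕ) (deg : ℕ → ℚ) (h : ℕ → MvPolynomial ℕ ℂ) : Prop :=
  (b + 1 ≤ e - 1 → h (e - 1) = 0) ∧
  ∀ j, b + 1 ≤ j → j ≤ e - 1 →
    (∀ i ∈ (h j).vars, j + 1 ≤ i ∧ i ≤ e - 1) ∧
    (h j).IsWeightedHomogeneous deg ((k : ℚ) * ((e : ℚ) - j) / ((e : ℚ) - b))

/-- `t^s` for `s` in the block `b+1, …, e`: `t^e = w^e`, `t^{b+1} = w^{b+1} + w^e h_{b+1}`, and
`t^s = w^e (w^s + h_s)` for `b + 1 < s < e`. -/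
def tBlock {l : ℕ} (b e : ℕ) (h : ℕ → MvPolynomial ℕ ℂ) (w : ℕ → Pt l → ℂ) (s : ℕ)
    (y : Pt l) : ℂ :=
  if s = e then w e y
  else if s = b + 1 then w s y + w e y * MvPolynomial.eval (fun i => w i y) (h s)
  else w e y * (w s y + MvPolynomial.eval (fun i => w i y) (h s))

/-- The functions `t^1, …, t^{l+1}`. -/
def tCoord (l k m : ℕ) (h : ℕ → MvPolynomial ℕ ℂ) (w : ℕ → Pt l → ℂ) (s : ℕ) (y : Pt l) : ℂ :=
  if s ≤ k then w s y
  else if s ≤ l - m then tBlock k (l - m) h w s y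
  else if s ≤ l then tBlock (l - m) l h w s y
  else w s y

/-- `t^1, …, t^{l+1}` is a system of holomorphic coordinates on `U` in which the components
`G(dt^i, dt^j)` of the metric `G` are constant (and form a nondegenerate matrix). -/
def IsFlatCoordinates {l : ℕ} (G : Tensor2 l) (U : Set (Pt l)) (t : ℕ → Pt l → ℂ) : Prop :=
  (∀ i : Fin (l + 1), DifferentiableOn ℂ (t (i.val + 1)) U) ∧
  Set.InjOn (fun y (i : Fin (l + 1)) => t (i.val + 1) y) U ∧
  (∀ y ∈ U, (Matrix.of fun i a : Fin (l + 1) => pd (t (i.val + 1)) a y).det ≠ 0) ∧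
  ∃ A : Matrix (Fin (l + 1)) (Fin (l + 1)) ℂ, A.det ≠ 0 ∧
    ∀ y ∈ U, ∀ i j, pairing G (t (i.val + 1)) (t (j.val + 1)) y = A i j

/-- On `U`, the function `f` is algebraic over `ℂ[e^{τ^{l+1}}, τ^1, …, τ^{l+1}]`. -/
def IsAlgebraicOn (l : ℕ) (τ : ℕ → Pt l → ℂ) (U : Set (Pt l)) (f : Pt l → ℂ) : Prop :=
  ∃ Q : Polynomial (MvPolynomial (Fin (l + 2)) ℂ), Q ≠ 0 ∧ ∀ y ∈ U,
    (Q.map (MvPolynomial.eval fun i : Fin (l + 2) =>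
      if i.val = 0 then Complex.exp (τ (l + 1) y) else τ i.val y)).eval (f y) = 0

end

end ExtAffineC

/-!
The computation takes place in the polynomial `P(u) = ∑ θ^j u^{l-j}`, which in the coordinates `x`
is `e^{2πi k x_{l+1}} ∏ (u + ξ_i)`. The metric on its values has a closed form
(`bil_metricX_upPoly`),
`(dP(u), dP(v)) = (k-l) P(u)P(v) + ((u²-4) P'(u)P(v) - (v²-4) P(u)P'(v))/(u-v)`,
whose right-hand side depends on `y` alone, so that `g` exists. The field `e` moves `P` in the
direction of the fixed polynomial `E = (u+2)^m (u-2)^{l-k-m}`, and `η` is the polarization of this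
quadratic expression (`bil_etaForm_twistPoly`). For `f = P/E` it becomes
`η(df(u), df(v)) = (Df(u) - Df(v))/(u-v)` with `D = (u²-4) d/du`.

The `ϖ^j` are the coefficients of `f` in the functions `(u-2)^s`, `(u-2)^{-(s+1)}` and
`-(u-2)^s (u+2)^{-(s+1)}`. For `f` in one of these three families, `(Df(u) - Df(v))/(u-v)` is a
combination of products `f_a(u) f_b(v)` of members of the same family, so `η` is block diagonal, with
three Hankel blocks that are linear in the `ϖ^j` (`bil_etaForm_fam`). A Hankel form is a linear
functional of the product of two generating series. A substitution in that series, found from a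
differential equation, is a unitriangular linear change of the `ϖ^j` and brings each block to the
normal form with entries proportional to a single function (`exists_change_one`,
`exists_change_two`, `exists_change_poly`). For the last two families this gives `z^{k+1}, …, z^l`.

The nonlinear changes of coordinates rest on one observation. Let the functions `F_i` be, up to
factors, the coefficients of `X^i` in powers `V^{N-i}` (or `V^{2(n-i)}`) of a generating polynomial
`V` of functions `a_j`, or of its exponential. Then the differentials of the `F_i` are Toeplitz
combinations of the `da_j`, the products of two Toeplitz matrices are again built from powers of
`V`, and a constant antidiagonal matrix of `η` in the `a_j` corresponds exactly to a Hankel matrix in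
the `F_i` (`sum_antidiagonal_gram`). In the first family `V` is the exponential of
`y^{l+1} + ∑ (z^i/k) X^i` (`gradient_normFam_first`, `bil_etaForm_ell`). In a block of size `n` it
is `t^e + ∑ (t^{e-j}/(2n)) X^j` (`coeff_blockGen_pow`, `gradient_z_block`, `bil_etaForm_flatFam`).
Solving these triangular systems for the `a_j` (`triInv`) gives the polynomials `p_j` and `h_j`
together with their variables and degrees.

The constant matrix of `η` in the `t^i` has a single nonzero entry in each row, hence is
nondegenerate; as it factors through the Jacobian matrix of `t`, the latter is invertible. The `t^i`
determine `z`, then `τ`, then `y`, which gives injectivity (`isFlatCoordinates_of_blockRel`).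
The `t^i` are algebraic since they are polynomials in the `z^j`, the roots of `z^{l-m}` and `z^l`,
and their inverses.
-/

namespace ExtAffineC

open Finset

/-! ### Power series and Hankel matrices -/

section Series

open PowerSeries

/-- The inverse square root of `1 + aw` exists as a power series with constant coefficient `1`. -/
theorem exists_inv_sqrt_series (a : ℂ) :
    ∃ γ : PowerSeries ℂ, constantCoeff γ = 1 ∧ (1 + C a * X) * γ ^ 2 = 1 := by
  refine ⟨rescale a (PowerSeries.binomialSeries ℂ (-1 / 2 : ℚ)), ?_, ?_⟩
  · rw [← coeff_zero_eq_constantCoeff_apply, coeff_rescale]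
    simp
  · have h : (1 + X) * PowerSeries.binomialSeries ℂ (-1 / 2 : ℚ) ^ 2 = 1 := by
      have h1 : PowerSeries.binomialSeries ℂ ((1 : ℕ) : ℚ) = (1 + X : PowerSeries ℂ) ^ 1 :=
        binomialSeries_nat 1
      rw [pow_one] at h1
      rw [← h1, sq, ← binomialSeries_add, ← binomialSeries_add]
      norm_num [PowerSeries.binomialSeries_zero]
    have := congrArg (rescale a) h
    simpa [map_mul, map_add, rescale_X] using this

/-- Every power series is the derivative of one without constant coefficient. -/
theorem exists_primitive_series (δ : PowerSeries ℂ) :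
    ∃ ε : PowerSeries ℂ, constantCoeff ε = 0 ∧ d⁄dX ℂ ε = δ := by
  refine ⟨X * PowerSeries.mk fun n => coeff n δ / (n + 1), by simp, ?_⟩
  ext n
  rw [coeff_derivative, coeff_succ_X_mul, coeff_mk]
  have : (n : ℂ) + 1 ≠ 0 := by exact_mod_cast n.succ_ne_zero
  field_simp

/-- A logarithmic derivative may be prescribed. -/
theorem exists_series_derivative_eq_mul (δ : PowerSeries ℂ) :
    ∃ ψ : PowerSeries ℂ, constantCoeff ψ = 1 ∧ d⁄dX ℂ ψ = δ * ψ := by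
  obtain ⟨ε, h0, h1⟩ := exists_primitive_series δ
  have hs : HasSubst ε := HasSubst.of_constantCoeff_zero' h0
  refine ⟨(exp ℂ).subst ε, ?_, ?_⟩
  · rw [← coeff_zero_eq_constantCoeff_apply, coeff_subst' hs, finsum_eq_single _ 0]
    · simp
    · intro n hn
      simp [h0, hn]
  · rw [derivative_subst hs, h1, mul_comm]
    congr 2
    ext n
    rw [coeff_derivative, coeff_exp, coeff_exp]
    have h2 : ((n.factorial : ℚ)) ≠ 0 := by exact_mod_cast n.factorial_ne_zero
    have h3 : (n : ℚ) + 1 ≠ 0 := by exact_mod_cast n.succ_ne_zero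
    have : ((n : ℂ) + 1) = algebraMap ℚ ℂ (n + 1) := by simp
    rw [this, ← map_mul]
    congr 1
    rw [Nat.factorial_succ]
    push_cast
    field_simp

/-- The equation `β + 2wβ' = γ` is solvable in power series. -/
theorem exists_series_half_integral (γ : PowerSeries ℂ) :
    ∃ β : PowerSeries ℂ, constantCoeff β = constantCoeff γ ∧ β + 2 * X * d⁄dX ℂ β = γ := by
  refine ⟨PowerSeries.mk fun n => coeff n γ / (2 * n + 1), ?_, ?_⟩
  · rw [← coeff_zero_eq_constantCoeff_apply, coeff_mk]; simp
  · ext n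
    have h2 : (2 : PowerSeries ℂ) = C 2 := (map_ofNat C 2).symm
    rcases n with _ | n
    · rw [map_add, mul_assoc, h2, coeff_C_mul, coeff_zero_X_mul, coeff_mk]; simp
    · rw [map_add, mul_assoc, h2, coeff_C_mul, coeff_succ_X_mul, coeff_derivative, coeff_mk]
      have : (2 * (n : ℂ) + 3) ≠ 0 := by
        exact_mod_cast (show (2 * n + 3) ≠ 0 by omega)
      have h3 : ((n + 1 : ℕ) : ℂ) = n + 1 := by push_cast; rfl
      rw [h3]
      rw [show 2 * ((n : ℂ) + 1) + 1 = 2 * n + 3 by ring]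
      generalize coeff (n + 1) γ = x
      field_simp
      ring

/-- The equation `w a(w) χ'² = χ` has a solution `χ = w + …`: if `a γ² = 1`, it is `χ = wβ²` with
`β + 2wβ' = γ`. -/
theorem exists_block_series (a γ : PowerSeries ℂ) (hγ : constantCoeff γ = 1)
    (h : a * γ ^ 2 = 1) :
    ∃ χ ψ : PowerSeries ℂ, χ = X * ψ ∧ constantCoeff ψ = 1 ∧ constantCoeff (d⁄dX ℂ χ) = 1 ∧
      X * a * (d⁄dX ℂ χ) ^ 2 = χ := by
  obtain ⟨β, h0, h1⟩ := exists_series_half_integral γ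
  have h2 : d⁄dX ℂ (X * β ^ 2) = β * γ := by
    rw [Derivation.leibniz, derivative_X, derivative_pow, ← h1]
    simp only [smul_eq_mul]
    push_cast
    ring
  refine ⟨X * β ^ 2, β ^ 2, rfl, by simp [h0, hγ], by rw [h2]; simp [h0, hγ], ?_⟩
  rw [h2]
  linear_combination X * β ^ 2 * h

theorem coeff_shift_pow_mul {χ ψ : PowerSeries ℂ} (hχ : χ = X * ψ) (ρ : PowerSeries ℂ) (i s : ℕ)
    (hs : s < i) : coeff s (χ ^ i * ρ) = 0 := by
  rw [hχ, mul_pow, mul_assoc, coeff_X_pow_mul']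
  simp [hs]

theorem coeff_self_shift_pow_mul {χ ψ ρ : PowerSeries ℂ} (hχ : χ = X * ψ)
    (hψ : constantCoeff ψ = 1) (hρ : constantCoeff ρ = 1) (i : ℕ) :
    coeff i (χ ^ i * ρ) = 1 := by
  rw [hχ, mul_pow, mul_assoc, coeff_X_pow_mul']
  simp [hψ, hρ]

/-- The functional on power series that a sequence defines by pairing the first `n` coefficients. -/
noncomputable def trFun (n : ℕ) (c : ℕ → ℂ) : PowerSeries ℂ →ₗ[ℂ] ℂ :=
  ∑ s ∈ range n, c s • (coeff s : PowerSeries ℂ →ₗ[ℂ] ℂ)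

theorem trFun_apply (n : ℕ) (c : ℕ → ℂ) (f : PowerSeries ℂ) :
    trFun n c f = ∑ s ∈ range n, c s * coeff s f := by
  simp [trFun]

/-- A Hankel form in two sequences is a functional of the product of their generating series. -/
theorem sum_hankel (n : ℕ) (h a b : ℕ → ℂ) (hn : ∀ s, n ≤ s → h s = 0) :
    ∑ p ∈ range n, ∑ q ∈ range n, a p * b q * h (p + q) =
      ∑ s ∈ range n, h s * ∑ x ∈ antidiagonal s, a x.1 * b x.2 := by
  rw [← sum_product']
  have h1 : ∑ x ∈ range n ×ˢ range n, a x.1 * b x.2 * h (x.1 + x.2) =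
      ∑ x ∈ (range n ×ˢ range n).filter (fun x => x.1 + x.2 ∈ range n),
        a x.1 * b x.2 * h (x.1 + x.2) := by
    rw [sum_filter_of_ne]
    intro x _ hx
    by_contra hc
    exact hx (by rw [hn _ (by simpa using hc), mul_zero])
  rw [h1, ← sum_fiberwise_of_maps_to (t := range n) (g := fun x : ℕ × ℕ => x.1 + x.2)
    (fun x hx => (mem_filter.1 hx).2)]
  refine sum_congr rfl fun s hs => ?_
  rw [mul_sum]
  refine sum_congr ?_ ?_
  · ext ⟨p, q⟩
    simp only [mem_filter, mem_product, mem_range, HasAntidiagonal.mem_antidiagonal] at *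
    omega
  · intro x hx
    rw [HasAntidiagonal.mem_antidiagonal] at hx
    rw [hx]; ring

theorem sum_hankel_coeff (n : ℕ) (h : ℕ → ℂ) (f g : PowerSeries ℂ) (hn : ∀ s, n ≤ s → h s = 0) :
    ∑ p ∈ range n, ∑ q ∈ range n, coeff p f * coeff q g * h (p + q) = trFun n h (f * g) := by
  rw [sum_hankel n h _ _ hn, trFun_apply]
  simp_rw [coeff_mul]

theorem trFun_X_mul_derivative (n : ℕ) (c : ℕ → ℂ) (f : PowerSeries ℂ) :
    trFun n (fun s => s * c s) f = trFun n c (X * d⁄dX ℂ f) := by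
  rw [trFun_apply, trFun_apply]
  refine sum_congr rfl fun s _ => ?_
  rcases s with _ | s
  · simp
  · rw [coeff_succ_X_mul, coeff_derivative]; push_cast; ring

theorem trFun_succ_derivative (n : ℕ) (c : ℕ → ℂ) (f : PowerSeries ℂ) :
    trFun n (fun s => (s + 1 : ℕ) * c s) f = trFun n c (d⁄dX ℂ (X * f)) := by
  rw [trFun_apply, trFun_apply]
  refine sum_congr rfl fun s _ => ?_
  rw [coeff_derivative, coeff_succ_X_mul]; push_cast; ring

theorem trFun_shift (n : ℕ) (c : ℕ → ℂ) (f : PowerSeries ℂ) (hc : ∀ s, n ≤ s → c s = 0) :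
    trFun n (fun s => c (s + 1)) f = trFun n c (X * f) := by
  rw [trFun_apply, trFun_apply]
  rcases n with _ | n
  · simp
  · rw [sum_range_succ, sum_range_succ' (n := n), hc _ le_rfl]
    simp [coeff_succ_X_mul]

/-- The matrix of `η` in the coefficients `c s` of the functions `(u-2)^{-(s+1)}`. -/
def gramOne (c : ℕ → ℂ) (p q : ℕ) : ℂ :=
  4 * (p + q + 1 : ℕ) * c (p + q) + (p + q + 2 : ℕ) * c (p + q + 1)

/-- The matrix of `η` in the coefficients `c s` of the functions `-(u-2)^s (u+2)^{-(s+1)}`. -/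
def gramTwo (c : ℕ → ℂ) (p q : ℕ) : ℂ :=
  4 * (p + q + 1 : ℕ) * (c (p + q) - c (p + q + 1))

/-- The matrix of `η` in the coefficients `c s` of the polynomials `(u-2)^s`. -/
def gramPoly (c : ℕ → ℂ) (p q : ℕ) : ℂ :=
  (p + q : ℕ) * c (p + q) + 4 * (p + q + 1 : ℕ) * c (p + q + 1)

theorem sum_gramOne (n : ℕ) (c : ℕ → ℂ) (hc : ∀ s, n ≤ s → c s = 0) (f g : PowerSeries ℂ) :
    ∑ p ∈ range n, ∑ q ∈ range n, coeff p f * coeff q g * gramOne c p q =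
      trFun n c (d⁄dX ℂ (X * (4 + X) * (f * g))) := by
  let d : ℕ → ℂ := fun t => (t + 1 : ℕ) * c t
  have hd : ∀ s, n ≤ s → d s = 0 := fun s hs => by simp [d, hc s hs]
  have h := sum_hankel_coeff n (fun s => 4 * (s + 1 : ℕ) * c s + (s + 2 : ℕ) * c (s + 1)) f g
    (by intro s hs; simp [hc s hs, hc (s + 1) (by omega)])
  have e1 : d⁄dX ℂ (X * (4 + X) * (f * g)) =
      C 4 * d⁄dX ℂ (X * (f * g)) + (X * d⁄dX ℂ (X * (f * g)) + X * (f * g)) := by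
    have h4 : C (4 : ℂ) = (4 : PowerSeries ℂ) := map_ofNat C 4
    have h5 : d⁄dX ℂ (4 : PowerSeries ℂ) = 0 := by rw [← h4]; exact derivative_C
    rw [h4]
    simp only [Derivation.leibniz, smul_eq_mul, derivative_X, map_add, h5]
    ring
  have e2 : trFun n (fun s => 4 * (s + 1 : ℕ) * c s + (s + 2 : ℕ) * c (s + 1)) (f * g) =
      4 * trFun n (fun s => (s + 1 : ℕ) * c s) (f * g) +
        trFun n (fun s => d (s + 1)) (f * g) := by
    simp only [trFun_apply, mul_sum, ← sum_add_distrib]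
    refine sum_congr rfl fun s _ => ?_
    simp only [d]; push_cast; ring
  rw [e1, map_add, ← smul_eq_C_mul, map_smul, ← trFun_succ_derivative, smul_eq_mul]
  refine (h.trans e2).trans ?_
  rw [trFun_shift n d _ hd, trFun_succ_derivative n c (X * (f * g))]
  congr 2
  simp only [Derivation.leibniz, smul_eq_mul, derivative_X]
  ring

theorem sum_gramTwo (n : ℕ) (c : ℕ → ℂ) (hc : ∀ s, n ≤ s → c s = 0) (f g : PowerSeries ℂ) :
    ∑ p ∈ range n, ∑ q ∈ range n, coeff p f * coeff q g * gramTwo c p q =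
      trFun n c (4 * (1 - X) * d⁄dX ℂ (X * (f * g))) := by
  let d : ℕ → ℂ := fun t => t * c t
  have hd : ∀ s, n ≤ s → d s = 0 := fun s hs => by simp [d, hc s hs]
  have h := sum_hankel_coeff n (fun s => 4 * (s + 1 : ℕ) * (c s - c (s + 1))) f g
    (by intro s hs; simp [hc s hs, hc (s + 1) (by omega)])
  have e1 : 4 * (1 - X) * d⁄dX ℂ (X * (f * g)) =
      C 4 * (d⁄dX ℂ (X * (f * g)) - X * d⁄dX ℂ (X * (f * g))) := by
    have h4 : C (4 : ℂ) = (4 : PowerSeries ℂ) := map_ofNat C 4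
    rw [h4]; ring
  have e2 : trFun n (fun s => 4 * (s + 1 : ℕ) * (c s - c (s + 1))) (f * g) =
      4 * (trFun n (fun s => (s + 1 : ℕ) * c s) (f * g) -
        trFun n (fun s => d (s + 1)) (f * g)) := by
    simp only [trFun_apply, mul_sum, ← sum_sub_distrib]
    refine sum_congr rfl fun s _ => ?_
    simp only [d]; push_cast; ring
  rw [e1, ← smul_eq_C_mul, map_smul, map_sub, ← trFun_succ_derivative, smul_eq_mul]
  refine (h.trans e2).trans ?_
  rw [trFun_shift n d _ hd, trFun_X_mul_derivative n c (X * (f * g))]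

theorem sum_gramPoly (n : ℕ) (c : ℕ → ℂ) (hc : ∀ s, n ≤ s → c s = 0) (f g : PowerSeries ℂ) :
    ∑ p ∈ range n, ∑ q ∈ range n, coeff p f * coeff q g * gramPoly c p q =
      trFun n c (X * d⁄dX ℂ ((1 + 4 * X) * (f * g))) := by
  let d : ℕ → ℂ := fun t => t * c t
  have hd : ∀ s, n ≤ s → d s = 0 := fun s hs => by simp [d, hc s hs]
  have h := sum_hankel_coeff n (fun s => (s : ℕ) * c s + 4 * (s + 1 : ℕ) * c (s + 1)) f g
    (by intro s hs; simp [hc s hs, hc (s + 1) (by omega)])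
  have h4 : C (4 : ℂ) = (4 : PowerSeries ℂ) := map_ofNat C 4
  have h5 : d⁄dX ℂ (4 : PowerSeries ℂ) = 0 := by rw [← h4]; exact derivative_C
  have e1 : X * d⁄dX ℂ ((1 + 4 * X) * (f * g)) =
      X * d⁄dX ℂ (f * g) + C 4 * (X * d⁄dX ℂ (X * (f * g))) := by
    rw [h4]
    have : (1 + 4 * X) * (f * g) = f * g + 4 * (X * (f * g)) := by ring
    rw [this, map_add, Derivation.leibniz (d⁄dX ℂ) (4 : PowerSeries ℂ), h5]
    simp only [smul_eq_mul]
    ring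
  have e2 : trFun n (fun s => (s : ℕ) * c s + 4 * (s + 1 : ℕ) * c (s + 1)) (f * g) =
      trFun n (fun s => (s : ℂ) * c s) (f * g) +
        4 * trFun n (fun s => d (s + 1)) (f * g) := by
    simp only [trFun_apply, mul_sum, ← sum_add_distrib]
    refine sum_congr rfl fun s _ => ?_
    simp only [d]; push_cast; ring
  rw [e1, map_add, ← smul_eq_C_mul, map_smul, ← trFun_X_mul_derivative, smul_eq_mul]
  refine (h.trans e2).trans ?_
  rw [trFun_shift n d _ hd, trFun_X_mul_derivative n c (X * (f * g))]

/-- A unitriangular change of coordinates that brings `gramOne` to normal form. With series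
`G i = χ^i χ'`, the normal form amounts to the equation `w (4 + w) χ'² = 4χ`. -/
theorem exists_change_one : ∃ G : ℕ → PowerSeries ℂ,
    (∀ i s, s < i → coeff s (G i) = 0) ∧ (∀ i, coeff i (G i) = 1) ∧
    ∀ (n : ℕ) (c : ℕ → ℂ), (∀ s, n ≤ s → c s = 0) → ∀ i j,
      ∑ p ∈ range n, ∑ q ∈ range n, coeff p (G i) * coeff q (G j) * gramOne c p q =
        4 * (i + j + 1 : ℕ) * trFun n c (G (i + j)) := by
  obtain ⟨γ, hγ, h⟩ := exists_inv_sqrt_series (1 / 4)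
  obtain ⟨χ, ψ, hχ, hψ, hd, h'⟩ := exists_block_series _ γ hγ h
  have h4 : C (4 : ℂ) = (4 : PowerSeries ℂ) := map_ofNat C 4
  have h44 : (4 : PowerSeries ℂ) * C (1 / 4 : ℂ) = 1 := by
    rw [← h4, ← map_mul]; norm_num
  have key : X * (4 + X) * (d⁄dX ℂ χ) ^ 2 = 4 * χ := by
    linear_combination 4 * h' - X ^ 2 * (d⁄dX ℂ χ) ^ 2 * h44
  refine ⟨fun i => χ ^ i * d⁄dX ℂ χ, fun i s hs => coeff_shift_pow_mul hχ _ i s hs,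
    fun i => coeff_self_shift_pow_mul hχ hψ hd i, fun n c hc i j => ?_⟩
  rw [sum_gramOne n c hc]
  have e : X * (4 + X) * (χ ^ i * d⁄dX ℂ χ * (χ ^ j * d⁄dX ℂ χ)) = C 4 * χ ^ (i + j + 1) := by
    rw [h4]; linear_combination χ ^ (i + j) * key
  rw [e, ← smul_eq_C_mul, (d⁄dX ℂ).map_smul, map_smul, derivative_pow]
  rw [show ((i + j + 1 : ℕ) : PowerSeries ℂ) * χ ^ (i + j + 1 - 1) * d⁄dX ℂ χ =
    ((i + j + 1 : ℕ) : ℂ) • (χ ^ (i + j) * d⁄dX ℂ χ) by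
      rw [smul_eq_C_mul, map_natCast, Nat.add_sub_cancel]; ring]
  rw [map_smul, smul_eq_mul, smul_eq_mul]
  ring

/-- A unitriangular change of coordinates that brings `gramTwo` to normal form. With series
`G i = χ^i χ' (1 - w)`, the normal form amounts to the equation `w (1 - w)² χ'² = χ`. -/
theorem exists_change_two : ∃ G : ℕ → PowerSeries ℂ,
    (∀ i s, s < i → coeff s (G i) = 0) ∧ (∀ i, coeff i (G i) = 1) ∧
    ∀ (n : ℕ) (c : ℕ → ℂ), (∀ s, n ≤ s → c s = 0) → ∀ i j,
      ∑ p ∈ range n, ∑ q ∈ range n, coeff p (G i) * coeff q (G j) * gramTwo c p q =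
        4 * (i + j + 1 : ℕ) * trFun n c (G (i + j)) := by
  have hg : constantCoeff (1 - X : PowerSeries ℂ) ≠ 0 := by simp
  obtain ⟨χ, ψ, hχ, hψ, hd, h'⟩ := exists_block_series ((1 - X) ^ 2) (1 - X)⁻¹ (by simp) (by
    rw [← mul_pow, PowerSeries.mul_inv_cancel _ hg, one_pow])
  refine ⟨fun i => χ ^ i * (d⁄dX ℂ χ * (1 - X)), fun i s hs => coeff_shift_pow_mul hχ _ i s hs,
    fun i => coeff_self_shift_pow_mul hχ hψ (by simp [hd]) i, fun n c hc i j => ?_⟩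
  rw [sum_gramTwo n c hc]
  have h4 : C (4 : ℂ) = (4 : PowerSeries ℂ) := map_ofNat C 4
  have e : X * (χ ^ i * (d⁄dX ℂ χ * (1 - X)) * (χ ^ j * (d⁄dX ℂ χ * (1 - X)))) =
      χ ^ (i + j + 1) := by
    linear_combination χ ^ (i + j) * h'
  rw [e, derivative_pow]
  rw [show 4 * (1 - X) * (((i + j + 1 : ℕ) : PowerSeries ℂ) * χ ^ (i + j + 1 - 1) * d⁄dX ℂ χ) =
    (4 * ((i + j + 1 : ℕ) : ℂ)) • (χ ^ (i + j) * (d⁄dX ℂ χ * (1 - X))) by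
      rw [smul_eq_C_mul, map_mul, map_natCast, Nat.add_sub_cancel, h4]; ring]
  rw [map_smul, smul_eq_mul]

/-- A unitriangular change of coordinates that brings `gramPoly` to normal form. With series
`G i = π^i γ`, the normal form amounts to `(1 + 4w) γ² = 1` and `w π' = γ π`. -/
theorem exists_change_poly : ∃ G : ℕ → PowerSeries ℂ,
    (∀ i s, s < i → coeff s (G i) = 0) ∧ (∀ i, coeff i (G i) = 1) ∧
    ∀ (n : ℕ) (c : ℕ → ℂ), (∀ s, n ≤ s → c s = 0) → ∀ i j,
      ∑ p ∈ range n, ∑ q ∈ range n, coeff p (G i) * coeff q (G j) * gramPoly c p q =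
        (i + j : ℕ) * trFun n c (G (i + j)) := by
  obtain ⟨γ, hγ, h⟩ := exists_inv_sqrt_series 4
  have h4 : C (4 : ℂ) = (4 : PowerSeries ℂ) := map_ofNat C 4
  rw [h4] at h
  obtain ⟨δ, hδ⟩ : X ∣ γ - 1 := X_dvd_iff.2 (by simp [hγ])
  obtain ⟨ψ, hψ, hψ'⟩ := exists_series_derivative_eq_mul δ
  have hπ : X * d⁄dX ℂ (X * ψ) = γ * (X * ψ) := by
    simp only [Derivation.leibniz, smul_eq_mul, derivative_X, hψ']
    linear_combination -X * ψ * hδ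
  refine ⟨fun i => (X * ψ) ^ i * γ, fun i s hs => coeff_shift_pow_mul rfl _ i s hs,
    fun i => coeff_self_shift_pow_mul rfl hψ hγ i, fun n c hc i j => ?_⟩
  rw [sum_gramPoly n c hc]
  have e : (1 + 4 * X) * ((X * ψ) ^ i * γ * ((X * ψ) ^ j * γ)) = (X * ψ) ^ (i + j) := by
    linear_combination (X * ψ) ^ (i + j) * h
  rw [e, derivative_pow]
  rcases hN : i + j with _ | N
  · simp
  rw [show X * (((N + 1 : ℕ) : PowerSeries ℂ) * (X * ψ) ^ (N + 1 - 1) * d⁄dX ℂ (X * ψ)) =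
    ((N + 1 : ℕ) : ℂ) • ((X * ψ) ^ (N + 1) * γ) by
      rw [smul_eq_C_mul, map_natCast, Nat.add_sub_cancel]
      linear_combination ((N + 1 : ℕ) : PowerSeries ℂ) * (X * ψ) ^ N * hπ]
  rw [map_smul, smul_eq_mul]

end Series

/-! ### Triangular systems -/

theorem eq_zero_of_triangular {n : ℕ} {J : ℕ → ℕ → ℂ}
    (hz : ∀ i j, i < n → j < n → i < j → J i j = 0) (hd : ∀ i < n, J i i ≠ 0) {c : ℕ → ℂ}
    (h : ∀ i < n, ∑ j ∈ range n, J i j * c j = 0) : ∀ j < n, c j = 0 := by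
  intro j
  induction j using Nat.strong_induction_on with
  | _ j ih =>
    intro hj
    have h1 := h j hj
    rw [sum_eq_single_of_mem j (mem_range.2 hj)] at h1
    · exact (mul_eq_zero.1 h1).resolve_left (hd j hj)
    · intro i hi hij
      rcases lt_or_gt_of_ne hij with h2 | h2
      · rw [ih i h2 (mem_range.1 hi), mul_zero]
      · rw [hz j i hj (mem_range.1 hi) h2, zero_mul]

/-- If each family `α κ` arises from `β κ` by an invertible triangular matrix `J κ`, the Gram matrix
of `β` is the one that `J` carries to the Gram matrix of `α`. -/
theorem gram_of_triangular {κ V : Type*} [AddCommGroup V] [Module ℂ V] (n : κ → ℕ)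
    (B : V →ₗ[ℂ] V →ₗ[ℂ] ℂ) (α β : κ → ℕ → V) (J : κ → ℕ → ℕ → ℂ)
    (hz : ∀ a i j, i < n a → j < n a → i < j → J a i j = 0) (hd : ∀ a, ∀ i < n a, J a i i ≠ 0)
    (hα : ∀ a, ∀ i < n a, α a i = ∑ j ∈ range (n a), J a i j • β a j) (A : κ → κ → ℕ → ℕ → ℂ)
    (h : ∀ a b i j, i < n a → j < n b → B (α a i) (α b j) =
      ∑ p ∈ range (n a), ∑ q ∈ range (n b), J a i p * J b j q * A a b p q)
    (a b : κ) (p q : ℕ) (hp : p < n a) (hq : q < n b) : B (β a p) (β b q) = A a b p q := by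
  have h1 : ∀ i j, i < n a → j < n b →
      ∑ p ∈ range (n a), J a i p *
        ∑ q ∈ range (n b), J b j q * (B (β a p) (β b q) - A a b p q) = 0 := by
    intro i j hi hj
    have := h a b i j hi hj
    rw [hα a i hi, hα b j hj] at this
    simp only [map_sum, map_smul, LinearMap.sum_apply, LinearMap.smul_apply, smul_eq_mul,
      mul_sum] at this
    rw [← sub_eq_zero, sum_comm, ← sum_sub_distrib] at this
    rw [← this]
    refine sum_congr rfl fun p _ => ?_
    rw [mul_sum, ← sum_sub_distrib]
    refine sum_congr rfl fun q _ => ?_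
    ring
  have h2 : ∀ j < n b, ∑ q ∈ range (n b), J b j q * (B (β a p) (β b q) - A a b p q) = 0 :=
    fun j hj => eq_zero_of_triangular (hz a) (hd a) (fun i hi => h1 i j hi hj) p hp
  exact sub_eq_zero.1 (eq_zero_of_triangular (hz b) (hd b) h2 q hq)

/-- Two families whose coefficient matrices have trivial kernel determine the Gram matrix. -/
theorem gram_of_injective {ι ν ν' V : Type*} [Fintype ι] [AddCommGroup V] [Module ℂ V]
    (B : V →ₗ[ℂ] V →ₗ[ℂ] ℂ) (α : ν → V) (α' : ν' → V) (β : ι → V) (F : ν → ι → ℂ)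
    (F' : ν' → ι → ℂ) (hF : ∀ c : ι → ℂ, (∀ a, ∑ i, F a i * c i = 0) → c = 0)
    (hF' : ∀ c : ι → ℂ, (∀ a, ∑ i, F' a i * c i = 0) → c = 0)
    (hα : ∀ a, α a = ∑ i, F a i • β i) (hα' : ∀ a, α' a = ∑ i, F' a i • β i) (A : ι → ι → ℂ)
    (h : ∀ a b, B (α a) (α' b) = ∑ i, ∑ j, F a i * F' b j * A i j) (i j : ι) :
    B (β i) (β j) = A i j := by
  have h1 : ∀ a b, ∑ i, F a i * ∑ j, F' b j * (B (β i) (β j) - A i j) = 0 := by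
    intro a b
    have := h a b
    rw [hα a, hα' b] at this
    simp only [map_sum, map_smul, LinearMap.sum_apply, LinearMap.smul_apply, smul_eq_mul,
      mul_sum] at this
    rw [← sub_eq_zero, sum_comm, ← sum_sub_distrib] at this
    rw [← this]
    refine sum_congr rfl fun p _ => ?_
    rw [mul_sum, ← sum_sub_distrib]
    refine sum_congr rfl fun q _ => ?_
    ring
  have h2 : (fun j => B (β i) (β j) - A i j) = 0 := hF' _ fun b =>
    congrFun (hF (fun i => ∑ j, F' b j * (B (β i) (β j) - A i j)) fun a => h1 a b) i
  exact sub_eq_zero.1 (congrFun h2 j)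

open Polynomial

theorem coeff_shift_mul_sum (N i i' : ℕ) (hi : i ≤ N) (hi' : i' ≤ N) (P Q : ℂ[X]) :
    ∑ j ∈ range (N + 1), (X ^ j * P).coeff i * (X ^ (N - j) * Q).coeff i' =
      if N ≤ i + i' then (P * Q).coeff (i + i' - N) else 0 := by
  simp only [coeff_X_pow_mul']
  split_ifs with h
  · rw [coeff_mul]
    rw [← sum_filter_of_ne (p := fun j => j ≤ i ∧ N - j ≤ i')]
    · refine sum_nbij' (fun j => (i - j, i' - (N - j))) (fun x => i - x.1) ?_ ?_ ?_ ?_ ?_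
      · intro j hj
        simp only [mem_filter, mem_range, HasAntidiagonal.mem_antidiagonal] at *
        omega
      · rintro ⟨p, q⟩ hx
        simp only [mem_filter, mem_range, HasAntidiagonal.mem_antidiagonal] at *
        omega
      · intro j hj
        simp only [mem_filter, mem_range] at *
        omega
      · rintro ⟨p, q⟩ hx
        simp only [HasAntidiagonal.mem_antidiagonal, Prod.mk.injEq] at *
        omega
      · intro j hj
        simp only [mem_filter] at hj
        rw [if_pos hj.2.1, if_pos hj.2.2]
    · intro j _ hne
      by_contra hc
      apply hne
      by_cases h1 : j ≤ i
      · rw [if_neg (fun h2 => hc ⟨h1, h2⟩), mul_zero]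
      · rw [if_neg h1, zero_mul]
  · refine sum_eq_zero fun j hj => ?_
    rw [mem_range] at hj
    by_cases h1 : j ≤ i
    · rw [if_neg (by omega : ¬ N - j ≤ i'), mul_zero]
    · rw [if_neg h1, zero_mul]

/-- The image of an antidiagonal Gram matrix under shifted coefficients of `P` and `Q` depends on
the product `PQ` only. -/
theorem sum_antidiagonal_gram (N i i' : ℕ) (hi : i ≤ N) (hi' : i' ≤ N) (P Q : ℂ[X]) (c : ℂ) :
    ∑ p ∈ range (N + 1), ∑ q ∈ range (N + 1), (X ^ p * P).coeff i * (X ^ q * Q).coeff i' *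
        (if p + q = N then c else 0) =
      if N ≤ i + i' then c * (P * Q).coeff (i + i' - N) else 0 := by
  have h := coeff_shift_mul_sum N i i' hi hi' P Q
  calc _ = ∑ p ∈ range (N + 1), c * ((X ^ p * P).coeff i * (X ^ (N - p) * Q).coeff i') := by
        refine sum_congr rfl fun p hp => ?_
        rw [mem_range] at hp
        rw [sum_eq_single_of_mem (N - p) (mem_range.2 (by omega))]
        · rw [if_pos (by omega)]; ring
        · intro q _ hq
          rw [if_neg (by omega), mul_zero]
    _ = _ := by
        rw [← mul_sum, h, mul_ite, mul_zero]

/-! ### Differentiating the coefficients of a polynomial that depends on a point -/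

/-- At `p` the function `f` is differentiable, with partial derivatives `v`. -/
def HasGrad {l : ℕ} (f : Pt l → ℂ) (v : Pt l) (p : Pt l) : Prop :=
  DifferentiableAt ℂ f p ∧ ∀ a, pd f a p = v a

section HasGrad

variable {l : ℕ} {f h : Pt l → ℂ} {v w p : Pt l}

theorem HasFDerivAt.hasGrad {f' : Pt l →L[ℂ] ℂ} (hf : HasFDerivAt f f' p) :
    HasGrad f (fun a => f' (Pi.single a 1)) p :=
  ⟨hf.differentiableAt, fun a => by rw [pd, hf.fderiv]⟩

theorem HasGrad.congr_grad (hf : HasGrad f v p) (e : v = w) : HasGrad f w p := e ▸ hf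

theorem HasGrad.const (c : ℂ) : HasGrad (fun _ => c) 0 p :=
  ⟨differentiableAt_const c, fun a => by simp [pd]⟩

theorem HasGrad.add (hf : HasGrad f v p) (hh : HasGrad h w p) :
    HasGrad (fun q => f q + h q) (v + w) p :=
  ⟨hf.1.fun_add hh.1, fun a => by
    rw [pd, fderiv_fun_add hf.1 hh.1, Pi.add_apply, ← hf.2, ← hh.2]; rfl⟩

theorem HasGrad.mul (hf : HasGrad f v p) (hh : HasGrad h w p) :
    HasGrad (fun q => f q * h q) (f p • w + h p • v) p :=
  ⟨hf.1.fun_mul hh.1, fun a => by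
    rw [pd, fderiv_fun_mul hf.1 hh.1, Pi.add_apply, Pi.smul_apply, Pi.smul_apply, ← hf.2,
      ← hh.2]; rfl⟩

theorem HasGrad.const_mul (c : ℂ) (hf : HasGrad f v p) : HasGrad (fun q => c * f q) (c • v) p :=
  ((HasGrad.const c).mul hf).congr_grad (by simp)

theorem HasGrad.cexp (hf : HasGrad f v p) :
    HasGrad (fun q => Complex.exp (f q)) (Complex.exp (f p) • v) p := by
  have h := HasFDerivAt.hasGrad hf.1.hasFDerivAt.cexp
  refine h.congr_grad ?_
  ext a
  rw [Pi.smul_apply, ← hf.2]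
  rfl

theorem HasGrad.sum {ι : Type*} (t : Finset ι) {f : ι → Pt l → ℂ} {v : ι → Pt l}
    (hf : ∀ i ∈ t, HasGrad (f i) (v i) p) :
    HasGrad (fun q => ∑ i ∈ t, f i q) (∑ i ∈ t, v i) p := by
  classical
  induction t using Finset.induction_on with
  | empty => simpa using HasGrad.const (0 : ℂ)
  | insert i t hi ih =>
    simp only [sum_insert hi]
    exact (hf i (mem_insert_self i t)).add (ih fun j hj => hf j (mem_insert_of_mem hj))

theorem HasGrad.congr_of_eventuallyEq (hf : HasGrad f v p) (e : h =ᶠ[nhds p] f) :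
    HasGrad h v p :=
  ⟨hf.1.congr_of_eventuallyEq e, fun a => by rw [pd, e.fderiv_eq]; exact hf.2 a⟩

theorem HasGrad.unique (hf : HasGrad f v p) (hf' : HasGrad f w p) : v = w :=
  funext fun a => (hf.2 a).symm.trans (hf'.2 a)

end HasGrad

section CoeffDeriv

variable {l : ℕ}

/-- The differentials of the coefficients of `S` at `y` are `∑_j [X^s](dS_j) ω_j`. -/
def HasCoeffDeriv (n : ℕ) (ω : ℕ → Pt l) (S : Pt l → ℂ[X]) (dS : ℕ → ℂ[X]) (y : Pt l) : Prop :=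
  ∀ s, HasGrad (fun y' => (S y').coeff s) (∑ j ∈ range n, (dS j).coeff s • ω j) y

variable {n : ℕ} {ω : ℕ → Pt l} {S T : Pt l → ℂ[X]} {dS dT : ℕ → ℂ[X]} {y : Pt l}

theorem HasCoeffDeriv.mul (hS : HasCoeffDeriv n ω S dS y) (hT : HasCoeffDeriv n ω T dT y) :
    HasCoeffDeriv n ω (fun y' => S y' * T y') (fun j => dS j * T y + S y * dT j) y := by
  intro s
  simp only [coeff_mul, coeff_add, add_smul, sum_smul, sum_add_distrib]
  rw [sum_comm, sum_comm (s := range n) (t := HasAntidiagonal.antidiagonal s),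
    ← sum_add_distrib]
  refine HasGrad.sum _ fun x _ => ((hS x.1).mul (hT x.2)).congr_grad ?_
  rw [add_comm, smul_sum, smul_sum]
  congr 1
  · refine sum_congr rfl fun j _ => ?_
    rw [smul_smul, mul_comm]
  · refine sum_congr rfl fun j _ => ?_
    rw [smul_smul]

theorem HasCoeffDeriv.const (P : ℂ[X]) : HasCoeffDeriv n ω (fun _ => P) (fun _ => 0) y := by
  intro s
  simpa using HasGrad.const (P.coeff s)

theorem HasCoeffDeriv.pow (hS : HasCoeffDeriv n ω S dS y) (r : ℕ) :
    HasCoeffDeriv n ω (fun y' => S y' ^ r) (fun j => (r : ℂ[X]) * S y ^ (r - 1) * dS j) y := by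
  induction r with
  | zero => simpa using HasCoeffDeriv.const (1 : ℂ[X])
  | succ r ih =>
    have h := ih.mul hS
    simp only [← pow_succ] at h
    convert h using 2 with j
    rcases r with _ | r
    · simp
    · simp only [Nat.add_sub_cancel]
      push_cast
      ring

theorem HasCoeffDeriv.sum {ι : Type*} (t : Finset ι) {S : ι → Pt l → ℂ[X]} {dS : ι → ℕ → ℂ[X]}
    (h : ∀ i ∈ t, HasCoeffDeriv n ω (S i) (dS i) y) :
    HasCoeffDeriv n ω (fun y' => ∑ i ∈ t, S i y') (fun j => ∑ i ∈ t, dS i j) y := by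
  intro s
  simp only [finsetSum_coeff, sum_smul]
  rw [sum_comm]
  exact HasGrad.sum _ fun i hi => h i hi s

theorem coeff_sum_C_mul_X_pow {R : Type*} [CommRing R] (t : Finset ℕ) (Z : ℕ → R) (s : ℕ) :
    (∑ i ∈ t, C (Z i) * X ^ i : R[X]).coeff s = if s ∈ t then Z s else 0 := by
  simp [coeff_C_mul, coeff_X_pow]

/-- The generating polynomial of functions whose differentials are the `ω_j`. -/
theorem HasCoeffDeriv.generating {t : Finset ℕ} (ht : t ⊆ range n) {c : ℕ → Pt l → ℂ}
    (hc : ∀ j ∈ t, HasGrad (c j) (ω j) y) :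
    HasCoeffDeriv n ω (fun y' => ∑ j ∈ t, C (c j y') * X ^ j)
      (fun j => if j ∈ t then X ^ j else 0) y := by
  intro s
  simp only [coeff_sum_C_mul_X_pow]
  by_cases hs : s ∈ t
  · simp only [hs, if_true]
    refine (hc s hs).congr_grad ?_
    rw [sum_eq_single_of_mem s (ht hs)]
    · simp [hs]
    · intro j _ hj
      split_ifs
      · rw [coeff_X_pow, if_neg (Ne.symm hj), zero_smul]
      · simp
  · simp only [hs, if_false]
    refine (HasGrad.const 0).congr_grad (sum_eq_zero fun j _ => ?_).symm
    split_ifs with h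
    · rw [coeff_X_pow, if_neg (fun e => hs (by rw [e]; exact h)), zero_smul]
    · simp

end CoeffDeriv

/-! ### Inverting a triangular polynomial system -/

/-- The solution of the system `[X^j] f_j(∑_{i ≥ 1} Z_i X^i) = A_j`, where `f_j = T + …` up to the
constant term. -/
noncomputable def triInv (A : ℕ → MvPolynomial ℕ ℂ) (f : ℕ → ℂ[X]) (j : ℕ) : MvPolynomial ℕ ℂ :=
  A j - (aeval (∑ i : Fin (j - 1), C (triInv A f (i + 1)) * X ^ (i.val + 1) :
    (MvPolynomial ℕ ℂ)[X]) (f j)).coeff j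
  termination_by j
  decreasing_by omega

/-- The nonlinear part of the equation number `j`. -/
noncomputable def triRem (A : ℕ → MvPolynomial ℕ ℂ) (f : ℕ → ℂ[X]) (j : ℕ) : MvPolynomial ℕ ℂ :=
  (aeval (∑ i ∈ Ico 1 j, C (triInv A f i) * X ^ i : (MvPolynomial ℕ ℂ)[X]) (f j)).coeff j

theorem triInv_eq (A : ℕ → MvPolynomial ℕ ℂ) (f : ℕ → ℂ[X]) (j : ℕ) :
    triInv A f j = A j - triRem A f j := by
  rw [triInv, triRem]
  congr 4
  rw [Fin.sum_univ_eq_sum_range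
    (fun i => (C (triInv A f (i + 1)) * X ^ (i + 1) : (MvPolynomial ℕ ℂ)[X])) (j - 1),
    sum_Ico_eq_sum_range]
  refine sum_congr rfl fun i _ => ?_
  rw [add_comm]

/-- A property of coefficients that is multiplicative in the degree passes to polynomial
expressions. -/
theorem coeff_aeval_induction {R : Type*} [CommRing R] [Algebra ℂ R] (Q : ℕ → R → Prop)
    (h0 : ∀ s, Q s 0) (h1 : Q 0 1) (hadd : ∀ s a b, Q s a → Q s b → Q s (a + b))
    (hsmul : ∀ s a (c : ℂ), Q s a → Q s (c • a))
    (hmul : ∀ s t a b, Q s a → Q t b → Q (s + t) (a * b)) (S : R[X]) (hS : ∀ s, Q s (S.coeff s))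
    (f : ℂ[X]) (s : ℕ) : Q s ((aeval S f).coeff s) := by
  have hsum : ∀ {ι : Type} (t : Finset ι) (s : ℕ) (g : ι → R), (∀ i ∈ t, Q s (g i)) →
      Q s (∑ i ∈ t, g i) := fun t s g hg =>
    Finset.sum_induction g (Q s) (hadd s) (h0 s) hg
  have hpow : ∀ r s, Q s ((S ^ r).coeff s) := by
    intro r
    induction r with
    | zero =>
      intro s
      rw [pow_zero, coeff_one]
      split_ifs with h
      · exact h ▸ h1
      · exact h0 s
    | succ r ih =>
      intro s
      rw [pow_succ, coeff_mul]
      refine hsum _ _ _ fun x hx => ?_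
      rw [HasAntidiagonal.mem_antidiagonal] at hx
      exact hx ▸ hmul _ _ _ _ (ih _) (hS _)
  rw [aeval_eq_sum_range, finsetSum_coeff]
  refine hsum _ _ _ fun r _ => ?_
  rw [coeff_smul]
  exact hsmul _ _ _ (hpow r s)

theorem triRem_induction (A : ℕ → MvPolynomial ℕ ℂ) (f : ℕ → ℂ[X])
    (Q : ℕ → MvPolynomial ℕ ℂ → Prop)
    (h0 : ∀ s, Q s 0) (h1 : Q 0 1) (hadd : ∀ s a b, Q s a → Q s b → Q s (a + b))
    (hsmul : ∀ s a (c : ℂ), Q s a → Q s (c • a))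
    (hmul : ∀ s t a b, Q s a → Q t b → Q (s + t) (a * b)) (j : ℕ)
    (hA : ∀ i, 1 ≤ i → i < j → Q i (A i)) :
    Q j (triRem A f j) := by
  induction j using Nat.strong_induction_on with
  | _ j ih =>
    rw [triRem]
    refine coeff_aeval_induction Q h0 h1 hadd hsmul hmul _ (fun s => ?_) _ _
    rw [coeff_sum_C_mul_X_pow]
    split_ifs with h
    · rw [mem_Ico] at h
      rw [triInv_eq, sub_eq_add_neg, ← neg_one_smul ℂ]
      exact hadd _ _ _ (hA s h.1 h.2)
        (hsmul _ _ _ (ih s h.2 fun i hi his => hA i hi (his.trans h.2)))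
    · exact h0 s

theorem triRem_isWeightedHomogeneous {M : Type*} [AddCommMonoid M] (A : ℕ → MvPolynomial ℕ ℂ)
    (f : ℕ → ℂ[X]) (w : ℕ → M) (d : M) (j : ℕ)
    (hA : ∀ i, 1 ≤ i → i < j → (A i).IsWeightedHomogeneous w (i • d)) :
    (triRem A f j).IsWeightedHomogeneous w (j • d) := by
  refine triRem_induction A f (fun s P => P.IsWeightedHomogeneous w (s • d))
    (fun s => MvPolynomial.isWeightedHomogeneous_zero ℂ w _)
    (by simpa using MvPolynomial.isWeightedHomogeneous_one ℂ w) (fun s a b ha hb => ha.add hb)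
    (fun s a c ha => ?_) (fun s t a b ha hb => ?_) j hA
  · rw [MvPolynomial.smul_eq_C_mul]; exact ha.C_mul c
  · rw [add_smul]; exact ha.mul hb

theorem triRem_mem {A : ℕ → MvPolynomial ℕ ℂ} (f : ℕ → ℂ[X])
    (𝒮 : Subalgebra ℂ (MvPolynomial ℕ ℂ)) (j : ℕ) (hA : ∀ i, 1 ≤ i → i < j → A i ∈ 𝒮) :
    triRem A f j ∈ 𝒮 :=
  triRem_induction A f (fun _ P => P ∈ 𝒮) (fun _ => 𝒮.zero_mem) 𝒮.one_mem
    (fun _ _ _ ha hb => 𝒮.add_mem ha hb) (fun _ _ c ha => 𝒮.smul_mem ha c)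
    (fun _ _ _ _ ha hb => 𝒮.mul_mem ha hb) j hA

theorem triRem_one (A : ℕ → MvPolynomial ℕ ℂ) (f : ℕ → ℂ[X]) : triRem A f 1 = 0 := by
  have h : (algebraMap ℂ (MvPolynomial ℕ ℂ)[X]) ((f 1).coeff 0) =
      C (algebraMap ℂ (MvPolynomial ℕ ℂ) ((f 1).coeff 0)) := rfl
  rw [triRem, Ico_self, sum_empty, ← coeff_zero_eq_aeval_zero', h, coeff_C]
  simp

theorem coeff_aeval_add_higher (f : ℂ[X]) (hf : f.coeff 1 = 1) (z : ℕ → ℂ) (j N : ℕ) (hj : 1 ≤ j)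
    (hN : j ≤ N) :
    (aeval (∑ i ∈ Ico 1 (N + 1), C (z i) * X ^ i : ℂ[X]) f).coeff j =
      z j + (aeval (∑ i ∈ Ico 1 j, C (z i) * X ^ i : ℂ[X]) f).coeff j := by
  set S : ℂ[X] := ∑ i ∈ Ico 1 (N + 1), C (z i) * X ^ i with hS
  set S' : ℂ[X] := ∑ i ∈ Ico 1 j, C (z i) * X ^ i with hS'
  obtain ⟨D, hD⟩ : X ^ j ∣ S - S' := by
    rw [X_pow_dvd_iff]
    intro d hd
    rw [coeff_sub, hS, hS', coeff_sum_C_mul_X_pow, coeff_sum_C_mul_X_pow]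
    simp only [mem_Ico]
    by_cases h1 : 1 ≤ d
    · rw [if_pos (by omega), if_pos (by omega), sub_self]
    · rw [if_neg (by omega), if_neg (by omega), sub_self]
  have hz : (S - S').coeff j = z j := by
    rw [coeff_sub, hS, hS', coeff_sum_C_mul_X_pow, coeff_sum_C_mul_X_pow, if_pos (by simp; omega),
      if_neg (by simp), sub_zero]
  obtain ⟨S'', h''⟩ : X ∣ S' := by
    rw [X_dvd_iff, hS', coeff_sum_C_mul_X_pow, if_neg (by simp)]
  obtain ⟨⟨K, hK⟩⟩ : Nonempty {K // (f.map (algebraMap ℂ ℂ[X])).eval (S' + (S - S')) = _} :=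
    ⟨(f.map (algebraMap ℂ ℂ[X])).binomExpansion S' (S - S')⟩
  obtain ⟨L, hL⟩ := (f.map (algebraMap ℂ ℂ[X])).derivative.sub_dvd_eval_sub S' 0
  have h0 : (f.map (algebraMap ℂ ℂ[X])).derivative.eval 0 = 1 := by
    rw [← coeff_zero_eq_eval_zero, coeff_derivative, coeff_map, hf]
    simp
  rw [h0, sub_zero] at hL
  rw [add_sub_cancel, eval_map_algebraMap, eval_map_algebraMap] at hK
  have hfin : aeval S f = aeval S' f + (S - S') + X ^ (j + 1) * (S'' * L * D + K * D ^ 2 *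
      X ^ (j - 1)) := by
    rw [hK, eq_add_of_sub_eq hL, hD, show S' * L = X * S'' * L by rw [h'']]
    obtain ⟨i, rfl⟩ : ∃ i, j = i + 1 := ⟨j - 1, by omega⟩
    simp only [Nat.add_sub_cancel]
    ring
  rw [hfin, coeff_add, coeff_add, hz, coeff_X_pow_mul', if_neg (by omega)]
  ring

/-- The values of the polynomials `triInv A f` solve the system. -/
theorem coeff_aeval_triInv (A : ℕ → MvPolynomial ℕ ℂ) (f : ℕ → ℂ[X]) (v : ℕ → ℂ) (j N : ℕ)
    (hf : (f j).coeff 1 = 1) (hj : 1 ≤ j) (hN : j ≤ N) :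
    (aeval (∑ i ∈ Ico 1 (N + 1), C (MvPolynomial.eval v (triInv A f i)) * X ^ i : ℂ[X])
      (f j)).coeff j = MvPolynomial.eval v (A j) := by
  rw [coeff_aeval_add_higher _ hf (fun i => MvPolynomial.eval v (triInv A f i)) j N hj hN]
  have h : MvPolynomial.eval v (triRem A f j) =
      (aeval (∑ i ∈ Ico 1 j, C (MvPolynomial.eval v (triInv A f i)) * X ^ i : ℂ[X])
        (f j)).coeff j := by
    rw [triRem]
    have e := aeval_algHom_apply (mapAlgHom (MvPolynomial.aeval v : MvPolynomial ℕ ℂ →ₐ[ℂ] ℂ))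
      (∑ i ∈ Ico 1 j, C (triInv A f i) * X ^ i : (MvPolynomial ℕ ℂ)[X]) (f j)
    have e' := congrArg (fun P : ℂ[X] => P.coeff j) e
    simp only [map_sum, map_mul, coe_mapAlgHom, Polynomial.map_C,
      Polynomial.map_X, map_pow, coeff_map] at e'
    simp only [MvPolynomial.coe_aeval_eq_eval] at e'
    exact e'.symm
  rw [← h, triInv_eq, map_sub]
  ring

/-! ### Bilinear forms on covectors -/

/-- The bilinear form on covectors at `p` that a contravariant tensor defines. -/
noncomputable def bil {l : ℕ} (G : Tensor2 l) (p : Pt l) : Pt l →ₗ[ℂ] Pt l →ₗ[ℂ] ℂ :=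
  Matrix.toLinearMap₂' ℂ (Matrix.of fun a b => G a b p)

theorem bil_apply {l : ℕ} (G : Tensor2 l) (p v w : Pt l) :
    bil G p v w = ∑ a, ∑ b, G a b p * v a * w b := by
  rw [bil, Matrix.toLinearMap₂'_apply]
  refine sum_congr rfl fun a _ => sum_congr rfl fun b _ => ?_
  simp only [Matrix.of_apply, smul_eq_mul]
  ring

theorem bil_single {l : ℕ} (G : Tensor2 l) (p : Pt l) (a b : Fin (l + 1)) :
    bil G p (Pi.single a 1) (Pi.single b 1) = G a b p := by
  rw [bil_apply]
  simp [Pi.single_apply]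

theorem pairing_eq_bil {l : ℕ} (G : Tensor2 l) {f h : Pt l → ℂ} {v w p : Pt l}
    (hf : HasGrad f v p) (hh : HasGrad h w p) : pairing G f h p = bil G p v w := by
  rw [bil_apply, pairing]
  simp_rw [hf.2, hh.2]

theorem HasGrad.prod {l : ℕ} {p : Pt l} {ι : Type*} [DecidableEq ι] (t : Finset ι)
    {f : ι → Pt l → ℂ} {v : ι → Pt l} (hf : ∀ i ∈ t, HasGrad (f i) (v i) p) :
    HasGrad (fun q => ∏ i ∈ t, f i q) (∑ i ∈ t, (∏ j ∈ t.erase i, f j p) • v i) p := by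
  induction t using Finset.induction_on with
  | empty => simpa using HasGrad.const (1 : ℂ)
  | insert i t hi ih =>
    simp only [prod_insert hi, sum_insert hi]
    refine ((hf i (mem_insert_self i t)).mul
      (ih fun j hj => hf j (mem_insert_of_mem hj))).congr_grad ?_
    rw [erase_insert hi, add_comm, smul_sum]
    congr 1
    refine sum_congr rfl fun j hj => ?_
    rw [erase_insert_of_ne (by rintro rfl; exact hi hj), prod_insert (by simp [hi]), smul_smul]

theorem hasGrad_coord {l j : ℕ} (h : j - 1 < l + 1) (p : Pt l) :
    HasGrad (coord l j) (Pi.single ⟨j - 1, h⟩ 1) p := by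
  have e : coord l j = fun q => q ⟨j - 1, h⟩ := by
    funext q; rw [coord, dif_pos h]
  rw [e]
  refine (HasFDerivAt.hasGrad (hasFDerivAt_apply (𝕜 := ℂ) (⟨j - 1, h⟩ : Fin (l + 1)) p)).congr_grad
    ?_
  ext a
  simp [Pi.single_apply, eq_comm]

/-! ### The metric in the coordinates `x` -/

/-- The bilinear expression that gives, for `P = Q = ∑ θ^j u^{l-j}`, the metric on the differentials
of the values `P(u)` and `P(v)`. It is meaningful for `u ≠ v` only. -/
noncomputable def metricExpr (l k : ℕ) (P Q : ℂ[X]) (u v : ℂ) : ℂ :=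
  ((k : ℂ) - l) * (P.eval u * Q.eval v) +
    ((u ^ 2 - 4) * (derivative P).eval u * Q.eval v -
      (v ^ 2 - 4) * P.eval u * (derivative Q).eval v) / (u - v)

/-- The covector `dx_s`, which is zero for `s = 0`. -/
noncomputable def dx (l s : ℕ) : Pt l := fun a => if a.val + 1 = s then 1 else 0

/-- The covector `dv_j = dx_j - dx_{j-1}`. -/
noncomputable def dv (l j : ℕ) : Pt l := dx l j - dx l (j - 1)

theorem dx_zero (l : ℕ) : dx l 0 = 0 := by
  ext a; simp [dx]

theorem dx_eq_single {l s : ℕ} (h1 : 1 ≤ s) (h : s - 1 < l + 1) :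
    dx l s = Pi.single ⟨s - 1, h⟩ 1 := by
  ext a
  rw [dx, Pi.single_apply]
  congr 1
  rw [Fin.ext_iff]
  simp only [eq_iff_iff]
  omega

theorem hasGrad_coord_dx {l s : ℕ} (h1 : 1 ≤ s) (h : s ≤ l + 1) (p : Pt l) :
    HasGrad (coord l s) (dx l s) p :=
  dx_eq_single h1 (by omega : s - 1 < l + 1) ▸ hasGrad_coord (by omega) p

theorem hasGrad_vCoord {l j : ℕ} (h1 : 1 ≤ j) (h2 : j ≤ l) (p : Pt l) :
    HasGrad (vCoord l j) (dv l j) p := by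
  have e : vCoord l j = fun x => coord l j x + (-1) * (if j = 1 then 0 else coord l (j - 1) x) := by
    funext x; rw [vCoord]; ring
  have h : HasGrad (fun x => if j = 1 then 0 else coord l (j - 1) x) (dx l (j - 1)) p := by
    by_cases hj1 : j = 1
    · simp only [hj1, if_true]
      exact (HasGrad.const 0).congr_grad (dx_zero l).symm
    · simp only [hj1, if_false]
      exact hasGrad_coord_dx (by omega) (by omega) p
  rw [e]
  refine ((hasGrad_coord_dx h1 (by omega) p).add (h.const_mul (-1))).congr_grad ?_
  rw [dv, neg_one_smul, sub_eq_add_neg]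

theorem hasGrad_xi {l j : ℕ} (h1 : 1 ≤ j) (h2 : j ≤ l) (x : Pt l) :
    HasGrad (xi l j) ((2 * Real.pi * Complex.I *
      (Complex.exp (2 * Real.pi * Complex.I * vCoord l j x) -
        Complex.exp (-(2 * Real.pi * Complex.I * vCoord l j x)))) • dv l j) x := by
  have h := (hasGrad_vCoord h1 h2 x).const_mul (2 * Real.pi * Complex.I)
  have h' := (hasGrad_vCoord h1 h2 x).const_mul (-(2 * Real.pi * Complex.I))
  have hh := h.cexp.add h'.cexp
  simp only [neg_mul] at hh
  refine hh.congr_grad ?_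
  rw [smul_smul, smul_smul, ← add_smul]
  congr 1
  ring

theorem bil_metricX_dx {l k : ℕ} (x : Pt l) {s n : ℕ} (hs : s ≤ l) (hn : n ≤ l) :
    bil (metricX l k) x (dx l s) (dx l n) = (min s n : ℕ) / (4 * (Real.pi : ℂ) ^ 2) := by
  rcases Nat.eq_zero_or_pos s with rfl | hs0
  · simp [dx_zero]
  rcases Nat.eq_zero_or_pos n with rfl | hn0
  · simp [dx_zero]
  rw [dx_eq_single hs0 (by omega), dx_eq_single hn0 (by omega), bil_single, metricX,
    if_pos (by simp only; omega)]
  simp only [Nat.sub_add_cancel hs0, Nat.sub_add_cancel hn0]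

theorem bil_metricX_dx_last {l k : ℕ} (x : Pt l) {s : ℕ} (hs : s ≤ l) :
    bil (metricX l k) x (dx l s) (dx l (l + 1)) = 0 ∧
      bil (metricX l k) x (dx l (l + 1)) (dx l s) = 0 := by
  rcases Nat.eq_zero_or_pos s with rfl | hs0
  · simp [dx_zero]
  rw [dx_eq_single hs0 (by omega), dx_eq_single (show 1 ≤ l + 1 by omega) (by omega), bil_single,
    bil_single, metricX, metricX, if_neg (by simp only; omega), if_neg (by simp only; omega),
    if_neg (by simp only; omega), if_neg (by simp only; omega)]
  exact ⟨rfl, rfl⟩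

theorem bil_metricX_last {l k : ℕ} (x : Pt l) :
    bil (metricX l k) x (dx l (l + 1)) (dx l (l + 1)) = -1 / (4 * k * (Real.pi : ℂ) ^ 2) := by
  rw [dx_eq_single (show 1 ≤ l + 1 by omega) (by omega), bil_single, metricX,
    if_neg (by simp only; omega), if_pos (by simp only; omega)]

/-- The `v_j` are orthogonal to each other. -/
theorem bil_metricX_dv {l k : ℕ} (x : Pt l) {i j : ℕ} (hi : 1 ≤ i) (hi' : i ≤ l) (hj : 1 ≤ j)
    (hj' : j ≤ l) :
    bil (metricX l k) x (dv l i) (dv l j) = if i = j then 1 / (4 * (Real.pi : ℂ) ^ 2) else 0 := by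
  simp only [dv, map_sub, LinearMap.sub_apply]
  rw [bil_metricX_dx x hi' hj', bil_metricX_dx x hi' (by omega), bil_metricX_dx x (by omega) hj',
    bil_metricX_dx x (by omega) (by omega), ← sub_div, ← sub_div, ← sub_div]
  have h : ((min i j : ℕ) - (min (i - 1) j : ℕ) - ((min i (j - 1) : ℕ) -
      (min (i - 1) (j - 1) : ℕ)) : ℤ) = if i = j then 1 else 0 := by
    split_ifs <;> omega
  have hc : ((min i j : ℕ) - (min (i - 1) j : ℕ) - ((min i (j - 1) : ℕ) -
      (min (i - 1) (j - 1) : ℕ)) : ℂ) = if i = j then 1 else 0 := by exact_mod_cast h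
  have e : (if i = j then 1 / (4 * (Real.pi : ℂ) ^ 2) else 0) =
      (if i = j then 1 else 0) / (4 * (Real.pi : ℂ) ^ 2) := by split_ifs <;> simp
  rw [e, ← hc]

/-- The values at `x` of the polynomial `e^{kY} ∏ (u + ξ_i)`, where `Y = 2πi x_{l+1}`. -/
noncomputable def upPoly (l k : ℕ) (x : Pt l) : ℂ[X] :=
  C (Complex.exp (k * (2 * Real.pi * Complex.I * coord l (l + 1) x))) *
    ∏ i ∈ Icc 1 l, (X + C (xi l i x))

theorem eval_derivative_upPoly (l k : ℕ) (x : Pt l) (u : ℂ) :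
    (derivative (upPoly l k x)).eval u =
      Complex.exp (k * (2 * Real.pi * Complex.I * coord l (l + 1) x)) *
        ∑ i ∈ Icc 1 l, ∏ j ∈ (Icc 1 l).erase i, (u + xi l j x) := by
  rw [upPoly, derivative_C_mul, eval_C_mul, derivative_prod_finset]
  simp [eval_finsetSum, eval_prod]

theorem eval_upPoly (l k : ℕ) (x : Pt l) (u : ℂ) :
    (upPoly l k x).eval u =
      Complex.exp (k * (2 * Real.pi * Complex.I * coord l (l + 1) x)) *
        ∏ i ∈ Icc 1 l, (u + xi l i x) := by
  simp [upPoly, eval_prod]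

theorem hasGrad_eval_upPoly (l k : ℕ) (x : Pt l) (u : ℂ) :
    HasGrad (fun x => (upPoly l k x).eval u)
      (((upPoly l k x).eval u * (k * (2 * Real.pi * Complex.I))) • dx l (l + 1) +
        ∑ i ∈ Icc 1 l, (Complex.exp (k * (2 * Real.pi * Complex.I * coord l (l + 1) x)) *
          (∏ j ∈ (Icc 1 l).erase i, (u + xi l j x)) * (2 * Real.pi * Complex.I *
      (Complex.exp (2 * Real.pi * Complex.I * vCoord l i x) -
        Complex.exp (-(2 * Real.pi * Complex.I * vCoord l i x))))) • dv l i) x := by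
  simp only [eval_upPoly]
  have h1 := (((hasGrad_coord_dx (show 1 ≤ l + 1 by omega) le_rfl x).const_mul
    (2 * Real.pi * Complex.I)).const_mul (k : ℂ)).cexp
  have h2 := HasGrad.prod (Icc 1 l) (f := fun i x => u + xi l i x)
    (fun i hi => (HasGrad.const u).add (hasGrad_xi (mem_Icc.1 hi).1 (mem_Icc.1 hi).2 x))
  refine (h1.mul h2).congr_grad ?_
  rw [add_comm]
  congr 1
  · rw [smul_smul, smul_smul, smul_smul]
    congr 1
    ring
  · rw [smul_sum]
    refine sum_congr rfl fun i _ => ?_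
    rw [zero_add, smul_smul, smul_smul]

/-- The metric on the values of `e^{kY} ∏ (u + ξ_i)`. The covectors `dv_i`, `dx_{l+1}` are
orthogonal, and `(dξ_i, dξ_i) = 4 - ξ_i²`, which is interpolated in `u` and `v`. -/
theorem bil_metricX_upPoly {l k : ℕ} (hk : 1 ≤ k) (x : Pt l) {u v : ℂ} (huv : u ≠ v) {φ ψ : Pt l}
    (hφ : HasGrad (fun x => (upPoly l k x).eval u) φ x)
    (hψ : HasGrad (fun x => (upPoly l k x).eval v) ψ x) :
    bil (metricX l k) x φ ψ = metricExpr l k (upPoly l k x) (upPoly l k x) u v := by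
  rw [hφ.unique (hasGrad_eval_upPoly l k x u), hψ.unique (hasGrad_eval_upPoly l k x v)]
  have hpi : (Real.pi : ℂ) ≠ 0 := by exact_mod_cast Real.pi_ne_zero
  have hk0 : (k : ℂ) ≠ 0 := by exact_mod_cast (by omega : k ≠ 0)
  have huv' : u - v ≠ 0 := sub_ne_zero.2 huv
  have hv0 : ∀ i ∈ Icc 1 l, bil (metricX l k) x (dv l i) (dx l (l + 1)) = 0 ∧
      bil (metricX l k) x (dx l (l + 1)) (dv l i) = 0 := by
    intro i hi
    rw [mem_Icc] at hi
    simp only [dv, map_sub, LinearMap.sub_apply]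
    rw [(bil_metricX_dx_last x hi.2).1, (bil_metricX_dx_last x hi.2).2,
      (bil_metricX_dx_last x (by omega : i - 1 ≤ l)).1,
      (bil_metricX_dx_last x (by omega : i - 1 ≤ l)).2]
    simp
  have hsum : ∀ a b : ℕ → ℂ, bil (metricX l k) x (∑ i ∈ Icc 1 l, a i • dv l i)
      (∑ i ∈ Icc 1 l, b i • dv l i) = ∑ i ∈ Icc 1 l, a i * b i * (1 / (4 * (Real.pi : ℂ) ^ 2)) := by
    intro a b
    simp only [map_sum, map_smul, LinearMap.sum_apply, LinearMap.smul_apply, smul_eq_mul, mul_sum]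
    refine sum_congr rfl fun i hi => ?_
    rw [sum_eq_single_of_mem i hi]
    · rw [mem_Icc] at hi
      rw [bil_metricX_dv x hi.1 hi.2 hi.1 hi.2, if_pos rfl]
      ring
    · intro j hj hji
      rw [mem_Icc] at hi hj
      rw [bil_metricX_dv x hj.1 hj.2 hi.1 hi.2, if_neg hji]
      ring
  have hsum1 : ∀ a : ℕ → ℂ, bil (metricX l k) x (∑ i ∈ Icc 1 l, a i • dv l i)
      (dx l (l + 1)) = 0 := by
    intro a
    simp only [map_sum, map_smul, LinearMap.sum_apply, LinearMap.smul_apply, smul_eq_mul]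
    exact sum_eq_zero fun i hi => by rw [(hv0 i hi).1, mul_zero]
  have hsum2 : ∀ a : ℕ → ℂ, bil (metricX l k) x (dx l (l + 1))
      (∑ i ∈ Icc 1 l, a i • dv l i) = 0 := by
    intro a
    simp only [map_sum, map_smul, smul_eq_mul]
    exact sum_eq_zero fun i hi => by rw [(hv0 i hi).2, mul_zero]
  simp only [map_add, map_smul, LinearMap.add_apply, LinearMap.smul_apply, hsum, hsum1, hsum2,
    bil_metricX_last, smul_eq_mul, mul_zero, add_zero, zero_add]
  rw [metricExpr, eval_derivative_upPoly, eval_derivative_upPoly, eval_upPoly, eval_upPoly]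
  set e := Complex.exp (k * (2 * Real.pi * Complex.I * coord l (l + 1) x)) with he
  set p : ℂ → ℂ := fun u => ∏ i ∈ Icc 1 l, (u + xi l i x) with hp
  set q : ℕ → ℂ → ℂ := fun i u => ∏ j ∈ (Icc 1 l).erase i, (u + xi l j x) with hq
  have hpq : ∀ i ∈ Icc 1 l, ∀ u, p u = (u + xi l i x) * q i u := fun i hi u =>
    (mul_prod_erase _ _ hi).symm
  -- the contribution of `dv_i`
  have hterm : ∀ i ∈ Icc 1 l, e * q i u * (2 * Real.pi * Complex.I *
      (Complex.exp (2 * Real.pi * Complex.I * vCoord l i x) -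
        Complex.exp (-(2 * Real.pi * Complex.I * vCoord l i x)))) * (e * q i v *
      (2 * Real.pi * Complex.I * (Complex.exp (2 * Real.pi * Complex.I * vCoord l i x) -
        Complex.exp (-(2 * Real.pi * Complex.I * vCoord l i x))))) *
      (1 / (4 * (Real.pi : ℂ) ^ 2)) =
      e ^ 2 * (-(p u * p v) + ((u ^ 2 - 4) * (q i u * p v) - (v ^ 2 - 4) * (p u * q i v)) /
        (u - v)) := by
    intro i hi
    rw [hpq i hi u, hpq i hi v]
    have hxi : (Complex.exp (2 * Real.pi * Complex.I * vCoord l i x) -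
        Complex.exp (-(2 * Real.pi * Complex.I * vCoord l i x))) ^ 2 = xi l i x ^ 2 - 4 := by
      have h1 : Complex.exp (2 * Real.pi * Complex.I * vCoord l i x) *
        Complex.exp (-(2 * Real.pi * Complex.I * vCoord l i x)) = 1 := by
        rw [← Complex.exp_add]; simp
      rw [xi]
      linear_combination (-4 : ℂ) * h1
    set D := Complex.exp (2 * Real.pi * Complex.I * vCoord l i x) -
        Complex.exp (-(2 * Real.pi * Complex.I * vCoord l i x))
    have e1 : (2 * Real.pi * Complex.I) ^ 2 * (1 / (4 * (Real.pi : ℂ) ^ 2)) = -1 := by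
      rw [mul_pow, Complex.I_sq]
      field_simp
      ring
    have lhs : e * q i u * (2 * Real.pi * Complex.I * D) * (e * q i v *
      (2 * Real.pi * Complex.I * D)) * (1 / (4 * (Real.pi : ℂ) ^ 2)) =
        e ^ 2 * q i u * q i v * (4 - xi l i x ^ 2) := by
      linear_combination (e ^ 2 * q i u * q i v * D ^ 2) * e1 - e ^ 2 * q i u * q i v * hxi
    rw [lhs]
    field_simp
    ring
  rw [sum_congr rfl hterm, ← mul_sum, sum_add_distrib, ← sum_div, sum_sub_distrib, ← mul_sum,
    ← mul_sum, ← sum_mul, ← mul_sum]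
  simp only [sum_const, Nat.card_Icc, nsmul_eq_mul, Nat.add_sub_cancel]
  have e2 : (2 * Real.pi * Complex.I) ^ 2 * (-1 / (4 * k * (Real.pi : ℂ) ^ 2)) = 1 / k := by
    rw [mul_pow, Complex.I_sq]
    field_simp
    ring
  have e3 : (k : ℂ) ^ 2 * (1 / k) = k := by field_simp
  -- the contribution of `dx_{l+1}`
  have e4 : e * p v * (k * (2 * Real.pi * Complex.I)) * (e * p u * (k * (2 * Real.pi * Complex.I)) *
      (-1 / (4 * k * (Real.pi : ℂ) ^ 2))) = e ^ 2 * p u * p v * k := by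
    linear_combination (e ^ 2 * p u * p v * k ^ 2) * e2 + (e ^ 2 * p u * p v) * e3
  refine (congrArg₂ (· + ·) e4 rfl).trans ?_
  field_simp
  ring

/-! ### The intersection form in the coordinates `y` -/

theorem bilin_sum_sum {V ι ι' : Type*} [AddCommGroup V] [Module ℂ V] (B : V →ₗ[ℂ] V →ₗ[ℂ] ℂ)
    (s : Finset ι) (t : Finset ι') (c : ι → ℂ) (d : ι' → ℂ) (α : ι → V) (β : ι' → V) :
    B (∑ i ∈ s, c i • α i) (∑ j ∈ t, d j • β j) =
      ∑ i ∈ s, ∑ j ∈ t, c i * d j * B (α i) (β j) := by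
  simp only [map_sum, map_smul, LinearMap.sum_apply, LinearMap.smul_apply, smul_eq_mul, mul_sum]
  rw [sum_comm]
  exact sum_congr rfl fun i _ => sum_congr rfl fun j _ => by ring

/-- The polynomial `∑ θ^j u^{l-j}` of a system of functions. -/
noncomputable def twistPoly (l k : ℕ) (f : ℕ → Pt l → ℂ) (q : Pt l) : ℂ[X] :=
  ∑ j ∈ range (l + 1), C (twist l k f j q) * X ^ (l - j)

theorem eval_twistPoly (l k : ℕ) (f : ℕ → Pt l → ℂ) (q : Pt l) (u : ℂ) :
    (twistPoly l k f q).eval u = ∑ j ∈ range (l + 1), twist l k f j q * u ^ (l - j) := by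
  simp [twistPoly, eval_finsetSum]

theorem coord_proj {l k j : ℕ} (h1 : 1 ≤ j) (h2 : j ≤ l) (x : Pt l) :
    coord l j (proj l k x) = yTilde l k j x := by
  rw [coord, dif_pos (by omega), proj]
  simp only
  rw [if_pos (by omega), Nat.sub_add_cancel h1]

theorem coord_proj_last (l k : ℕ) (x : Pt l) :
    coord l (l + 1) (proj l k x) = 2 * Real.pi * Complex.I * coord l (l + 1) x := by
  rw [coord, dif_pos (by omega), proj]
  simp only
  rw [if_neg (by omega)]

theorem twist_eq_mul_exp {l k : ℕ} (f : ℕ → Pt l → ℂ) {j : ℕ} (hj : 1 ≤ j) (q : Pt l) :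
    twist l k f j q = f j q * Complex.exp (((k : ℂ) - dDeg k j) * f (l + 1) q) := by
  rw [twist, if_neg (by omega), dDeg]
  split_ifs with h
  · rw [min_eq_left h.le]
  · rw [min_eq_right (by omega)]; simp

theorem twistPoly_proj {l k : ℕ} (x : Pt l) :
    twistPoly l k (coord l) (proj l k x) = upPoly l k x := by
  have h := Multiset.prod_X_add_C_eq_sum_esymm ((Icc 1 l).val.map fun i => xi l i x)
  simp only [Multiset.map_map, Multiset.card_map, card_val, Nat.card_Icc,
    Nat.add_sub_cancel] at h
  rw [upPoly, Finset.prod_eq_multiset_prod]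
  refine Eq.trans ?_ (congrArg _ h.symm)
  rw [twistPoly, mul_sum]
  refine sum_congr rfl fun j hj => ?_
  rw [mem_range] at hj
  rw [← mul_assoc, ← C_mul]
  congr 2
  rcases Nat.eq_zero_or_pos j with rfl | h0
  · rw [twist, if_pos rfl, coord_proj_last]
    simp [Multiset.esymm]
  · rw [twist_eq_mul_exp _ h0, coord_proj h0 (by omega), coord_proj_last, yTilde, mul_right_comm,
      ← Complex.exp_add]
    congr 2
    ring

section Gradients

variable {l k : ℕ} {f : ℕ → Pt l → ℂ} {φ : ℕ → Pt l} {q : Pt l}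

/-- The differential of `twist l k f j`, in terms of the differentials `φ` of `f`. -/
noncomputable def twistGrad (l k : ℕ) (f : ℕ → Pt l → ℂ) (φ : ℕ → Pt l) (q : Pt l) (j : ℕ) : Pt l :=
  if j = 0 then (k * Complex.exp (k * f (l + 1) q)) • φ (l + 1)
  else Complex.exp (((k : ℂ) - dDeg k j) * f (l + 1) q) • φ j +
    (f j q * ((k : ℂ) - dDeg k j) * Complex.exp (((k : ℂ) - dDeg k j) * f (l + 1) q)) • φ (l + 1)

theorem hasGrad_twist (hf : ∀ j, 1 ≤ j → j ≤ l + 1 → HasGrad (f j) (φ j) q) {j : ℕ} (hj : j ≤ l) :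
    HasGrad (twist l k f j) (twistGrad l k f φ q j) q := by
  have hY := hf (l + 1) (by omega) le_rfl
  rcases Nat.eq_zero_or_pos j with rfl | h0
  · have e : twist l k f 0 = fun y => Complex.exp (k * f (l + 1) y) := by
      funext y; rw [twist, if_pos rfl]
    rw [e, twistGrad, if_pos rfl]
    refine (hY.const_mul (k : ℂ)).cexp.congr_grad ?_
    rw [smul_smul, mul_comm]
  · have e : twist l k f j =
        fun y => f j y * Complex.exp (((k : ℂ) - dDeg k j) * f (l + 1) y) := by
      funext y; rw [twist_eq_mul_exp f h0]
    rw [e, twistGrad, if_neg (by omega)]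
    refine ((hf j h0 (by omega)).mul (hY.const_mul ((k : ℂ) - dDeg k j)).cexp).congr_grad ?_
    rw [add_comm, smul_smul, smul_smul]
    congr 2
    ring

theorem hasGrad_eval_twistPoly (hf : ∀ j, 1 ≤ j → j ≤ l + 1 → HasGrad (f j) (φ j) q) (u : ℂ) :
    HasGrad (fun y => (twistPoly l k f y).eval u)
      (∑ j ∈ range (l + 1), u ^ (l - j) • twistGrad l k f φ q j) q := by
  simp only [eval_twistPoly]
  refine HasGrad.sum _ fun j hj => ?_
  simp only [mul_comm _ (u ^ _)]
  exact (hasGrad_twist hf (by rw [mem_range] at hj; omega)).const_mul _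

/-- The coefficient of degree `d` of a polynomial of degree at most `l`, in terms of the values at
the nodes `u`. -/
noncomputable def nodeCoef {l : ℕ} (u : Fin (l + 1) → ℂ) (d : ℕ) (a : Fin (l + 1)) : ℂ :=
  (Lagrange.basis univ u a).coeff d

theorem sum_nodeCoef_mul_pow {u : Fin (l + 1) → ℂ} (hu : Function.Injective u) (d e : ℕ)
    (he : e ≤ l) : ∑ a, nodeCoef u d a * u a ^ e = if d = e then 1 else 0 := by
  have h := Lagrange.eq_interpolate (s := univ) (v := u) (f := (X ^ e : ℂ[X])) hu.injOn
    (by rw [degree_X_pow, card_univ, Fintype.card_fin]; exact_mod_cast Nat.lt_succ_of_le he)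
  have h' := congrArg (fun P : ℂ[X] => P.coeff d) h
  simp only [Lagrange.interpolate_apply, finsetSum_coeff, coeff_C_mul, coeff_X_pow, eval_pow,
    eval_X] at h'
  rw [h']
  exact sum_congr rfl fun a _ => mul_comm _ _

/-- The coefficients of the differential of the function number `j` of the system `f` with respect
to the differentials of the values of `twistPoly l k f` at the nodes. -/
noncomputable def sysCoef (l k : ℕ) (u : Fin (l + 1) → ℂ) (f : ℕ → Pt l → ℂ) (q : Pt l) (j : ℕ)
    (a : Fin (l + 1)) : ℂ :=
  if j ≤ l then Complex.exp (-(((k : ℂ) - dDeg k j) * f (l + 1) q)) * nodeCoef u (l - j) a -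
    ((k : ℂ) - dDeg k j) * f j q * (Complex.exp (-(k * f (l + 1) q)) / k) * nodeCoef u l a
  else Complex.exp (-(k * f (l + 1) q)) / k * nodeCoef u l a

/-- The differentials of a system of functions are recovered from those of the values of its
`twistPoly` at `l + 1` nodes. -/
theorem sum_sysCoef_smul (hk : 1 ≤ k) {u : Fin (l + 1) → ℂ} (hu : Function.Injective u) {j : ℕ}
    (h1 : 1 ≤ j) (h2 : j ≤ l + 1) :
    ∑ a, sysCoef l k u f q j a • ∑ i ∈ range (l + 1), u a ^ (l - i) • twistGrad l k f φ q i =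
      φ j := by
  have hk0 : (k : ℂ) ≠ 0 := by exact_mod_cast (by omega : k ≠ 0)
  have hnode : ∀ A ≤ l, ∑ a, nodeCoef u (l - A) a •
      ∑ i ∈ range (l + 1), u a ^ (l - i) • twistGrad l k f φ q i = twistGrad l k f φ q A := by
    intro A hA
    simp only [smul_sum, smul_smul]
    rw [sum_comm]
    simp only [← sum_smul]
    rw [sum_eq_single_of_mem A (mem_range.2 (by omega))]
    · rw [sum_nodeCoef_mul_pow hu _ _ (by omega), if_pos rfl, one_smul]
    · intro i hi hiA
      rw [mem_range] at hi
      rw [sum_nodeCoef_mul_pow hu _ _ (by omega), if_neg (by omega), zero_smul]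
  have h0 := hnode 0 (by omega)
  rw [Nat.sub_zero, twistGrad, if_pos rfl] at h0
  have hlast : ∑ a, (Complex.exp (-(k * f (l + 1) q)) / k * nodeCoef u l a) •
      ∑ i ∈ range (l + 1), u a ^ (l - i) • twistGrad l k f φ q i = φ (l + 1) := by
    simp only [mul_smul]
    rw [← smul_sum, h0, smul_smul]
    have : Complex.exp (-(k * f (l + 1) q)) / k * (k * Complex.exp (k * f (l + 1) q)) = 1 := by
      rw [Complex.exp_neg]
      have := Complex.exp_ne_zero (k * f (l + 1) q)
      field_simp
    rw [this, one_smul]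
  by_cases hj : j ≤ l
  · have hj' := hnode j hj
    simp only [sysCoef, if_pos hj, sub_smul, sum_sub_distrib]
    have e1 : ∀ a, (((k : ℂ) - dDeg k j) * f j q * (Complex.exp (-(k * f (l + 1) q)) / k) *
        nodeCoef u l a) = (((k : ℂ) - dDeg k j) * f j q) *
          (Complex.exp (-(k * f (l + 1) q)) / k * nodeCoef u l a) := fun a => by ring
    simp only [e1]
    simp only [mul_smul _ (nodeCoef _ _ _), mul_smul (((k : ℂ) - dDeg k j) * f j q)]
    rw [← smul_sum, hj', ← smul_sum]
    simp only [← mul_smul _ (nodeCoef _ _ _)]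
    rw [hlast, twistGrad, if_neg (by omega), smul_add, smul_smul, smul_smul, ← Complex.exp_add]
    rw [neg_add_cancel, Complex.exp_zero, one_smul, add_sub_assoc, ← sub_smul]
    have : Complex.exp (-(((k : ℂ) - dDeg k j) * f (l + 1) q)) * (f j q * ((k : ℂ) - dDeg k j) *
        Complex.exp (((k : ℂ) - dDeg k j) * f (l + 1) q)) - ((k : ℂ) - dDeg k j) * f j q = 0 := by
      rw [Complex.exp_neg]
      have := Complex.exp_ne_zero (((k : ℂ) - dDeg k j) * f (l + 1) q)
      field_simp
      ring
    rw [this, zero_smul, add_zero]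
  · obtain rfl : j = l + 1 := by omega
    simp only [sysCoef, if_neg hj]
    exact hlast

end Gradients

/-- The nodes for the first argument of the metric. -/
noncomputable def nodeU (l : ℕ) (a : Fin (l + 1)) : ℂ := (a.val + 3 : ℕ)

/-- The nodes for the second argument of the metric. -/
noncomputable def nodeV (l : ℕ) (a : Fin (l + 1)) : ℂ := (a.val + (l + 4) : ℕ)

theorem nodeU_injective (l : ℕ) : Function.Injective (nodeU l) := by
  intro a b h
  have : a.val + 3 = b.val + 3 := by
    simp only [nodeU] at h
    exact_mod_cast h
  exact Fin.ext (by omega)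

theorem nodeV_injective (l : ℕ) : Function.Injective (nodeV l) := by
  intro a b h
  have : a.val + (l + 4) = b.val + (l + 4) := by
    simp only [nodeV] at h
    exact_mod_cast h
  exact Fin.ext (by omega)

theorem nodeU_ne_nodeV (l : ℕ) (a b : Fin (l + 1)) : nodeU l a ≠ nodeV l b := by
  intro h
  have : a.val + 3 = b.val + (l + 4) := by
    simp only [nodeU, nodeV] at h
    exact_mod_cast h
  omega

/-- The intersection form in the coordinates `y`: the metric on the values of `∑ θ^j u^{l-j}` at
nodes, carried over to the `dy^i` by interpolation. The arguments use disjoint sets of nodes, as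
`metricExpr` is meaningful at distinct points only. -/
noncomputable def gForm (l k : ℕ) : Tensor2 l := fun i j y =>
  ∑ a, ∑ b, sysCoef l k (nodeU l) (coord l) y (i.val + 1) a *
    sysCoef l k (nodeV l) (coord l) y (j.val + 1) b *
    metricExpr l k (twistPoly l k (coord l) y) (twistPoly l k (coord l) y) (nodeU l a) (nodeV l b)

theorem coord_succ {l : ℕ} (i : Fin (l + 1)) (p : Pt l) : coord l (i.val + 1) p = p i := by
  rw [coord, dif_pos (by simpa using Nat.lt_succ_iff.1 i.2)]
  rfl

theorem differentiableAt_proj {l k : ℕ} (i : Fin (l + 1)) (x : Pt l) :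
    DifferentiableAt ℂ (fun x' => proj l k x' i) x := by
  have hY := (hasGrad_coord_dx (show 1 ≤ l + 1 by omega) le_rfl x).1
  by_cases h : i.val + 1 ≤ l
  · simp only [proj, if_pos h, yTilde, esymm_map_val]
    refine DifferentiableAt.fun_mul ((hY.const_mul _).cexp) ?_
    refine DifferentiableAt.fun_sum fun t ht => ?_
    rw [mem_powersetCard] at ht
    exact (HasGrad.prod t fun j hj => hasGrad_xi (mem_Icc.1 (ht.1 hj)).1
      (mem_Icc.1 (ht.1 hj)).2 x).1
  · simp only [proj, if_neg h]
    exact hY.const_mul _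

theorem isIntersectionForm_gForm {l k : ℕ} (hk : 1 ≤ k) : IsIntersectionForm l k (gForm l k) := by
  intro x i j
  set f : ℕ → Pt l → ℂ := fun j x' => coord l j (proj l k x') with hf
  set φ : ℕ → Pt l := fun j a => pd (f j) a x with hφ
  have hi : ∀ i : Fin (l + 1), (fun x' => proj l k x' i) = f (i.val + 1) := by
    intro i; funext x'; exact (coord_succ i _).symm
  have hgrad : ∀ j, 1 ≤ j → j ≤ l + 1 → HasGrad (f j) (φ j) x := by
    intro j h1 h2
    have h : DifferentiableAt ℂ (f j) x := by
      have h := differentiableAt_proj (k := k) (⟨j - 1, by omega⟩ : Fin (l + 1)) x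
      rw [hi] at h
      simpa only [Nat.sub_add_cancel h1] using h
    exact ⟨h, fun _ => rfl⟩
  have hpoly : ∀ x', twistPoly l k f x' = upPoly l k x' := fun x' => twistPoly_proj x'
  rw [hi i, hi j, pairing_eq_bil _ (hgrad (i.val + 1) (by omega) (by omega))
    (hgrad (j.val + 1) (by omega) (by omega)),
    ← sum_sysCoef_smul (f := f) (φ := φ) (q := x) hk (nodeU_injective l) (by omega : 1 ≤ i.val + 1)
      (by omega),
    ← sum_sysCoef_smul (f := f) (φ := φ) (q := x) hk (nodeV_injective l) (by omega : 1 ≤ j.val + 1)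
      (by omega)]
  rw [bilin_sum_sum, gForm]
  refine sum_congr rfl fun a _ => sum_congr rfl fun b _ => ?_
  have h1 := hasGrad_eval_twistPoly (k := k) hgrad (nodeU l a)
  have h2 := hasGrad_eval_twistPoly (k := k) hgrad (nodeV l b)
  simp only [hpoly] at h1 h2
  rw [bil_metricX_upPoly hk x (nodeU_ne_nodeV l a b) h1 h2, twistPoly_proj]
  rfl

/-! ### The Lie derivative along the unity field -/

theorem sum_mul_pd {l : ℕ} (c : Pt l) (f : Pt l → ℂ) (p : Pt l) :
    ∑ s, c s * pd f s p = fderiv ℂ f p c := by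
  conv_rhs => rw [pi_eq_sum_univ' c, map_sum]
  refine sum_congr rfl fun s _ => ?_
  rw [map_smul, smul_eq_mul, pd]

/-- For a vector field with constant components, the Lie derivative of the components is the
derivative along the lines in its direction. -/
theorem lieDeriv_const {l : ℕ} (c : Pt l) (G : Tensor2 l) (i j : Fin (l + 1)) (p : Pt l) {D : ℂ}
    (hd : DifferentiableAt ℂ (G i j) p) (hD : HasDerivAt (fun t : ℂ => G i j (p + t • c)) D 0) :
    lieDeriv (fun a _ => c a) G i j p = D := by
  have h0 : ∀ a s, pd (fun _ : Pt l => c a) s p = 0 := fun a s => by simp [pd]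
  simp only [lieDeriv, h0, mul_zero, sub_zero]
  rw [sum_mul_pd]
  exact (hd.hasFDerivAt.hasLineDerivAt c).unique hD

/-- The polynomial `(u+2)^m (u-2)^{l-k-m}`. -/
noncomputable def unityPoly (l k m : ℕ) : ℂ[X] := (X + C 2) ^ m * (X - C 2) ^ (l - k - m)

theorem natDegree_unityPoly {l k m : ℕ} (hm : m ≤ l - k) :
    (unityPoly l k m).natDegree = l - k := by
  rw [unityPoly, natDegree_mul (pow_ne_zero _ (X_add_C_ne_zero 2))
    (pow_ne_zero _ (X_sub_C_ne_zero 2)), natDegree_pow, natDegree_pow, natDegree_X_add_C,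
    natDegree_X_sub_C]
  omega

/-- The components of the unity field. -/
noncomputable def unityVec (l k m : ℕ) : Pt l := fun a =>
  if k ≤ a.val + 1 ∧ a.val + 1 ≤ l then cCoef l k m (a.val + 1) else 0

theorem coord_add_smul_unityVec {l k m j : ℕ} (h1 : 1 ≤ j) (h2 : j ≤ l + 1) (p : Pt l) (t : ℂ) :
    coord l j (p + t • unityVec l k m) =
      coord l j p + t * if k ≤ j ∧ j ≤ l then cCoef l k m j else 0 := by
  rw [coord, coord, dif_pos (by omega), dif_pos (by omega), Pi.add_apply, Pi.smul_apply,
    smul_eq_mul, unityVec]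
  simp only [Nat.sub_add_cancel h1]

theorem twistPoly_add_smul_unityVec {l k m : ℕ} (hk : 1 ≤ k) (hm : m ≤ l - k) (hkl : k ≤ l)
    (p : Pt l) (t : ℂ) :
    twistPoly l k (coord l) (p + t • unityVec l k m) =
      twistPoly l k (coord l) p + C t * unityPoly l k m := by
  have hE : unityPoly l k m = ∑ j ∈ range (l + 1),
      C (if k ≤ j then cCoef l k m j else 0) * X ^ (l - j) := by
    rw [(unityPoly l k m).as_sum_range' (l + 1) (by rw [natDegree_unityPoly hm]; omega),
      ← sum_range_reflect]
    refine sum_congr rfl fun j hj => ?_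
    rw [mem_range] at hj
    rw [← C_mul_X_pow_eq_monomial, show l + 1 - 1 - j = l - j by omega]
    split_ifs with h
    · rfl
    · rw [coeff_eq_zero_of_natDegree_lt (by rw [natDegree_unityPoly hm]; omega)]
  rw [hE, twistPoly, twistPoly, mul_sum, ← sum_add_distrib]
  refine sum_congr rfl fun j hj => ?_
  rw [mem_range] at hj
  rw [← mul_assoc, ← add_mul, ← C_mul, ← C_add]
  congr 2
  rcases Nat.eq_zero_or_pos j with rfl | h0
  · rw [twist, twist, if_pos rfl, if_pos rfl, coord_add_smul_unityVec (by omega) le_rfl,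
      if_neg (by omega), if_neg (by omega)]
    simp
  · rw [twist_eq_mul_exp _ h0, twist_eq_mul_exp _ h0, coord_add_smul_unityVec h0 (by omega),
      coord_add_smul_unityVec (by omega) le_rfl, if_neg (by omega : ¬ (k ≤ l + 1 ∧ l + 1 ≤ l)),
      mul_zero, add_zero]
    by_cases h : k ≤ j
    · rw [if_pos ⟨h, by omega⟩, if_pos h, dDeg, min_eq_right h]
      simp
    · rw [if_neg (by omega), if_neg h]
      simp

theorem sysCoef_add_smul_unityVec {l k m : ℕ} (u : Fin (l + 1) → ℂ) (p : Pt l)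
    (t : ℂ) {j : ℕ} (h1 : 1 ≤ j) (a : Fin (l + 1)) :
    sysCoef l k u (coord l) (p + t • unityVec l k m) j a = sysCoef l k u (coord l) p j a := by
  rw [sysCoef, sysCoef, coord_add_smul_unityVec (by omega) le_rfl,
    if_neg (by omega : ¬ (k ≤ l + 1 ∧ l + 1 ≤ l)), mul_zero, add_zero]
  split_ifs with hj
  · rw [coord_add_smul_unityVec h1 (by omega)]
    by_cases h : k ≤ j
    · rw [dDeg, min_eq_right h]; simp
    · rw [if_neg (by omega), mul_zero, add_zero]
  · rfl

theorem differentiableAt_coord {l : ℕ} (j : ℕ) (p : Pt l) : DifferentiableAt ℂ (coord l j) p := by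
  by_cases h : j - 1 < l + 1
  · exact (hasGrad_coord h p).1
  · have e : coord l j = fun _ => 0 := by
      funext q; rw [coord, dif_neg h]
    rw [e]
    exact differentiableAt_const 0

theorem differentiableAt_sysCoef {l k : ℕ} (u : Fin (l + 1) → ℂ) (p : Pt l) (j : ℕ)
    (a : Fin (l + 1)) : DifferentiableAt ℂ (fun y => sysCoef l k u (coord l) y j a) p := by
  have hj := differentiableAt_coord j p
  have hY := differentiableAt_coord (l + 1) p
  simp only [sysCoef, div_eq_mul_inv]
  split_ifs
  · refine ((((hY.const_mul _).fun_neg).cexp).mul_const _).fun_sub ?_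
    exact ((hj.const_mul _).fun_mul ((((hY.const_mul _).fun_neg).cexp).mul_const _)).mul_const _
  · exact ((((hY.const_mul _).fun_neg).cexp).mul_const _).mul_const _

theorem differentiableAt_metricExpr {l k : ℕ} (p : Pt l) (u v : ℂ) :
    DifferentiableAt ℂ (fun y => metricExpr l k (twistPoly l k (coord l) y)
      (twistPoly l k (coord l) y) u v) p := by
  have h0 : ∀ j ∈ range (l + 1), DifferentiableAt ℂ (twist l k (coord l) j) p := fun j hj =>
    (hasGrad_twist (fun j h1 h2 => hasGrad_coord_dx h1 h2 p) (by rw [mem_range] at hj; omega)).1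
  have h1 : ∀ u, DifferentiableAt ℂ (fun y => (twistPoly l k (coord l) y).eval u) p := by
    intro u
    simp only [eval_twistPoly]
    exact DifferentiableAt.fun_sum fun j hj => (h0 j hj).mul_const _
  have h2 : ∀ u, DifferentiableAt ℂ
      (fun y => (derivative (twistPoly l k (coord l) y)).eval u) p := by
    intro u
    simp only [twistPoly, derivative_sum, derivative_C_mul, eval_finsetSum, eval_C_mul]
    exact DifferentiableAt.fun_sum fun j hj => (h0 j hj).mul_const _
  simp only [metricExpr, div_eq_mul_inv]
  exact (((h1 u).fun_mul (h1 v)).const_mul _).fun_add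
    (((((h2 u).const_mul _).fun_mul (h1 v)).fun_sub
      (((h1 u).const_mul _).fun_mul (h2 v))).mul_const _)

theorem metricExpr_add_smul (l k : ℕ) (P E : ℂ[X]) (u v t : ℂ) :
    metricExpr l k (P + C t * E) (P + C t * E) u v = metricExpr l k P P u v +
      t * (metricExpr l k P E u v + metricExpr l k E P u v) + t ^ 2 * metricExpr l k E E u v := by
  simp only [metricExpr, derivative_add, derivative_C_mul, eval_add, eval_C_mul]
  ring

/-- The components of the metric `η`. The unity field moves `∑ θ^j u^{l-j}` in the direction of the
fixed polynomial `unityPoly` and leaves `sysCoef` fixed, so that `η` is the polarization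
of `metricExpr` in this direction. -/
theorem etaForm_gForm {l k m : ℕ} (hk : 1 ≤ k) (hm : m ≤ l - k) (hkl : k ≤ l)
    (i j : Fin (l + 1)) (p : Pt l) :
    etaForm l k m (gForm l k) i j p =
      ∑ a, ∑ b, sysCoef l k (nodeU l) (coord l) p (i.val + 1) a *
        sysCoef l k (nodeV l) (coord l) p (j.val + 1) b *
        (metricExpr l k (twistPoly l k (coord l) p) (unityPoly l k m) (nodeU l a) (nodeV l b) +
          metricExpr l k (unityPoly l k m) (twistPoly l k (coord l) p) (nodeU l a)
            (nodeV l b)) := by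
  refine lieDeriv_const (unityVec l k m) _ i j p ?_ ?_
  · unfold gForm
    exact DifferentiableAt.fun_sum fun a _ => DifferentiableAt.fun_sum fun b _ =>
      ((differentiableAt_sysCoef _ _ _ _).fun_mul (differentiableAt_sysCoef _ _ _ _)).fun_mul
        (differentiableAt_metricExpr _ _ _)
  · simp only [gForm, twistPoly_add_smul_unityVec hk hm hkl,
      sysCoef_add_smul_unityVec _ _ _ (by omega : 1 ≤ i.val + 1),
      sysCoef_add_smul_unityVec _ _ _ (by omega : 1 ≤ j.val + 1), metricExpr_add_smul]
    refine HasDerivAt.fun_sum fun a _ => HasDerivAt.fun_sum fun b _ => HasDerivAt.const_mul _ ?_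
    have h1 := (hasDerivAt_id (0 : ℂ)).mul_const
      (metricExpr l k (twistPoly l k (coord l) p) (unityPoly l k m) (nodeU l a) (nodeV l b) +
          metricExpr l k (unityPoly l k m) (twistPoly l k (coord l) p) (nodeU l a) (nodeV l b))
    have h2 := (hasDerivAt_pow 2 (0 : ℂ)).mul_const
      (metricExpr l k (unityPoly l k m) (unityPoly l k m) (nodeU l a) (nodeV l b))
    have h3 := (h1.const_add (metricExpr l k (twistPoly l k (coord l) p)
      (twistPoly l k (coord l) p) (nodeU l a) (nodeV l b))).add h2
    refine (h3.congr_deriv ?_).congr_of_eventuallyEq (Filter.Eventually.of_forall fun t => ?_)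
    · simp
    · simp only [id, Pi.add_apply]

/-- The metric `η` on the values of `∑ θ^j u^{l-j}` at the nodes. -/
theorem bil_etaForm_twistPoly {l k m : ℕ} (hk : 1 ≤ k) (hm : m ≤ l - k) (hkl : k ≤ l) (p : Pt l)
    (a b : Fin (l + 1)) {φ ψ : Pt l}
    (hφ : HasGrad (fun y => (twistPoly l k (coord l) y).eval (nodeU l a)) φ p)
    (hψ : HasGrad (fun y => (twistPoly l k (coord l) y).eval (nodeV l b)) ψ p) :
    bil (etaForm l k m (gForm l k)) p φ ψ =
      metricExpr l k (twistPoly l k (coord l) p) (unityPoly l k m) (nodeU l a) (nodeV l b) +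
        metricExpr l k (unityPoly l k m) (twistPoly l k (coord l) p) (nodeU l a) (nodeV l b) := by
  have hgrad : ∀ j, 1 ≤ j → j ≤ l + 1 → HasGrad (coord l j) (dx l j) p :=
    fun j h1 h2 => hasGrad_coord_dx h1 h2 p
  -- The covectors `dy^i` are combinations of the differentials of the values at the nodes; the
  -- matrix of coefficients is inverse to the Jacobian matrix of these values.
  have key : ∀ u : Fin (l + 1) → ℂ, Function.Injective u → ∀ (Φ : Fin (l + 1) → Pt l),
      (∀ a, HasGrad (fun y => (twistPoly l k (coord l) y).eval (u a)) (Φ a) p) →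
      (Matrix.of Φ) * (Matrix.of fun i a : Fin (l + 1) =>
        sysCoef l k u (coord l) p (i.val + 1) a) = 1 := by
    intro u hu Φ hΦ
    rw [mul_eq_one_comm]
    ext i j
    have h := sum_sysCoef_smul (f := coord l) (φ := dx l) (q := p) hk hu
      (by omega : 1 ≤ i.val + 1) (by omega : i.val + 1 ≤ l + 1)
    have h' := congrFun h j
    have hΦ' : ∀ a, Φ a = ∑ i ∈ range (l + 1), u a ^ (l - i) •
        twistGrad l k (coord l) (dx l) p i := fun a =>
      (hΦ a).unique (hasGrad_eval_twistPoly hgrad (u a))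
    simp only [← hΦ'] at h'
    rw [Matrix.mul_apply, Matrix.one_apply]
    simp only [Matrix.of_apply]
    simp only [Finset.sum_apply, Pi.smul_apply, smul_eq_mul] at h'
    rw [h', dx]
    congr 1
    simp only [Fin.ext_iff, eq_iff_iff]
    omega
  set Φ : Fin (l + 1) → Pt l := fun a => ∑ i ∈ range (l + 1), nodeU l a ^ (l - i) •
    twistGrad l k (coord l) (dx l) p i with hΦ
  set Ψ : Fin (l + 1) → Pt l := fun a => ∑ i ∈ range (l + 1), nodeV l a ^ (l - i) •
    twistGrad l k (coord l) (dx l) p i with hΨ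
  have h1 := key (nodeU l) (nodeU_injective l) Φ fun a => hasGrad_eval_twistPoly hgrad _
  have h2 := key (nodeV l) (nodeV_injective l) Ψ fun a => hasGrad_eval_twistPoly hgrad _
  rw [hφ.unique (hasGrad_eval_twistPoly hgrad _), hψ.unique (hasGrad_eval_twistPoly hgrad _)]
  change bil _ p (Φ a) (Ψ b) = _
  set F : Matrix (Fin (l + 1)) (Fin (l + 1)) ℂ := Matrix.of fun a b =>
      metricExpr l k (twistPoly l k (coord l) p) (unityPoly l k m) (nodeU l a) (nodeV l b) +
        metricExpr l k (unityPoly l k m) (twistPoly l k (coord l) p) (nodeU l a) (nodeV l b)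
    with hF
  set W : Matrix (Fin (l + 1)) (Fin (l + 1)) ℂ := Matrix.of fun i a =>
    sysCoef l k (nodeU l) (coord l) p (i.val + 1) a with hW
  set W' : Matrix (Fin (l + 1)) (Fin (l + 1)) ℂ := Matrix.of fun i a =>
    sysCoef l k (nodeV l) (coord l) p (i.val + 1) a with hW'
  have hη : (Matrix.of fun i j => etaForm l k m (gForm l k) i j p) = W * F * W'.transpose := by
    ext i j
    rw [Matrix.of_apply, etaForm_gForm hk hm hkl, Matrix.mul_apply]
    simp only [Matrix.mul_apply, Matrix.transpose_apply, sum_mul]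
    rw [sum_comm]
    refine sum_congr rfl fun b _ => sum_congr rfl fun a _ => ?_
    simp only [hW, hW', hF, Matrix.of_apply]
    ring
  have h3 : Matrix.of Φ * (W * F * W'.transpose) * (Matrix.of Ψ).transpose = F := by
    have h2' : W'.transpose * (Matrix.of Ψ).transpose = 1 := by
      rw [← Matrix.transpose_mul, h2, Matrix.transpose_one]
    calc _ = (Matrix.of Φ * W) * F * (W'.transpose * (Matrix.of Ψ).transpose) := by
          simp only [Matrix.mul_assoc]
      _ = F := by rw [h1, h2', Matrix.one_mul, Matrix.mul_one]
  have h4 := congrFun (congrFun h3 a) b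
  rw [← hη, Matrix.mul_apply] at h4
  simp only [Matrix.mul_apply, Matrix.transpose_apply, Matrix.of_apply, sum_mul] at h4
  rw [bil_apply, sum_comm]
  refine Eq.trans ?_ h4
  refine sum_congr rfl fun b _ => sum_congr rfl fun a _ => ?_
  ring

/-! ### The coordinates `τ` -/

/-- Polynomials are linearly independent if each of them has, at some point, a smaller order of
vanishing (relative to a common factor) than all the preceding ones. -/
theorem coeff_eq_zero_of_flag (f : ℕ → ℂ[X]) (n : ℕ)
    (h : ∀ j < n, ∃ (D g : ℂ[X]) (a : ℂ), f j = D * g ∧ D ≠ 0 ∧ g.eval a ≠ 0 ∧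
      ∀ i < j, D * (X - C a) ∣ f i) (c : ℕ → ℂ) (hc : ∑ i ∈ range n, C (c i) * f i = 0) :
    ∀ i < n, c i = 0 := by
  induction n with
  | zero => intro i hi; omega
  | succ n ih =>
    obtain ⟨D, g, a, hf, hD, hg, hdiv⟩ := h n (Nat.lt_succ_self n)
    rw [sum_range_succ] at hc
    have h1 : D * (X - C a) ∣ ∑ i ∈ range n, C (c i) * f i :=
      dvd_sum fun i hi => (hdiv i (mem_range.1 hi)).mul_left _
    have h2 : D * (X - C a) ∣ D * (C (c n) * g) := by
      have : D * (C (c n) * g) = -∑ i ∈ range n, C (c i) * f i := by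
        rw [eq_neg_iff_add_eq_zero, ← hc, hf]; ring
      rw [this]
      exact h1.neg_right
    have h3 := dvd_iff_isRoot.1 ((mul_dvd_mul_iff_left hD).1 h2)
    rw [IsRoot, eval_mul, eval_C] at h3
    have h4 : c n = 0 := (mul_eq_zero.1 h3).resolve_right hg
    rw [h4, C_0, zero_mul, add_zero] at hc
    intro i hi
    rcases Nat.lt_succ_iff_lt_or_eq.1 hi with h5 | rfl
    · exact ih (fun j hj => h j (by omega)) hc i h5
    · exact h4

/-- The polynomials in `u` through which `τ` is defined. -/
noncomputable def tauBasis (l k m j : ℕ) : ℂ[X] :=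
  if j ≤ l - m then (X + C 2) ^ m * (X - C 2) ^ (l - m - j)
  else -((X + C 2) ^ (l - j) * (X - C 2) ^ (j - k - 1))

theorem tauBasis_coeff_eq_zero {l k m : ℕ} (c : ℕ → ℂ)
    (hc : ∑ i ∈ range (l + 1), C (c i) * tauBasis l k m i = 0) : ∀ i < l + 1, c i = 0 := by
  refine coeff_eq_zero_of_flag _ _ (fun j hj => ?_) c hc
  by_cases h : j ≤ l - m
  · refine ⟨(X + C 2) ^ m * (X - C 2) ^ (l - m - j), 1, 2, by rw [tauBasis, if_pos h, mul_one],
      mul_ne_zero (pow_ne_zero _ (X_add_C_ne_zero 2)) (pow_ne_zero _ (X_sub_C_ne_zero 2)),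
      by simp, fun i hi => ?_⟩
    rw [tauBasis, if_pos (by omega), mul_assoc, ← pow_succ]
    exact mul_dvd_mul_left _ (pow_dvd_pow _ (by omega))
  · refine ⟨(X + C 2) ^ (l - j), -(X - C 2) ^ (j - k - 1), -2,
      by rw [tauBasis, if_neg h]; ring, pow_ne_zero _ (X_add_C_ne_zero 2), ?_, fun i hi => ?_⟩
    · simp only [eval_neg, eval_pow, eval_sub, eval_X, eval_C]
      exact neg_ne_zero.2 (pow_ne_zero _ (by norm_num))
    · rw [C_neg, sub_neg_eq_add, ← pow_succ, tauBasis]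
      split_ifs with h'
      · exact (pow_dvd_pow _ (by omega)).mul_right _
      · exact ((pow_dvd_pow _ (by omega)).mul_right _).neg_right

theorem natDegree_tauBasis {l k m j : ℕ} (hml : m ≤ l) (hj : j ≤ l) :
    (tauBasis l k m j).natDegree ≤ l := by
  rw [tauBasis]
  split_ifs with h
  · refine natDegree_mul_le.trans ((add_le_add natDegree_pow_le natDegree_pow_le).trans ?_)
    rw [natDegree_X_add_C, natDegree_X_sub_C]; omega
  · rw [natDegree_neg]
    refine natDegree_mul_le.trans ((add_le_add natDegree_pow_le natDegree_pow_le).trans ?_)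
    rw [natDegree_X_add_C, natDegree_X_sub_C]; omega

theorem coeff_tauBasis_top {l k m j : ℕ} (hk : 1 ≤ k) (hkl : k ≤ l) (hm : m ≤ l - k)
    (hj : j ≤ l) : (tauBasis l k m j).coeff l = if j = 0 then 1 else 0 := by
  split_ifs with h0
  · subst h0
    rw [tauBasis, if_pos (by omega)]
    have h1 : ((X + C 2) ^ m * (X - C 2) ^ (l - m - 0) : ℂ[X]).Monic :=
      ((monic_X_add_C 2).pow _).mul ((monic_X_sub_C 2).pow _)
    have h2 : ((X + C 2) ^ m * (X - C 2) ^ (l - m - 0) : ℂ[X]).natDegree = l := by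
      rw [((monic_X_add_C (2 : ℂ)).pow m).natDegree_mul ((monic_X_sub_C (2 : ℂ)).pow _),
        natDegree_pow, natDegree_pow, natDegree_X_add_C, natDegree_X_sub_C]
      omega
    have h3 := h1.coeff_natDegree
    rwa [h2] at h3
  · apply coeff_eq_zero_of_natDegree_lt
    rw [tauBasis]
    split_ifs with h
    · refine (natDegree_mul_le.trans (add_le_add natDegree_pow_le natDegree_pow_le)).trans_lt ?_
      rw [natDegree_X_add_C, natDegree_X_sub_C]; omega
    · rw [natDegree_neg]
      refine (natDegree_mul_le.trans (add_le_add natDegree_pow_le natDegree_pow_le)).trans_lt ?_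
      rw [natDegree_X_add_C, natDegree_X_sub_C]; omega

/-- The matrix of coefficients of the polynomials `tauBasis`. -/
noncomputable def tauMat (l k m : ℕ) : Matrix (Fin (l + 1)) (Fin (l + 1)) ℂ :=
  Matrix.of fun A j => (tauBasis l k m j).coeff (l - A)

theorem isUnit_det_tauMat {l k m : ℕ} (hkl : k ≤ l) (hm : m ≤ l - k) :
    IsUnit (tauMat l k m).det := by
  rw [isUnit_iff_ne_zero]
  intro h0
  obtain ⟨v, hv, hv0⟩ := Matrix.exists_mulVec_eq_zero_iff.2 h0
  apply hv
  let c : ℕ → ℂ := fun i => if h : i < l + 1 then v ⟨i, h⟩ else 0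
  have hc := tauBasis_coeff_eq_zero (l := l) (k := k) (m := m) c ?_
  · funext i
    have := hc i i.2
    simp only [c, dif_pos i.2] at this
    exact this
  · rw [← Fin.sum_univ_eq_sum_range (fun i => C (c i) * tauBasis l k m i)]
    ext d
    rw [coeff_zero]
    by_cases hd : d ≤ l
    · have h1 := congrFun hv0 (⟨l - d, by omega⟩ : Fin (l + 1))
      simp only [Matrix.mulVec, dotProduct, tauMat, Matrix.of_apply, Pi.zero_apply] at h1
      rw [finsetSum_coeff, ← h1]
      refine sum_congr rfl fun i _ => ?_
      rw [coeff_C_mul, mul_comm, show l - (l - d) = d by omega]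
      simp only [c]
      rw [dif_pos i.2]
    · refine coeff_eq_zero_of_natDegree_lt (lt_of_le_of_lt ?_ (not_le.1 hd))
      refine natDegree_sum_le_of_forall_le _ _ fun i _ => ?_
      exact (natDegree_C_mul_le _ _).trans (natDegree_tauBasis (by omega) (by omega))

/-- The functions `ϖ^j`, as linear combinations of the `θ^j`. -/
noncomputable def varpi (l k m j : ℕ) (y : Pt l) : ℂ :=
  if h : j < l + 1 then
    ∑ A : Fin (l + 1), (tauMat l k m)⁻¹ ⟨j, h⟩ A * twist l k (coord l) A y
  else 0

theorem differentiableAt_varpi {l k m : ℕ} (j : ℕ) (y : Pt l) :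
    DifferentiableAt ℂ (varpi l k m j) y := by
  unfold varpi
  split_ifs with h
  · refine DifferentiableAt.fun_sum fun A _ => DifferentiableAt.const_mul ?_ _
    exact (hasGrad_twist (fun j h1 h2 => hasGrad_coord_dx h1 h2 y) (by omega)).1
  · exact differentiableAt_const 0

theorem twistPoly_eq_sum_varpi {l k m : ℕ} (hkl : k ≤ l) (hm : m ≤ l - k) (y : Pt l) :
    twistPoly l k (coord l) y = ∑ j ∈ range (l + 1), C (varpi l k m j y) * tauBasis l k m j := by
  ext d
  by_cases hd : d ≤ l
  · have h1 : (twistPoly l k (coord l) y).coeff d = twist l k (coord l) (l - d) y := by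
      rw [twistPoly, finsetSum_coeff, sum_eq_single_of_mem (l - d) (mem_range.2 (by omega))]
      · rw [coeff_C_mul, coeff_X_pow, if_pos (by omega), mul_one]
      · intro b hb hbd
        rw [mem_range] at hb
        rw [coeff_C_mul, coeff_X_pow, if_neg (by omega), mul_zero]
    rw [h1, ← Fin.sum_univ_eq_sum_range (fun i => C (varpi l k m i y) * tauBasis l k m i),
      finsetSum_coeff]
    have h2 : tauMat l k m * (tauMat l k m)⁻¹ = 1 :=
      Matrix.mul_nonsing_inv _ (isUnit_det_tauMat hkl hm)
    have h3 : (tauMat l k m).mulVec ((tauMat l k m)⁻¹.mulVec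
        fun A : Fin (l + 1) => twist l k (coord l) A y) =
          fun A : Fin (l + 1) => twist l k (coord l) A y := by
      rw [Matrix.mulVec_mulVec, h2, Matrix.one_mulVec]
    have h4 := congrFun h3 (⟨l - d, by omega⟩ : Fin (l + 1))
    rw [← h4]
    simp only [Matrix.mulVec, dotProduct, tauMat, Matrix.of_apply]
    refine sum_congr rfl fun i _ => ?_
    rw [coeff_C_mul, mul_comm, show l - (l - d) = d by omega, varpi, dif_pos i.2]
    rfl
  · have h1 : (twistPoly l k (coord l) y).natDegree ≤ l := by
      refine natDegree_sum_le_of_forall_le _ _ fun i _ => ?_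
      exact (natDegree_C_mul_X_pow_le _ _).trans (by omega)
    rw [coeff_eq_zero_of_natDegree_lt (h1.trans_lt (not_le.1 hd)), eq_comm]
    refine coeff_eq_zero_of_natDegree_lt (lt_of_le_of_lt ?_ (not_le.1 hd))
    refine natDegree_sum_le_of_forall_le _ _ fun i hi => ?_
    rw [mem_range] at hi
    exact (natDegree_C_mul_le _ _).trans (natDegree_tauBasis (by omega) (by omega))

theorem varpi_zero {l k m : ℕ} (hk : 1 ≤ k) (hkl : k ≤ l) (hm : m ≤ l - k) (y : Pt l) :
    varpi l k m 0 y = Complex.exp (k * coord l (l + 1) y) := by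
  have h := congrArg (fun P : ℂ[X] => P.coeff l) (twistPoly_eq_sum_varpi hkl hm y)
  simp only [twistPoly, finsetSum_coeff, coeff_C_mul] at h
  rw [sum_eq_single_of_mem 0 (by simp), sum_eq_single_of_mem 0 (by simp)] at h
  · rw [coeff_tauBasis_top hk hkl hm (by omega), coeff_X_pow, if_pos (by omega), if_pos rfl,
      mul_one, mul_one, twist, if_pos rfl] at h
    exact h.symm
  · intro j hj hj0
    rw [mem_range] at hj
    rw [coeff_tauBasis_top hk hkl hm (by omega), if_neg hj0, mul_zero]
  · intro j hj hj0
    rw [mem_range] at hj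
    rw [coeff_X_pow, if_neg (by omega), mul_zero]

/-- The coordinates `τ`. -/
noncomputable def tau (l k m j : ℕ) (y : Pt l) : ℂ :=
  if j = 0 then 0
  else if j < k then varpi l k m j y * Complex.exp (-(((k : ℂ) - j) * coord l (l + 1) y))
  else if j ≤ l then varpi l k m j y
  else if j = l + 1 then coord l (l + 1) y
  else 0

theorem tau_last {l k : ℕ} (m : ℕ) (hkl : k ≤ l) (y : Pt l) :
    tau l k m (l + 1) y = coord l (l + 1) y := by
  rw [tau, if_neg (by omega), if_neg (by omega), if_neg (by omega), if_pos rfl]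

theorem twist_tau {l k m j : ℕ} (hk : 1 ≤ k) (hkl : k ≤ l) (hm : m ≤ l - k) (hj : j ≤ l)
    (y : Pt l) : twist l k (tau l k m) j y = varpi l k m j y := by
  rw [twist, tau_last m hkl]
  split_ifs with h0 h1
  · rw [h0, varpi_zero hk hkl hm]
  · rw [tau, if_neg h0, if_pos h1, mul_assoc, ← Complex.exp_add, neg_add_cancel, Complex.exp_zero,
      mul_one]
  · rw [tau, if_neg h0, if_neg h1, if_pos hj]

theorem differentiableAt_tau {l k m : ℕ} (j : ℕ) (y : Pt l) :
    DifferentiableAt ℂ (tau l k m j) y := by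
  have h1 := differentiableAt_varpi (k := k) (m := m) j y
  have h2 := differentiableAt_coord (l + 1) y
  unfold tau
  split_ifs
  · exact differentiableAt_const 0
  · exact h1.fun_mul ((h2.const_mul _).fun_neg).cexp
  · exact h1
  · exact h2
  · exact differentiableAt_const 0

theorem isTau_iff {l k m : ℕ} (hm : m ≤ l) (τ : ℕ → Pt l → ℂ) :
    IsTau l k m τ ↔ ∀ y, τ (l + 1) y = coord l (l + 1) y ∧
      twistPoly l k (coord l) y =
        ∑ j ∈ range (l + 1), C (twist l k τ j y) * tauBasis l k m j := by
  have hsplit : ∀ F : ℕ → ℂ[X], ∑ j ∈ range (l + 1), F j =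
      (∑ j ∈ Icc 0 (l - m), F j) + ∑ j ∈ Icc (l - m + 1) l, F j := by
    intro F
    rw [← Nat.range_succ_eq_Icc_zero, ← Ico_add_one_right_eq_Icc,
      sum_range_add_sum_Ico F (by omega)]
  have e : ∀ y, (∑ j ∈ range (l + 1), C (twist l k τ j y) * tauBasis l k m j) =
      (∑ j ∈ Icc 0 (l - m),
        C (twist l k τ j y) * ((X + C 2) ^ m * (X - C 2) ^ (l - m - j))) -
      ∑ j ∈ Icc (l - m + 1) l,
        C (twist l k τ j y) * ((X + C 2) ^ (l - j) * (X - C 2) ^ (j - k - 1)) := by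
    intro y
    rw [hsplit, sub_eq_add_neg, ← sum_neg_distrib]
    congr 1
    · refine sum_congr rfl fun j hj => ?_
      rw [mem_Icc] at hj
      rw [tauBasis, if_pos hj.2]
    · refine sum_congr rfl fun j hj => ?_
      rw [mem_Icc] at hj
      rw [tauBasis, if_neg (by omega), mul_neg]
  simp only [IsTau]
  refine forall_congr' fun y => ?_
  rw [e y, twistPoly, Nat.range_succ_eq_Icc_zero]

theorem isTau_tau {l k m : ℕ} (hk : 1 ≤ k) (hkl : k ≤ l) (hm : m ≤ l - k) :
    IsTau l k m (tau l k m) := by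
  rw [isTau_iff (by omega)]
  refine fun y => ⟨tau_last m hkl y, ?_⟩
  rw [twistPoly_eq_sum_varpi hkl hm]
  refine sum_congr rfl fun j hj => ?_
  rw [mem_range] at hj
  rw [twist_tau hk hkl hm (by omega)]

/-- The coordinates `τ` separate points. -/
theorem tau_injective {l k m : ℕ} (hk : 1 ≤ k) (hkl : k ≤ l) (hm : m ≤ l - k) {y y' : Pt l}
    (h : ∀ j, 1 ≤ j → j ≤ l + 1 → tau l k m j y = tau l k m j y') : y = y' := by
  have hY : coord l (l + 1) y = coord l (l + 1) y' := by
    rw [← tau_last m hkl, ← tau_last m hkl, h _ (by omega) le_rfl]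
  have hp : twistPoly l k (coord l) y = twistPoly l k (coord l) y' := by
    rw [((isTau_iff (by omega) _).1 (isTau_tau hk hkl hm) y).2,
      ((isTau_iff (by omega) _).1 (isTau_tau hk hkl hm) y').2]
    refine sum_congr rfl fun j hj => ?_
    rw [mem_range] at hj
    congr 2
    rcases Nat.eq_zero_or_pos j with rfl | h0
    · rw [twist, twist, if_pos rfl, if_pos rfl, h _ (by omega) le_rfl]
    · rw [twist_eq_mul_exp _ h0, twist_eq_mul_exp _ h0, h _ (by omega) le_rfl,
        h j h0 (by omega)]
  have hc : ∀ j, 1 ≤ j → j ≤ l → coord l j y = coord l j y' := by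
    intro j h1 h2
    have h3 := congrArg (fun P : ℂ[X] => P.coeff (l - j)) hp
    have h4 : ∀ y, (twistPoly l k (coord l) y).coeff (l - j) = twist l k (coord l) j y := by
      intro y
      rw [twistPoly, finsetSum_coeff, sum_eq_single_of_mem j (mem_range.2 (by omega))]
      · rw [coeff_C_mul, coeff_X_pow, if_pos rfl, mul_one]
      · intro b hb hbd
        rw [mem_range] at hb
        rw [coeff_C_mul, coeff_X_pow, if_neg (by omega), mul_zero]
    simp only [h4] at h3
    rw [twist_eq_mul_exp _ h1, twist_eq_mul_exp _ h1, hY] at h3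
    exact mul_right_cancel₀ (Complex.exp_ne_zero _) h3
  funext a
  rw [← coord_succ a y, ← coord_succ a y']
  by_cases ha : a.val + 1 ≤ l
  · exact hc _ (by omega) ha
  · rw [show a.val + 1 = l + 1 by omega]; exact hY

/-! ### The metric `η` in the functions `ϖ` -/

/-- Sizes of the three families into which the functions `ϖ^0, …, ϖ^l` are divided. -/
def famSize (l k m : ℕ) (κ : Fin 3) : ℕ := ![k + 1, l - m - k, m] κ

/-- Position of the member number `s` of a family: `ϖ^k, ϖ^{k-1}, …, ϖ^0` form the first family,
`ϖ^{k+1}, …, ϖ^{l-m}` the second one, `ϖ^{l-m+1}, …, ϖ^l` the third one. -/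
def famIdx (l k m : ℕ) (κ : Fin 3) (s : ℕ) : ℕ := ![k - s, k + 1 + s, l - m + 1 + s] κ

/-- The members of a family, extended by zero. -/
noncomputable def fam (l k m : ℕ) (κ : Fin 3) (s : ℕ) (y : Pt l) : ℂ :=
  if s < famSize l k m κ then varpi l k m (famIdx l k m κ s) y else 0

/-- The entries of the matrix of `η` in a family with members `c s`. -/
noncomputable def famGram (κ : Fin 3) (c : ℕ → ℂ) (p q : ℕ) : ℂ :=
  ![gramPoly c p q, gramOne c p q, gramTwo c p q] κ

theorem forall_fin_three {P : Fin 3 → Prop} : (∀ κ, P κ) ↔ P 0 ∧ P 1 ∧ P 2 := by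
  constructor
  · intro h; exact ⟨h 0, h 1, h 2⟩
  · rintro ⟨h0, h1, h2⟩ κ
    fin_cases κ
    exacts [h0, h1, h2]

theorem famIdx_lt {l k m : ℕ} (hkl : k ≤ l) (hm : m ≤ l - k) :
    ∀ κ s, s < famSize l k m κ → famIdx l k m κ s < l + 1 := by
  rw [forall_fin_three]
  simp only [famSize, famIdx, Matrix.cons_val]
  refine ⟨?_, ?_, ?_⟩ <;> intro s hs <;> omega

theorem sum_range_eq_sum_fam {M : Type*} [AddCommMonoid M] {l k m : ℕ} (hkl : k ≤ l)
    (hm : m ≤ l - k) (G : ℕ → M) :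
    ∑ j ∈ range (l + 1), G j =
      ∑ κ, ∑ s ∈ range (famSize l k m κ), G (famIdx l k m κ s) := by
  rw [Fin.sum_univ_three]
  simp only [famSize, famIdx, Matrix.cons_val]
  rw [← sum_range_add_sum_Ico G (by omega : l - m + 1 ≤ l + 1),
    ← sum_range_add_sum_Ico G (by omega : k + 1 ≤ l - m + 1), sum_Ico_eq_sum_range,
    sum_Ico_eq_sum_range]
  congr 1
  · congr 1
    · rw [← sum_range_reflect]
      refine sum_congr rfl fun s hs => ?_
      congr 1
    · rw [show l - m + 1 - (k + 1) = l - m - k by omega]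
  · rw [show l + 1 - (l - m + 1) = m by omega]

theorem sub_mul_sum_hankel (n : ℕ) (h : ℕ → ℂ) (p q : ℂ) (hn : ∀ s, n ≤ s → h s = 0) :
    (p - q) * ∑ a ∈ range n, ∑ b ∈ range n, p ^ a * q ^ b * h (a + b) =
      ∑ s ∈ range n, h s * (p ^ (s + 1) - q ^ (s + 1)) := by
  rw [sum_hankel n h (fun a => p ^ a) (fun b => q ^ b) hn, mul_sum]
  refine sum_congr rfl fun s _ => ?_
  rw [Finset.Nat.sum_antidiagonal_eq_sum_range_succ (fun i j => p ^ i * q ^ j), ← geom_sum₂_mul]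
  simp only [Nat.add_sub_cancel]
  ring

theorem sum_shift (n : ℕ) (c f : ℕ → ℂ) (hc : c n = 0) (hf : f 0 = 0) :
    ∑ s ∈ range n, c (s + 1) * f (s + 1) = ∑ s ∈ range n, c s * f s := by
  have h := sum_range_succ' (fun s => c s * f s) n
  rw [sum_range_succ, hc, hf] at h
  simpa using h.symm

/-- The quotients of the polynomials `tauBasis` by `unityPoly`. -/
noncomputable def famFun (κ : Fin 3) (s : ℕ) (u : ℂ) : ℂ :=
  ![(u - 2) ^ s, ((u - 2)⁻¹) ^ (s + 1), -((u - 2) ^ s * ((u + 2)⁻¹) ^ (s + 1))] κ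

/-- The images of the functions `famFun` under the derivation `(u² - 4) d/du`. -/
noncomputable def famDer (κ : Fin 3) (s : ℕ) (u : ℂ) : ℂ :=
  ![s * (u + 2), -((s + 1) * (u + 2)), s * (u + 2) - (s + 1) * (u - 2)] κ * famFun κ s u

/-- The matrices `famGram` solve `η(f(u), f(v)) = (Df(u) - Df(v))/(u - v)` for `f = ∑ c_s f_s` in
each family, where `D = (u² - 4) d/du`. -/
theorem sum_famFun_gram {u v : ℂ} (hu : u - 2 ≠ 0) (hu' : u + 2 ≠ 0) (hv : v - 2 ≠ 0)
    (hv' : v + 2 ≠ 0) (n : ℕ) (c : ℕ → ℂ) (hc : ∀ s, n ≤ s → c s = 0) :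
    ∀ κ, (u - v) * ∑ a ∈ range n, ∑ b ∈ range n,
        famFun κ a u * famFun κ b v * famGram κ c a b =
      ∑ s ∈ range n, c s * (famDer κ s u - famDer κ s v) := by
  rw [forall_fin_three]
  refine ⟨?_, ?_, ?_⟩
  · simp only [famFun, famGram, famDer, Matrix.cons_val]
    have h := sub_mul_sum_hankel n (fun s => s * c s + 4 * (s + 1 : ℕ) * c (s + 1)) (u - 2) (v - 2)
      (fun s hs => by rw [hc s hs, hc (s + 1) (by omega)]; ring)
    have h' := sum_shift n c (fun s => 4 * s * ((u - 2) ^ s - (v - 2) ^ s)) (hc n le_rfl) (by simp)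
    calc _ = (u - 2 - (v - 2)) * ∑ a ∈ range n, ∑ b ∈ range n, (u - 2) ^ a * (v - 2) ^ b *
          (((a + b : ℕ) : ℂ) * c (a + b) + 4 * (a + b + 1 : ℕ) * c (a + b + 1)) := by
          congr 1
          ring
      _ = ∑ s ∈ range n, c s * (s * ((u - 2) ^ (s + 1) - (v - 2) ^ (s + 1))) +
          ∑ s ∈ range n, c (s + 1) * (4 * (s + 1 : ℕ) *
            ((u - 2) ^ (s + 1) - (v - 2) ^ (s + 1))) := by
          rw [h, ← sum_add_distrib]
          refine sum_congr rfl fun s _ => by ring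
      _ = _ := by
          rw [h', ← sum_add_distrib]
          refine sum_congr rfl fun s _ => by ring
  · simp only [famFun, famGram, famDer, Matrix.cons_val]
    set U := (u - 2)⁻¹ with hU
    set V := (v - 2)⁻¹ with hV
    have eU : u = U⁻¹ + 2 := by rw [hU, inv_inv]; ring
    have eV : v = V⁻¹ + 2 := by rw [hV, inv_inv]; ring
    have hU0 : U ≠ 0 := inv_ne_zero hu
    have hV0 : V ≠ 0 := inv_ne_zero hv
    have h := sub_mul_sum_hankel n (fun s => 4 * (s + 1 : ℕ) * c s + (s + 2 : ℕ) * c (s + 1)) U V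
      (fun s hs => by rw [hc s hs, hc (s + 1) (by omega)]; ring)
    have h' := sum_shift n c (fun s => (s + 1 : ℕ) * (U ^ s - V ^ s)) (hc n le_rfl) (by simp)
    calc _ = -((U - V) * ∑ a ∈ range n, ∑ b ∈ range n, U ^ a * V ^ b *
          (4 * (a + b + 1 : ℕ) * c (a + b) + (a + b + 2 : ℕ) * c (a + b + 1))) := by
          rw [mul_sum, mul_sum, ← sum_neg_distrib]
          refine sum_congr rfl fun a _ => ?_
          rw [mul_sum, mul_sum, ← sum_neg_distrib]
          refine sum_congr rfl fun b _ => ?_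
          rw [gramOne, eU, eV]
          field_simp
          ring
      _ = -(∑ s ∈ range n, c s * (4 * (s + 1 : ℕ) * (U ^ (s + 1) - V ^ (s + 1))) +
          ∑ s ∈ range n, c (s + 1) * ((s + 1 + 1 : ℕ) * (U ^ (s + 1) - V ^ (s + 1)))) := by
          rw [h, ← sum_add_distrib]
          congr 1
          refine sum_congr rfl fun s _ => by ring
      _ = _ := by
          rw [h', ← sum_add_distrib, ← sum_neg_distrib]
          refine sum_congr rfl fun s _ => ?_
          rw [eU, eV, pow_succ U, pow_succ V]
          push_cast
          field_simp
          ring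
  · simp only [famFun, famGram, famDer, Matrix.cons_val]
    set R := (u - 2) * (u + 2)⁻¹ with hR
    set S := (v - 2) * (v + 2)⁻¹ with hS
    have hRS : (R - S) = 4 * (u - v) * ((u + 2)⁻¹ * (v + 2)⁻¹) := by
      rw [hR, hS]; field_simp; ring
    have h := sub_mul_sum_hankel n (fun s => 4 * (s + 1 : ℕ) * (c s - c (s + 1))) R S
      (fun s hs => by rw [hc s hs, hc (s + 1) (by omega)]; ring)
    have h' := sum_shift n c (fun s => -s * (R ^ s - S ^ s)) (hc n le_rfl) (by simp)
    calc _ = ((R - S) * ∑ a ∈ range n, ∑ b ∈ range n, R ^ a * S ^ b *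
          (4 * (a + b + 1 : ℕ) * (c (a + b) - c (a + b + 1)))) / 4 := by
          rw [mul_sum, mul_sum, sum_div]
          refine sum_congr rfl fun a _ => ?_
          rw [mul_sum, mul_sum, sum_div]
          refine sum_congr rfl fun b _ => ?_
          rw [gramTwo, hRS, hR, hS,
            mul_pow, mul_pow]
          ring
      _ = ∑ s ∈ range n, c s * ((s + 1) * (R ^ (s + 1) - S ^ (s + 1))) +
          ∑ s ∈ range n, c (s + 1) * (-(s + 1 : ℕ) * (R ^ (s + 1) - S ^ (s + 1))) := by
          rw [h, ← sum_add_distrib, sum_div]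
          refine sum_congr rfl fun s _ => ?_
          push_cast; ring
      _ = _ := by
          rw [h', ← sum_add_distrib]
          refine sum_congr rfl fun s _ => ?_
          have e1 : u + 2 = (u + 2)⁻¹⁻¹ := (inv_inv _).symm
          rw [pow_succ R, pow_succ S, pow_succ (u + 2)⁻¹, pow_succ (v + 2)⁻¹, hR, hS,
            mul_pow, mul_pow]
          field_simp
          ring

theorem eval_derivative_mul_pow (p q : ℕ) (u : ℂ) :
    (u ^ 2 - 4) * (derivative ((X + C 2) ^ p * (X - C 2) ^ q : ℂ[X])).eval u =
      (p * (u - 2) + q * (u + 2)) * ((u + 2) ^ p * (u - 2) ^ q) := by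
  have h : ∀ (n : ℕ) (x : ℂ), (n : ℂ) * x ^ (n - 1) * x = n * x ^ n := by
    intro n x
    rcases n with _ | n
    · simp
    · rw [Nat.add_sub_cancel, mul_assoc, ← pow_succ]
  simp only [derivative_mul, derivative_pow, derivative_add, derivative_sub, derivative_X,
    derivative_C, eval_add, eval_mul, eval_pow, eval_sub, eval_X, eval_C, map_natCast,
    eval_natCast, add_zero, sub_zero, mul_one]
  linear_combination (u - 2) * (u - 2) ^ q * h p (u + 2) + (u + 2) * (u + 2) ^ p * h q (u - 2)

/-- The polynomials `tauBasis` and their derivatives in terms of the functions `famFun`. -/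
theorem eval_tauBasis_famIdx {l k m : ℕ} (hkl : k ≤ l) (hm : m ≤ l - k) {u : ℂ} (hu : u - 2 ≠ 0)
    (hu' : u + 2 ≠ 0) : ∀ κ s, s < famSize l k m κ →
      (tauBasis l k m (famIdx l k m κ s)).eval u = (unityPoly l k m).eval u * famFun κ s u ∧
      (u ^ 2 - 4) * (derivative (tauBasis l k m (famIdx l k m κ s))).eval u =
        (unityPoly l k m).eval u * (famDer κ s u +
          (m * (u - 2) + (l - k - m : ℕ) * (u + 2)) * famFun κ s u) := by
  rw [forall_fin_three]
  simp only [famSize, famIdx, famFun, famDer, Matrix.cons_val, unityPoly]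
  refine ⟨fun s hs => ?_, fun s hs => ?_, fun s hs => ?_⟩
  · rw [tauBasis, if_pos (by omega), eval_derivative_mul_pow,
      show l - m - (k - s) = l - k - m + s by omega]
    constructor
    · simp only [eval_mul, eval_pow, eval_add, eval_sub, eval_X, eval_C, pow_add]; ring
    · simp only [eval_mul, eval_pow, eval_add, eval_sub, eval_X, eval_C, pow_add]
      push_cast; ring
  · obtain ⟨q, hq⟩ : ∃ q, l - k - m = q + (s + 1) := ⟨l - k - m - (s + 1), by omega⟩
    rw [tauBasis, if_pos (by omega), eval_derivative_mul_pow,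
      show l - m - (k + 1 + s) = q by omega, hq]
    have hi : (u - 2) ^ (s + 1) * ((u - 2)⁻¹) ^ (s + 1) = 1 := by
      rw [← mul_pow, mul_inv_cancel₀ hu, one_pow]
    constructor
    · simp only [eval_mul, eval_pow, eval_add, eval_sub, eval_X, eval_C]
      rw [pow_add]
      linear_combination -((u + 2) ^ m * (u - 2) ^ q) * hi
    · simp only [eval_mul, eval_pow, eval_add, eval_sub, eval_X, eval_C]
      rw [pow_add _ q]
      push_cast
      linear_combination -((m * (u - 2) + q * (u + 2)) * ((u + 2) ^ m * (u - 2) ^ q)) * hi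
  · obtain ⟨q, hq⟩ : ∃ q, m = q + (s + 1) := ⟨m - (s + 1), by omega⟩
    have hi : (u + 2) ^ (s + 1) * ((u + 2)⁻¹) ^ (s + 1) = 1 := by
      rw [← mul_pow, mul_inv_cancel₀ hu', one_pow]
    rw [tauBasis, if_neg (by omega), derivative_neg]
    simp only [eval_neg, mul_neg]
    rw [eval_derivative_mul_pow,
      show l - (l - m + 1 + s) = q by omega, show l - m + 1 + s - k - 1 = l - k - m + s by omega]
    constructor
    · simp only [eval_mul, eval_pow, eval_add, eval_sub, eval_X, eval_C]
      rw [show (u + 2) ^ m = (u + 2) ^ q * (u + 2) ^ (s + 1) by rw [← pow_add, ← hq]]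
      linear_combination ((u + 2) ^ q * (u - 2) ^ (l - k - m) * (u - 2) ^ s) * hi
    · simp only [eval_mul, eval_pow, eval_add, eval_sub, eval_X, eval_C]
      rw [show (u + 2) ^ m = (u + 2) ^ q * (u + 2) ^ (s + 1) by rw [← pow_add, ← hq],
        show (m : ℂ) = q + (s + 1) by exact_mod_cast hq]
      push_cast
      linear_combination ((q * (u - 2) + ((l - k - m : ℕ) + s) * (u + 2)) *
        ((u + 2) ^ q * (u - 2) ^ (l - k - m) * (u - 2) ^ s)) * hi

/-- The expression for `η` on the polynomials `tauBasis`. After division by `unityPoly`, the terms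
with its logarithmic derivative cancel against the term `(k - l) P(u) Q(v)` of `metricExpr`. -/
theorem metricExpr_tauBasis_unityPoly {l k m : ℕ} (hkl : k ≤ l) (hm : m ≤ l - k) {u v : ℂ}
    (hu : u - 2 ≠ 0) (hu' : u + 2 ≠ 0) (hv : v - 2 ≠ 0) (hv' : v + 2 ≠ 0) (huv : u ≠ v) (κ : Fin 3)
    (s : ℕ) (hs : s < famSize l k m κ) :
    metricExpr l k (tauBasis l k m (famIdx l k m κ s)) (unityPoly l k m) u v +
        metricExpr l k (unityPoly l k m) (tauBasis l k m (famIdx l k m κ s)) u v =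
      (unityPoly l k m).eval u * (unityPoly l k m).eval v *
        ((famDer κ s u - famDer κ s v) / (u - v)) := by
  obtain ⟨h1, h2⟩ := eval_tauBasis_famIdx hkl hm hu hu' κ s hs
  obtain ⟨h3, h4⟩ := eval_tauBasis_famIdx hkl hm hv hv' κ s hs
  have h5 : ∀ u, (u ^ 2 - 4) * (derivative (unityPoly l k m)).eval u =
      (m * (u - 2) + (l - k - m : ℕ) * (u + 2)) * (unityPoly l k m).eval u := by
    intro u
    rw [unityPoly, eval_derivative_mul_pow]
    simp only [eval_mul, eval_pow, eval_add, eval_sub, eval_X, eval_C]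
  have h6 : ((l - k - m : ℕ) : ℂ) + m = l - k := by
    rw [← Nat.cast_add, show l - k - m + m = l - k by omega, Nat.cast_sub hkl]
  have huv' : u - v ≠ 0 := sub_ne_zero.2 huv
  unfold metricExpr
  rw [h1, h2, h3, mul_right_comm (v ^ 2 - 4) _ (eval v (derivative (tauBasis l k m _))), h4, h5,
    mul_right_comm (v ^ 2 - 4) _ (eval v (derivative (unityPoly l k m))), h5]
  field_simp
  linear_combination (u - v) * (famFun κ s u + famFun κ s v) * (unityPoly l k m).eval u *
    (unityPoly l k m).eval v * h6

theorem metricExpr_sum {ι : Type*} (l k : ℕ) (t : Finset ι) (c : ι → ℂ) (T : ι → ℂ[X]) (E : ℂ[X])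
    (u v : ℂ) :
    metricExpr l k (∑ i ∈ t, C (c i) * T i) E u v + metricExpr l k E (∑ i ∈ t, C (c i) * T i) u v =
      ∑ i ∈ t, c i * (metricExpr l k (T i) E u v + metricExpr l k E (T i) u v) := by
  classical
  induction t using Finset.induction_on with
  | empty => simp [metricExpr]
  | insert i t hi ih =>
    rw [sum_insert hi, sum_insert hi, ← ih]
    simp only [metricExpr, derivative_add, derivative_mul, derivative_C, eval_add, eval_mul, eval_C,
      zero_mul, zero_add]
    ring

theorem nodeU_sub_two_ne_zero (l : ℕ) (a : Fin (l + 1)) :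
    nodeU l a - 2 ≠ 0 ∧ nodeU l a + 2 ≠ 0 := by
  constructor
  · rw [nodeU, sub_ne_zero]; exact_mod_cast (by omega : a.val + 3 ≠ 2)
  · rw [nodeU]; exact_mod_cast (by omega : a.val + 3 + 2 ≠ 0)

theorem nodeV_sub_two_ne_zero (l : ℕ) (a : Fin (l + 1)) :
    nodeV l a - 2 ≠ 0 ∧ nodeV l a + 2 ≠ 0 := by
  constructor
  · rw [nodeV, sub_ne_zero]; exact_mod_cast (by omega : a.val + (l + 4) ≠ 2)
  · rw [nodeV]; exact_mod_cast (by omega : a.val + (l + 4) + 2 ≠ 0)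

/-- The differential of a function, as the vector of its partial derivatives. -/
noncomputable def gradient {l : ℕ} (f : Pt l → ℂ) (y : Pt l) : Pt l := fun a => pd f a y

theorem hasGrad_gradient {l : ℕ} {f : Pt l → ℂ} {y : Pt l} (hf : DifferentiableAt ℂ f y) :
    HasGrad f (gradient f y) y := ⟨hf, fun _ => rfl⟩

theorem hasGrad_fam {l k m : ℕ} (κ : Fin 3) (s : ℕ) (y : Pt l) :
    HasGrad (fam l k m κ s) (gradient (fam l k m κ s) y) y := by
  refine hasGrad_gradient ?_
  unfold fam
  split_ifs
  · exact differentiableAt_varpi _ _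
  · exact differentiableAt_const 0

theorem fam_eq_zero {l k m : ℕ} (κ : Fin 3) (s : ℕ) (h : famSize l k m κ ≤ s) (y : Pt l) :
    fam l k m κ s y = 0 := by
  rw [fam, if_neg (by omega)]

theorem twistPoly_eq_sum_fam {l k m : ℕ} (hkl : k ≤ l) (hm : m ≤ l - k) (y : Pt l) :
    twistPoly l k (coord l) y = ∑ x : (κ : Fin 3) × Fin (famSize l k m κ),
      C (fam l k m x.1 x.2 y) * tauBasis l k m (famIdx l k m x.1 x.2) := by
  rw [twistPoly_eq_sum_varpi hkl hm, sum_range_eq_sum_fam hkl hm, Fintype.sum_sigma]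
  refine sum_congr rfl fun κ _ => ?_
  rw [Fin.sum_univ_eq_sum_range (fun s => C (fam l k m κ s y) * tauBasis l k m (famIdx l k m κ s))]
  refine sum_congr rfl fun s hs => ?_
  rw [fam, if_pos (mem_range.1 hs)]

/-- The polynomials `tauBasis`, evaluated at `l + 1` nodes, are linearly independent. -/
theorem eq_zero_of_sum_eval_tauBasis {l k m : ℕ} (hkl : k ≤ l) (hm : m ≤ l - k)
    {u : Fin (l + 1) → ℂ} (hu : Function.Injective u)
    (c : (κ : Fin 3) × Fin (famSize l k m κ) → ℂ)
    (hc : ∀ a, ∑ x, (tauBasis l k m (famIdx l k m x.1 x.2)).eval (u a) * c x = 0) : c = 0 := by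
  let cc : Fin 3 → ℕ → ℂ := fun κ s => if h : s < famSize l k m κ then c ⟨κ, ⟨s, h⟩⟩ else 0
  let c' : ℕ → ℂ := fun j => if j ≤ k then cc 0 (k - j) else if j ≤ l - m then cc 1 (j - (k + 1))
    else cc 2 (j - (l - m + 1))
  have e : ∀ κ s, s < famSize l k m κ → c' (famIdx l k m κ s) = cc κ s := by
    rw [forall_fin_three]
    simp only [famSize, famIdx, Matrix.cons_val, c']
    refine ⟨fun s hs => ?_, fun s hs => ?_, fun s hs => ?_⟩
    · rw [if_pos (by omega), show k - (k - s) = s by omega]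
    · rw [if_neg (by omega), if_pos (by omega), Nat.add_sub_cancel_left]
    · rw [if_neg (by omega), if_neg (by omega), Nat.add_sub_cancel_left]
  have h0 : ∑ j ∈ range (l + 1), C (c' j) * tauBasis l k m j = 0 := by
    refine eq_zero_of_degree_lt_of_eval_index_eq_zero (s := univ) (v := u) hu.injOn ?_
      fun a _ => ?_
    · rw [card_univ, Fintype.card_fin]
      refine (degree_sum_le _ _).trans_lt ((Finset.sup_lt_iff (WithBot.bot_lt_coe _)).2 ?_)
      intro j hj
      rw [mem_range] at hj
      refine (degree_le_of_natDegree_le ((natDegree_C_mul_le _ _).trans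
        (natDegree_tauBasis (by omega) (by omega : j ≤ l)))).trans_lt ?_
      exact_mod_cast Nat.lt_succ_self l
    · rw [sum_range_eq_sum_fam hkl hm, eval_finsetSum, ← hc a, Fintype.sum_sigma]
      refine sum_congr rfl fun κ _ => ?_
      rw [eval_finsetSum, ← Fin.sum_univ_eq_sum_range
        (fun s => (C (c' (famIdx l k m κ s)) * tauBasis l k m (famIdx l k m κ s)).eval (u a))]
      refine sum_congr rfl fun s _ => ?_
      rw [e κ s s.2, eval_mul, eval_C, mul_comm]
      simp only [cc]
      rw [dif_pos s.2]
  funext x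
  obtain ⟨κ, s⟩ := x
  have h1 := tauBasis_coeff_eq_zero c' h0 _ (famIdx_lt hkl hm κ s s.2)
  rw [e κ s s.2] at h1
  simp only [cc, dif_pos s.2] at h1
  exact h1

/-- The matrix of `η` in the functions `ϖ` is block diagonal, with three Hankel blocks: by
`sum_famFun_gram`, each family of functions `famFun` contributes products of its own members only. -/
theorem bil_etaForm_fam {l k m : ℕ} (hk : 1 ≤ k) (hkl : k ≤ l) (hm : m ≤ l - k) (y : Pt l)
    (κ κ' : Fin 3) (s s' : ℕ) (hs : s < famSize l k m κ) (hs' : s' < famSize l k m κ') :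
    bil (etaForm l k m (gForm l k)) y (gradient (fam l k m κ s) y) (gradient (fam l k m κ' s') y) =
      if κ = κ' then famGram κ (fun i => fam l k m κ i y) s s' else 0 := by
  have hG : ∀ u : ℂ, HasGrad (fun y => (twistPoly l k (coord l) y).eval u)
      (∑ x : (κ : Fin 3) × Fin (famSize l k m κ),
        (tauBasis l k m (famIdx l k m x.1 x.2)).eval u • gradient (fam l k m x.1 x.2) y) y := by
    intro u
    simp only [twistPoly_eq_sum_fam hkl hm, eval_finsetSum, eval_mul, eval_C]
    refine HasGrad.sum _ fun x _ => ?_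
    simp only [mul_comm _ (eval u _)]
    exact (hasGrad_fam x.1 x.2 y).const_mul _
  -- the formula is checked on the values at the nodes, which determine the form
  refine gram_of_injective (ι := (κ : Fin 3) × Fin (famSize l k m κ))
    (bil (etaForm l k m (gForm l k)) y) _ _
    (fun x => gradient (fam l k m x.1 x.2) y)
    (fun (a : Fin (l + 1)) x => (tauBasis l k m (famIdx l k m x.1 x.2)).eval (nodeU l a))
    (fun (a : Fin (l + 1)) x => (tauBasis l k m (famIdx l k m x.1 x.2)).eval (nodeV l a))
    (eq_zero_of_sum_eval_tauBasis hkl hm (nodeU_injective l))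
    (eq_zero_of_sum_eval_tauBasis hkl hm (nodeV_injective l)) (fun a => rfl) (fun a => rfl)
    (fun x x' => if x.1 = x'.1 then famGram x.1 (fun i => fam l k m x.1 i y) x.2 x'.2 else 0)
    (fun a b => ?_) ⟨κ, ⟨s, hs⟩⟩ ⟨κ', ⟨s', hs'⟩⟩
  obtain ⟨hu, hu'⟩ := nodeU_sub_two_ne_zero l a
  obtain ⟨hv, hv'⟩ := nodeV_sub_two_ne_zero l b
  have huv := nodeU_ne_nodeV l a b
  rw [bil_etaForm_twistPoly hk hm hkl y a b (hG _) (hG _), twistPoly_eq_sum_fam hkl hm,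
    metricExpr_sum, Fintype.sum_sigma, Fintype.sum_sigma]
  refine sum_congr rfl fun κ _ => ?_
  calc _ = (unityPoly l k m).eval (nodeU l a) * (unityPoly l k m).eval (nodeV l b) *
        ((∑ s ∈ range (famSize l k m κ), fam l k m κ s y *
          (famDer κ s (nodeU l a) - famDer κ s (nodeV l b))) / (nodeU l a - nodeV l b)) := by
        rw [sum_div, mul_sum, ← Fin.sum_univ_eq_sum_range (fun s =>
          (unityPoly l k m).eval (nodeU l a) * (unityPoly l k m).eval (nodeV l b) *
          (fam l k m κ s y *
          (famDer κ s (nodeU l a) - famDer κ s (nodeV l b)) / (nodeU l a - nodeV l b)))]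
        refine sum_congr rfl fun s _ => ?_
        rw [metricExpr_tauBasis_unityPoly hkl hm hu hu' hv hv' huv κ s s.2]
        ring
    _ = ∑ s ∈ range (famSize l k m κ), ∑ s' ∈ range (famSize l k m κ),
          ((unityPoly l k m).eval (nodeU l a) * famFun κ s (nodeU l a)) *
          ((unityPoly l k m).eval (nodeV l b) * famFun κ s' (nodeV l b)) *
          famGram κ (fun i => fam l k m κ i y) s s' := by
        rw [← sum_famFun_gram hu hu' hv hv' _ _ (fun s hs => fam_eq_zero κ s hs y) κ,
          mul_div_cancel_left₀ _ (sub_ne_zero.2 huv), mul_sum]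
        refine sum_congr rfl fun s _ => ?_
        rw [mul_sum]
        refine sum_congr rfl fun s' _ => ?_
        ring
    _ = _ := by
        rw [← Fin.sum_univ_eq_sum_range (fun s => ∑ s' ∈ range (famSize l k m κ),
          ((unityPoly l k m).eval (nodeU l a) * famFun κ s (nodeU l a)) *
          ((unityPoly l k m).eval (nodeV l b) * famFun κ s' (nodeV l b)) *
          famGram κ (fun i => fam l k m κ i y) s s')]
        refine sum_congr rfl fun s _ => ?_
        rw [Fintype.sum_sigma, Fintype.sum_eq_single κ (fun κ' hκ => ?_)]
        · rw [← Fin.sum_univ_eq_sum_range (fun s' =>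
            ((unityPoly l k m).eval (nodeU l a) * famFun κ s (nodeU l a)) *
            ((unityPoly l k m).eval (nodeV l b) * famFun κ s' (nodeV l b)) *
            famGram κ (fun i => fam l k m κ i y) s s')]
          refine sum_congr rfl fun s' _ => ?_
          rw [if_pos rfl, (eval_tauBasis_famIdx hkl hm hu hu' κ s s.2).1,
            (eval_tauBasis_famIdx hkl hm hv hv' κ s' s'.2).1]
        · refine sum_eq_zero fun s' _ => ?_
          rw [if_neg (Ne.symm hκ), mul_zero]

/-! ### Linear normalization of the three families -/

/-- The changes of coordinates that bring the three kinds of Hankel matrices to their normal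
form. -/
noncomputable def changeSeries (κ : Fin 3) : ℕ → PowerSeries ℂ :=
  ![exists_change_poly.choose, exists_change_one.choose, exists_change_two.choose] κ

/-- The entries of the normalized matrices. -/
noncomputable def normGram (κ : Fin 3) (c : ℕ → ℂ) (i j : ℕ) : ℂ :=
  ![(i + j : ℕ) * c (i + j), 4 * (i + j + 1 : ℕ) * c (i + j), 4 * (i + j + 1 : ℕ) * c (i + j)] κ

theorem changeSeries_spec : ∀ κ,
    (∀ i s, s < i → PowerSeries.coeff s (changeSeries κ i) = 0) ∧
    (∀ i, PowerSeries.coeff i (changeSeries κ i) = 1) ∧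
    ∀ (n : ℕ) (c : ℕ → ℂ), (∀ s, n ≤ s → c s = 0) → ∀ i j,
      ∑ p ∈ range n, ∑ q ∈ range n, PowerSeries.coeff p (changeSeries κ i) *
        PowerSeries.coeff q (changeSeries κ j) * famGram κ c p q =
      normGram κ (fun i => trFun n c (changeSeries κ i)) i j := by
  rw [forall_fin_three]
  exact ⟨exists_change_poly.choose_spec, exists_change_one.choose_spec,
    exists_change_two.choose_spec⟩

/-- The normalized members of a family. -/
noncomputable def normFam (l k m : ℕ) (κ : Fin 3) (i : ℕ) (y : Pt l) : ℂ :=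
  trFun (famSize l k m κ) (fun s => fam l k m κ s y) (changeSeries κ i)

theorem normFam_eq_sum (l k m : ℕ) (κ : Fin 3) (i : ℕ) (y : Pt l) :
    normFam l k m κ i y = ∑ s ∈ range (famSize l k m κ),
      PowerSeries.coeff s (changeSeries κ i) * fam l k m κ s y := by
  rw [normFam, trFun_apply]
  exact sum_congr rfl fun s _ => mul_comm _ _

theorem normFam_eq_zero {l k m : ℕ} {κ : Fin 3} {i : ℕ} (h : famSize l k m κ ≤ i) (y : Pt l) :
    normFam l k m κ i y = 0 := by
  rw [normFam_eq_sum]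
  refine sum_eq_zero fun s hs => ?_
  rw [mem_range] at hs
  rw [(changeSeries_spec κ).1 i s (by omega), zero_mul]

theorem hasGrad_normFam {l k m : ℕ} (κ : Fin 3) (i : ℕ) (y : Pt l) :
    HasGrad (normFam l k m κ i) (gradient (normFam l k m κ i) y) y := by
  refine hasGrad_gradient ?_
  have e : normFam l k m κ i = fun y => ∑ s ∈ range (famSize l k m κ),
      PowerSeries.coeff s (changeSeries κ i) * fam l k m κ s y :=
    funext fun y => normFam_eq_sum l k m κ i y
  rw [e]
  exact DifferentiableAt.fun_sum fun s _ => ((hasGrad_fam κ s y).1).const_mul _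

theorem gradient_normFam {l k m : ℕ} (κ : Fin 3) (i : ℕ) (y : Pt l) :
    gradient (normFam l k m κ i) y = ∑ s ∈ range (famSize l k m κ),
      PowerSeries.coeff s (changeSeries κ i) • gradient (fam l k m κ s) y := by
  refine (hasGrad_normFam κ i y).unique ?_
  have e : normFam l k m κ i = fun y => ∑ s ∈ range (famSize l k m κ),
      PowerSeries.coeff s (changeSeries κ i) * fam l k m κ s y :=
    funext fun y => normFam_eq_sum l k m κ i y
  rw [e]
  exact HasGrad.sum _ fun s _ => (hasGrad_fam κ s y).const_mul _

theorem bil_etaForm_normFam {l k m : ℕ} (hk : 1 ≤ k) (hkl : k ≤ l) (hm : m ≤ l - k) (y : Pt l)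
    (κ κ' : Fin 3) (i j : ℕ) :
    bil (etaForm l k m (gForm l k)) y (gradient (normFam l k m κ i) y)
        (gradient (normFam l k m κ' j) y) =
      if κ = κ' then normGram κ (fun i => normFam l k m κ i y) i j else 0 := by
  rw [gradient_normFam, gradient_normFam]
  simp only [map_sum, map_smul, LinearMap.sum_apply, LinearMap.smul_apply, smul_eq_mul,
    mul_sum]
  rw [sum_comm]
  by_cases h : κ = κ'
  · subst h
    rw [if_pos rfl]
    refine Eq.trans ?_ ((changeSeries_spec κ).2.2 (famSize l k m κ) (fun s => fam l k m κ s y)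
      (fun s hs => fam_eq_zero κ s hs y) i j)
    refine sum_congr rfl fun p hp => sum_congr rfl fun q hq => ?_
    rw [bil_etaForm_fam hk hkl hm y κ κ p q (mem_range.1 hp) (mem_range.1 hq), if_pos rfl]
    ring
  · rw [if_neg h]
    refine sum_eq_zero fun p hp => sum_eq_zero fun q hq => ?_
    rw [bil_etaForm_fam hk hkl hm y κ κ' p q (mem_range.1 hp) (mem_range.1 hq), if_neg h]
    ring

/-- A unitriangular linear combination, in the indexing of a block `b + 1, …, b + n`. -/
theorem sum_range_unitriangular (n b i : ℕ) (hi : i < n) (a F : ℕ → ℂ) (h0 : ∀ s < i, a s = 0)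
    (h1 : a i = 1) :
    ∑ s ∈ range n, a s * F (b + 1 + s) =
      F (b + 1 + i) + ∑ s ∈ Icc (b + 1 + i + 1) (b + n), a (s - (b + 1)) * F s := by
  rw [← sum_range_add_sum_Ico _ (by omega : i + 1 ≤ n), sum_range_succ, sum_eq_zero, h1, one_mul,
    zero_add]
  · congr 1
    have h := sum_Ico_add' (fun s => a (s - (b + 1)) * F s) (i + 1) n (b + 1)
    rw [show i + 1 + (b + 1) = b + 1 + i + 1 by omega, show n + (b + 1) = b + n + 1 by omega,
      Ico_add_one_right_eq_Icc] at h
    rw [← h]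
    refine sum_congr rfl fun s _ => ?_
    rw [Nat.add_sub_cancel, add_comm s]
  · intro s hs
    rw [h0 s (mem_range.1 hs), zero_mul]

/-! ### The normalizing coordinates `z` -/

/-- The coefficients `c^j_s` of the normalizing coordinates. -/
noncomputable def normCoef (l k m j s : ℕ) : ℂ :=
  if j ≤ l - m then PowerSeries.coeff (s - (k + 1)) (changeSeries 1 (j - (k + 1)))
  else PowerSeries.coeff (s - (l - m + 1)) (changeSeries 2 (j - (l - m + 1)))

/-- The number `k - j` of the first family, divided by `e^{(k-j) τ^{l+1}}`, as a polynomial in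
`e^{τ^{l+1}}, τ^1, …, τ^j`. -/
noncomputable def firstPoly (k j : ℕ) : MvPolynomial ℕ ℂ :=
  MvPolynomial.C (PowerSeries.coeff k (changeSeries 0 (k - j))) * MvPolynomial.X 0 ^ j +
    ∑ i ∈ Ico 1 (j + 1), MvPolynomial.C (PowerSeries.coeff (k - i) (changeSeries 0 (k - j))) *
      (MvPolynomial.X 0 ^ (j - i) * MvPolynomial.X i)

/-- The truncation of the exponential series in degree `k`. -/
noncomputable def truncExp (k : ℕ) : ℂ[X] := ∑ r ∈ range (k + 1), C ((r.factorial : ℂ)⁻¹) * X ^ r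

/-- The polynomials in one variable in the system of equations for `z^1, …, z^k`:
`k/(k-j) · exp(T/k)^{k-j}` with the exponential truncated, where the factor makes the coefficient of
`T` equal to `1`. For `j = k` the equation is linear. -/
noncomputable def firstFun (k j : ℕ) : ℂ[X] :=
  if j < k then C ((k : ℂ) / (k - j)) * (truncExp k).comp (C (k : ℂ)⁻¹ * X) ^ (k - j) else X

theorem coeff_one_mul (P Q : ℂ[X]) :
    (P * Q).coeff 1 = P.coeff 0 * Q.coeff 1 + P.coeff 1 * Q.coeff 0 := by
  rw [coeff_mul, Finset.Nat.antidiagonal_succ]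
  simp

theorem coeff_one_pow (P : ℂ[X]) (h0 : P.coeff 0 = 1) (n : ℕ) :
    (P ^ n).coeff 1 = n * P.coeff 1 := by
  have h : ∀ n, (P ^ n).coeff 0 = 1 := fun n => by rw [coeff_zero_eq_eval_zero, eval_pow,
    ← coeff_zero_eq_eval_zero, h0, one_pow]
  induction n with
  | zero => simp [coeff_one]
  | succ n ih => rw [pow_succ, coeff_one_mul, h, ih, h0]; push_cast; ring

theorem coeff_truncExp {k s : ℕ} (hs : s ≤ k) : (truncExp k).coeff s = (s.factorial : ℂ)⁻¹ := by
  rw [truncExp, finsetSum_coeff, sum_eq_single_of_mem s (mem_range.2 (by omega))]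
  · rw [coeff_C_mul, coeff_X_pow, if_pos rfl, mul_one]
  · intro b _ hb
    rw [coeff_C_mul, coeff_X_pow, if_neg (Ne.symm hb), mul_zero]

theorem coeff_firstFun_one {k : ℕ} (hk : 1 ≤ k) (j : ℕ) : (firstFun k j).coeff 1 = 1 := by
  rw [firstFun]
  split_ifs with h
  · have hkj : (k : ℂ) - j ≠ 0 := sub_ne_zero.2 (by exact_mod_cast h.ne')
    have hk0 : (k : ℂ) ≠ 0 := by exact_mod_cast (by omega : k ≠ 0)
    rw [coeff_C_mul, coeff_one_pow, comp_C_mul_X_coeff, coeff_truncExp hk, Nat.cast_sub h.le]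
    · simp only [Nat.factorial_one, Nat.cast_one, inv_one, pow_one, one_mul]
      field_simp
    · rw [comp_C_mul_X_coeff, coeff_truncExp (by omega)]; simp
  · exact coeff_X_one

/-- The polynomials `p_j` of the normalizing coordinates. -/
noncomputable def normPoly (k j : ℕ) : MvPolynomial ℕ ℂ :=
  triInv (firstPoly k) (firstFun k) j - MvPolynomial.X j

theorem firstPoly_isWeightedHomogeneous {k j : ℕ} (hj : j ≤ k) :
    (firstPoly k j).IsWeightedHomogeneous (fun i => if i = 0 then 1 else dDeg k i) (j • 1) := by
  have hX0 := MvPolynomial.isWeightedHomogeneous_X ℂ (fun i => if i = 0 then 1 else dDeg k i) 0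
  rw [if_pos rfl] at hX0
  refine MvPolynomial.IsWeightedHomogeneous.add ?_
    (MvPolynomial.IsWeightedHomogeneous.sum _ _ _ fun i hi => ?_)
  · exact (hX0.pow j).C_mul _
  · rw [mem_Ico] at hi
    have hXi := MvPolynomial.isWeightedHomogeneous_X ℂ (fun i => if i = 0 then 1 else dDeg k i) i
    rw [if_neg (by omega), dDeg, min_eq_left (by omega)] at hXi
    have h := ((hX0.pow (j - i)).mul hXi).C_mul
      (PowerSeries.coeff (k - i) (changeSeries 0 (k - j)))
    simp only [smul_eq_mul, mul_one] at h ⊢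
    rwa [Nat.sub_add_cancel (by omega)] at h

theorem X_mem_supported_Iio {i j : ℕ} (h : i < j) :
    (MvPolynomial.X i : MvPolynomial ℕ ℂ) ∈ MvPolynomial.supported ℂ (Set.Iio j) :=
  Algebra.subset_adjoin ⟨i, h, rfl⟩

theorem C_mem_supported (c : ℂ) (s : Set ℕ) : MvPolynomial.C c ∈ MvPolynomial.supported ℂ s :=
  (MvPolynomial.supported ℂ s).algebraMap_mem c

theorem firstPoly_mem {k i j : ℕ} (hj : 1 ≤ j) (h : i < j) :
    firstPoly k i ∈ MvPolynomial.supported ℂ (Set.Iio j) := by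
  refine Subalgebra.add_mem _ ?_ (Subalgebra.sum_mem _ fun s hs => ?_)
  · exact Subalgebra.mul_mem _ (C_mem_supported _ _)
      (Subalgebra.pow_mem _ (X_mem_supported_Iio (by omega)) _)
  · rw [mem_Ico] at hs
    exact Subalgebra.mul_mem _ (C_mem_supported _ _) (Subalgebra.mul_mem _
      (Subalgebra.pow_mem _ (X_mem_supported_Iio (by omega)) _) (X_mem_supported_Iio (by omega)))

theorem normPoly_spec {k j : ℕ} (hj : 1 ≤ j) (hjk : j ≤ k) :
    (∀ i ∈ (normPoly k j).vars, i < j) ∧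
      (normPoly k j).IsWeightedHomogeneous (fun i => if i = 0 then 1 else dDeg k i) (dDeg k j) := by
  constructor
  · have h : normPoly k j ∈ MvPolynomial.supported ℂ (Set.Iio j) := by
      have e : normPoly k j = (firstPoly k j - MvPolynomial.X j) -
          triRem (firstPoly k) (firstFun k) j := by
        rw [normPoly, triInv_eq]; ring
      rw [e]
      refine Subalgebra.sub_mem _ ?_ (triRem_mem _ _ _ fun i _ hi => firstPoly_mem hj hi)
      rw [firstPoly, sum_Ico_succ_top hj, Nat.sub_self, pow_zero, one_mul,
        (changeSeries_spec 0).2.1, map_one, one_mul, ← add_assoc, add_sub_cancel_right]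
      refine Subalgebra.add_mem _ ?_ (Subalgebra.sum_mem _ fun s hs => ?_)
      · exact Subalgebra.mul_mem _ (C_mem_supported _ _)
          (Subalgebra.pow_mem _ (X_mem_supported_Iio (by omega)) _)
      · rw [mem_Ico] at hs
        exact Subalgebra.mul_mem _ (C_mem_supported _ _) (Subalgebra.mul_mem _
          (Subalgebra.pow_mem _ (X_mem_supported_Iio (by omega)) _)
          (X_mem_supported_Iio (by omega)))
    intro i hi
    exact MvPolynomial.mem_supported.1 h hi
  · have hX := MvPolynomial.isWeightedHomogeneous_X ℂ (fun i => if i = 0 then 1 else dDeg k i) j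
    rw [if_neg (by omega)] at hX
    have e : dDeg k j = j • 1 := by rw [dDeg, min_eq_left hjk, smul_eq_mul, mul_one]
    rw [normPoly, triInv_eq]
    refine MvPolynomial.IsWeightedHomogeneous.sub (MvPolynomial.IsWeightedHomogeneous.sub ?_ ?_) hX
    · rw [e]; exact firstPoly_isWeightedHomogeneous hjk
    · rw [e]
      exact triRem_isWeightedHomogeneous _ _ _ _ _ fun i _ hi =>
        firstPoly_isWeightedHomogeneous (by omega)

/-- Normalizing coordinates. -/
noncomputable def zNorm (l k m : ℕ) : ℕ → Pt l → ℂ :=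
  zCoord l k m (tau l k m) (normPoly k) (normCoef l k m)

/-- The values of `e^{τ^{l+1}}, τ^1, τ^2, …`. -/
noncomputable def tauVal (l k m : ℕ) (y : Pt l) (i : ℕ) : ℂ :=
  if i = 0 then Complex.exp (tau l k m (l + 1) y) else tau l k m i y

theorem zNorm_first {l k m j : ℕ} (hj : 1 ≤ j) (hjk : j ≤ k) (y : Pt l) :
    zNorm l k m j y = MvPolynomial.eval (tauVal l k m y)
      (triInv (firstPoly k) (firstFun k) j) := by
  have e : triInv (firstPoly k) (firstFun k) j = MvPolynomial.X j + normPoly k j := by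
    rw [normPoly]; ring
  rw [zNorm, zCoord, if_pos hjk, e, map_add, MvPolynomial.eval_X, tauVal, if_neg (by omega)]
  rfl

/-- The indices of the coordinates `z` that belong to the three families; `z^{l+1}` belongs to the
first one. -/
def zIdx (l k m : ℕ) (κ : Fin 3) (i : ℕ) : ℕ :=
  ![if i = 0 then l + 1 else i, k + 1 + i, l - m + 1 + i] κ

theorem zNorm_last {l k m : ℕ} (hkl : k ≤ l) (y : Pt l) :
    zNorm l k m (l + 1) y = coord l (l + 1) y := by
  rw [zNorm, zCoord, if_neg (by omega), if_neg (by omega), if_neg (by omega), tau_last m hkl]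

theorem tau_eq_varpi {l k m j : ℕ} (hk : 1 ≤ k) (hj : k ≤ j) (hjl : j ≤ l) (y : Pt l) :
    tau l k m j y = varpi l k m j y := by
  rw [tau, if_neg (by omega), if_neg (by omega), if_pos hjl]

theorem zNorm_block {l k m : ℕ} (hk : 1 ≤ k) (hkl : k ≤ l) (hm : m ≤ l - k) (y : Pt l) :
    ∀ κ, κ ≠ 0 → ∀ i < famSize l k m κ,
      zNorm l k m (zIdx l k m κ i) y = normFam l k m κ i y := by
  rw [forall_fin_three]
  refine ⟨fun h => absurd rfl h, fun _ i hi => ?_, fun _ i hi => ?_⟩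
  · have hs := changeSeries_spec 1
    have h := sum_range_unitriangular (famSize l k m 1) k i hi
      (fun s => PowerSeries.coeff s (changeSeries 1 i)) (fun s => varpi l k m s y)
      (fun s => hs.1 i s) (hs.2.1 i)
    rw [normFam_eq_sum, sum_congr rfl fun s hs => by
      rw [fam, if_pos (mem_range.1 hs)]]
    refine Eq.trans ?_ h.symm
    simp only [famSize, Matrix.cons_val] at hi
    simp only [zIdx, famSize, Matrix.cons_val, zNorm]
    rw [zCoord, if_neg (by omega), if_pos (by omega), tau_eq_varpi hk (by omega) (by omega),
      show k + (l - m - k) = l - m by omega]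
    congr 1
    refine sum_congr rfl fun s hs => ?_
    rw [mem_Icc] at hs
    rw [tau_eq_varpi hk (by omega) (by omega), normCoef, if_pos (by omega),
      Nat.add_sub_cancel_left]
  · have hs := changeSeries_spec 2
    have h := sum_range_unitriangular (famSize l k m 2) (l - m) i hi
      (fun s => PowerSeries.coeff s (changeSeries 2 i)) (fun s => varpi l k m s y)
      (fun s => hs.1 i s) (hs.2.1 i)
    rw [normFam_eq_sum, sum_congr rfl fun s hs => by
      rw [fam, if_pos (mem_range.1 hs)]]
    refine Eq.trans ?_ h.symm
    simp only [famSize, Matrix.cons_val] at hi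
    simp only [zIdx, famSize, Matrix.cons_val, zNorm]
    rw [zCoord, if_neg (by omega), if_neg (by omega), if_pos (by omega),
      tau_eq_varpi hk (by omega) (by omega), show l - m + m = l by omega]
    congr 1
    refine sum_congr rfl fun s hs => ?_
    rw [mem_Icc] at hs
    rw [tau_eq_varpi hk (by omega) (by omega), normCoef, if_neg (by omega),
      Nat.add_sub_cancel_left]

/-! ### Flat coordinates of the first family -/

theorem fam_zero_eq {l k m i : ℕ} (hk : 1 ≤ k) (hkl : k ≤ l) (hm : m ≤ l - k) (h1 : 1 ≤ i)
    (hi : i ≤ k) (y : Pt l) :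
    varpi l k m i y = tauVal l k m y 0 ^ (k - i) * tauVal l k m y i := by
  rw [← twist_tau hk hkl hm (by omega), twist_eq_mul_exp _ h1, dDeg, min_eq_left hi, tauVal,
    if_pos rfl, tauVal, if_neg (by omega), ← Complex.exp_nat_mul, Nat.cast_sub hi, mul_comm]

theorem normFam_first {l k m j : ℕ} (hk : 1 ≤ k) (hkl : k ≤ l) (hm : m ≤ l - k) (hj : j ≤ k)
    (y : Pt l) : normFam l k m 0 (k - j) y =
      tauVal l k m y 0 ^ (k - j) * MvPolynomial.eval (tauVal l k m y) (firstPoly k j) := by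
  have hs := changeSeries_spec 0
  have e : normFam l k m 0 (k - j) y = ∑ i ∈ range (j + 1),
      PowerSeries.coeff (k - i) (changeSeries 0 (k - j)) * varpi l k m i y := by
    rw [normFam_eq_sum, show famSize l k m 0 = k + 1 from rfl, ← sum_range_reflect]
    refine (sum_subset (range_mono (by omega : j + 1 ≤ k + 1)) fun i hi hij => ?_).symm.trans ?_
    · rw [mem_range] at hi hij
      rw [hs.1 _ _ (by omega), zero_mul]
    · refine sum_congr rfl fun i hi => ?_
      rw [mem_range] at hi
      rw [fam, show famSize l k m 0 = k + 1 from rfl, if_pos (show k + 1 - 1 - i < k + 1 by omega)]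
      congr 2
      show k - (k + 1 - 1 - i) = i
      omega
  have h0 : varpi l k m 0 y = tauVal l k m y 0 ^ k := by
    rw [varpi_zero hk hkl hm, tauVal, if_pos rfl, ← Complex.exp_nat_mul, tau_last m hkl]
  rw [e, firstPoly, map_add, map_sum, map_mul, map_pow, MvPolynomial.eval_X, MvPolynomial.eval_C,
    range_eq_Ico, sum_eq_sum_Ico_succ_bot (by omega), mul_add, h0, mul_sum]
  congr 1
  · rw [Nat.sub_zero, mul_left_comm, ← pow_add, Nat.sub_add_cancel hj]
  · refine sum_congr rfl fun i hi => ?_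
    rw [mem_Ico] at hi
    rw [map_mul, map_mul, map_pow, MvPolynomial.eval_X, MvPolynomial.eval_X, MvPolynomial.eval_C,
      fam_zero_eq hk hkl hm hi.1 (by omega), show k - i = (k - j) + (j - i) by omega, pow_add]
    ring

/-- The functions `y^{l+1}, z^1/k, …, z^k/k`. -/
noncomputable def ell (l k m i : ℕ) (y : Pt l) : ℂ :=
  if i = 0 then coord l (l + 1) y else (k : ℂ)⁻¹ * zNorm l k m i y

/-- The generating polynomial of `z^1/k, …, z^k/k`. -/
noncomputable def ellPoly (l k m : ℕ) (y : Pt l) : ℂ[X] :=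
  ∑ i ∈ Ico 1 (k + 1), C (ell l k m i y) * X ^ i

/-- The polynomial whose powers have the normalized functions of the first family as their
coefficients: the exponential of `y^{l+1} + ∑ (z^i/k) X^i`, truncated. -/
noncomputable def expPoly (l k m : ℕ) (y : Pt l) : ℂ[X] :=
  C (Complex.exp (coord l (l + 1) y)) *
    ∑ r ∈ range (k + 1), C ((r.factorial : ℂ)⁻¹) * ellPoly l k m y ^ r

theorem coeff_ellPoly_zero (l k m : ℕ) (y : Pt l) : (ellPoly l k m y).coeff 0 = 0 := by
  rw [ellPoly, coeff_sum_C_mul_X_pow, if_neg (by simp)]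

theorem coeff_expPoly_zero (l k m : ℕ) (y : Pt l) :
    (expPoly l k m y).coeff 0 = Complex.exp (coord l (l + 1) y) := by
  rw [coeff_zero_eq_eval_zero, expPoly, eval_mul, eval_C, eval_finsetSum,
    sum_eq_single_of_mem 0 (by simp)]
  · simp
  · intro r _ hr
    rw [eval_mul, eval_pow, ← coeff_zero_eq_eval_zero (ellPoly l k m y), coeff_ellPoly_zero,
      zero_pow hr, mul_zero]

theorem aeval_firstFun {k j : ℕ} (hk : 1 ≤ k) (hj : j < k) (L : ℂ[X]) :
    aeval (C (k : ℂ) * L) (firstFun k j) = C ((k : ℂ) / (k - j)) *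
      (∑ r ∈ range (k + 1), C ((r.factorial : ℂ)⁻¹) * L ^ r) ^ (k - j) := by
  have hk0 : (k : ℂ) ≠ 0 := by exact_mod_cast (by omega : k ≠ 0)
  rw [firstFun, if_pos hj, map_mul, map_pow, aeval_C, aeval_comp, map_mul, aeval_C, aeval_X]
  have h : (algebraMap ℂ ℂ[X]) (k : ℂ)⁻¹ * (C (k : ℂ) * L) = L := by
    rw [← mul_assoc]
    change C (k : ℂ)⁻¹ * C (k : ℂ) * L = L
    rw [← C_mul, inv_mul_cancel₀ hk0, C_1, one_mul]
  rw [h, truncExp, map_sum]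
  congr 2
  refine sum_congr rfl fun r _ => ?_
  rw [map_mul, map_pow, aeval_C, aeval_X]
  rfl

/-- The defining system of equations for `z^1, …, z^k`. -/
theorem smul_normFam_first {l k m N : ℕ} (hk : 1 ≤ k) (hkl : k ≤ l) (hm : m ≤ l - k) (hN : N ≤ k)
    (y : Pt l) :
    (N : ℂ) * normFam l k m 0 N y = k * (expPoly l k m y ^ N).coeff (k - N) := by
  have hk0 : (k : ℂ) ≠ 0 := by exact_mod_cast (by omega : k ≠ 0)
  obtain ⟨j, hj, rfl⟩ : ∃ j, j ≤ k ∧ N = k - j := ⟨k - N, by omega, by omega⟩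
  rw [show k - (k - j) = j by omega]
  rcases Nat.eq_zero_or_pos j with rfl | h0
  · rw [Nat.sub_zero, coeff_zero_eq_eval_zero, eval_pow, ← coeff_zero_eq_eval_zero,
      coeff_expPoly_zero]
    have h := normFam_first hk hkl hm (Nat.zero_le k) y
    rw [Nat.sub_zero] at h
    rw [h, firstPoly, zero_add, Ico_self, sum_empty, Nat.sub_zero, (changeSeries_spec 0).2.1]
    simp [tauVal, tau_last m hkl]
  · rcases hj.lt_or_eq with h1 | rfl
    · have hkj : (k : ℂ) - j ≠ 0 := sub_ne_zero.2 (by exact_mod_cast h1.ne')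
      have h := coeff_aeval_triInv (firstPoly k) (firstFun k) (tauVal l k m y) j k
        (coeff_firstFun_one hk j) h0 hj
      have e : (∑ i ∈ Ico 1 (k + 1), C (MvPolynomial.eval (tauVal l k m y)
          (triInv (firstPoly k) (firstFun k) i)) * X ^ i : ℂ[X]) = C (k : ℂ) * ellPoly l k m y := by
        rw [ellPoly, mul_sum]
        refine sum_congr rfl fun i hi => ?_
        rw [mem_Ico] at hi
        rw [ell, if_neg (by omega), zNorm_first hi.1 (by omega), ← mul_assoc, ← C_mul,
          mul_inv_cancel_left₀ hk0]
      rw [e, aeval_firstFun hk h1, coeff_C_mul] at h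
      rw [normFam_first hk hkl hm hj, ← h, expPoly, mul_pow, ← C_pow, coeff_C_mul, tauVal,
        if_pos rfl, tau_last m hkl, Nat.cast_sub hj]
      field_simp
    · rw [Nat.sub_self, pow_zero, coeff_one, if_neg (by omega)]
      simp

theorem normFam_first_zero {l k m : ℕ} (hk : 1 ≤ k) (hkl : k ≤ l) (hm : m ≤ l - k) (y : Pt l) :
    normFam l k m 0 0 y = k * ell l k m k y := by
  have hk0 : (k : ℂ) ≠ 0 := by exact_mod_cast (by omega : k ≠ 0)
  have h := coeff_aeval_triInv (firstPoly k) (firstFun k) (tauVal l k m y) k k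
    (coeff_firstFun_one hk k) hk le_rfl
  rw [firstFun, if_neg (lt_irrefl k), aeval_X, coeff_sum_C_mul_X_pow,
    if_pos (mem_Ico.2 ⟨hk, Nat.lt_succ_self k⟩)] at h
  have h' := normFam_first hk hkl hm (le_refl k) y
  rw [Nat.sub_self, pow_zero, one_mul, ← h, ← zNorm_first hk le_rfl] at h'
  rw [h', ell, if_neg (by omega), mul_inv_cancel_left₀ hk0]

theorem differentiableAt_eval_mvPolynomial {l : ℕ} {v : Pt l → ℕ → ℂ} {y : Pt l}
    (hv : ∀ i, DifferentiableAt ℂ (fun y => v y i) y) (P : MvPolynomial ℕ ℂ) :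
    DifferentiableAt ℂ (fun y => MvPolynomial.eval (v y) P) y := by
  induction P using MvPolynomial.induction_on with
  | C a => simp
  | add P Q hP hQ => simp only [map_add]; exact hP.fun_add hQ
  | mul_X P i hP =>
    simp only [map_mul, MvPolynomial.eval_X]
    exact hP.fun_mul (hv i)

theorem differentiableAt_tauVal {l k m : ℕ} (i : ℕ) (y : Pt l) :
    DifferentiableAt ℂ (fun y => tauVal l k m y i) y := by
  unfold tauVal
  split_ifs
  · exact (differentiableAt_tau _ y).cexp
  · exact differentiableAt_tau _ y

theorem differentiableAt_zCoord {l k m : ℕ} (p : ℕ → MvPolynomial ℕ ℂ) (c : ℕ → ℕ → ℂ) (j : ℕ)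
    (y : Pt l) : DifferentiableAt ℂ (zCoord l k m (tau l k m) p c j) y := by
  have h := differentiableAt_tau (l := l) (k := k) (m := m) j y
  have hs : ∀ t : Finset ℕ, DifferentiableAt ℂ (fun y => ∑ s ∈ t, c j s * tau l k m s y) y :=
    fun t => DifferentiableAt.fun_sum fun s _ => (differentiableAt_tau s y).const_mul _
  unfold zCoord
  split_ifs
  · exact h.fun_add (differentiableAt_eval_mvPolynomial (fun i => differentiableAt_tauVal i y) _)
  · exact h.fun_add (hs _)
  · exact h.fun_add (hs _)
  · exact h

theorem hasGrad_ell {l k m : ℕ} (i : ℕ) (y : Pt l) :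
    HasGrad (ell l k m i) (gradient (ell l k m i) y) y := by
  refine hasGrad_gradient ?_
  unfold ell
  split_ifs
  · exact differentiableAt_coord _ y
  · exact (differentiableAt_zCoord _ _ _ y).const_mul _

/-- Differentiating the exponential multiplies it by the differential of the exponent. -/
theorem hasCoeffDeriv_expPoly (l k m : ℕ) (y : Pt l) : ∃ dS : ℕ → ℂ[X],
    HasCoeffDeriv (k + 1) (fun j => gradient (ell l k m j) y) (expPoly l k m) dS y ∧
      ∀ j < k + 1, X ^ (k + 1) ∣ dS j - X ^ j * expPoly l k m y := by
  have hE : HasCoeffDeriv (k + 1) (fun j => gradient (ell l k m j) y)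
      (fun y => C (Complex.exp (coord l (l + 1) y)))
      (fun j => if j = 0 then C (Complex.exp (coord l (l + 1) y)) else 0) y := by
    intro s
    have h0 : HasGrad (coord l (l + 1)) (gradient (ell l k m 0) y) y := hasGrad_ell 0 y
    simp only [coeff_C]
    split_ifs with hs
    · refine h0.cexp.congr_grad ?_
      rw [sum_eq_single_of_mem 0 (by simp)]
      · simp [hs]
      · intro j _ hj
        simp [hj]
    · refine (HasGrad.const 0).congr_grad (sum_eq_zero fun j _ => ?_).symm
      split_ifs
      · rw [coeff_C, if_neg hs, zero_smul]
      · simp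
  have hL : HasCoeffDeriv (k + 1) (fun j => gradient (ell l k m j) y) (ellPoly l k m)
      (fun j => if j ∈ Ico 1 (k + 1) then X ^ j else 0) y :=
    HasCoeffDeriv.generating (by intro j; simp) fun j _ => hasGrad_ell j y
  have hV := hE.mul (HasCoeffDeriv.sum (range (k + 1)) fun r _ =>
    (HasCoeffDeriv.const (C ((r.factorial : ℂ)⁻¹))).mul (hL.pow r))
  refine ⟨_, hV, fun j hj => ?_⟩
  by_cases h0 : j = 0
  · subst h0
    simp [expPoly]
  · have hj' : j ∈ Ico 1 (k + 1) := by rw [mem_Ico]; omega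
    have hsum : ∑ r ∈ range (k + 1), C ((r.factorial : ℂ)⁻¹) *
        ((r : ℂ[X]) * ellPoly l k m y ^ (r - 1) * X ^ j) =
        X ^ j * ∑ r ∈ range k, C ((r.factorial : ℂ)⁻¹) * ellPoly l k m y ^ r := by
      rw [sum_range_succ', Nat.cast_zero, zero_mul, zero_mul, mul_zero, add_zero, mul_sum]
      refine sum_congr rfl fun r _ => ?_
      have e : C (((r + 1).factorial : ℂ)⁻¹) * ((r + 1 : ℕ) : ℂ[X]) = C ((r.factorial : ℂ)⁻¹) := by
        rw [← map_natCast (C : ℂ →+* ℂ[X]), ← C_mul, Nat.factorial_succ]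
        congr 1
        have h1 : ((r + 1 : ℕ) : ℂ) ≠ 0 := by exact_mod_cast r.succ_ne_zero
        have h2 : (r.factorial : ℂ) ≠ 0 := by exact_mod_cast r.factorial_ne_zero
        push_cast at h1 ⊢
        field_simp
      rw [Nat.add_sub_cancel, ← e]
      ring
    simp only [h0, hj', if_true, if_false, zero_mul, zero_add]
    rw [hsum, expPoly, sum_range_succ]
    have hL0 : X ∣ ellPoly l k m y := X_dvd_iff.2 (coeff_ellPoly_zero l k m y)
    have hd : (X : ℂ[X]) ^ (k + 1) ∣ X ^ j * ellPoly l k m y ^ k := by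
      refine dvd_trans ?_ (mul_dvd_mul_left (X ^ j) (pow_dvd_pow_of_dvd hL0 k))
      rw [← pow_add]
      exact pow_dvd_pow _ (by omega)
    refine dvd_trans hd ⟨-(C (Complex.exp (coord l (l + 1) y)) * C ((k.factorial : ℂ)⁻¹)), ?_⟩
    ring

/-- The normalized functions of the first family in terms of `y^{l+1}, z^1/k, …, z^k/k`. -/
theorem gradient_normFam_first {l k m : ℕ} (hk : 1 ≤ k) (hkl : k ≤ l) (hm : m ≤ l - k) (y : Pt l)
    {i : ℕ} (hi : i < k + 1) :
    gradient (normFam l k m 0 (k - i)) y = ∑ j ∈ range (k + 1),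
      (X ^ j * (C (k : ℂ) * expPoly l k m y ^ (k - i))).coeff i • gradient (ell l k m j) y := by
  have hk0 : (k : ℂ) ≠ 0 := by exact_mod_cast (by omega : k ≠ 0)
  refine (hasGrad_normFam 0 (k - i) y).unique ?_
  rcases Nat.lt_or_ge i k with h | h
  · have hN : ((k - i : ℕ) : ℂ) ≠ 0 := by exact_mod_cast (by omega : k - i ≠ 0)
    obtain ⟨dS, hS, hd⟩ := hasCoeffDeriv_expPoly l k m y
    have h1 := (hS.pow (k - i)) i
    have h2 := h1.const_mul ((k : ℂ) / (k - i : ℕ))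
    have e : normFam l k m 0 (k - i) =
        fun y => (k : ℂ) / (k - i : ℕ) * (expPoly l k m y ^ (k - i)).coeff i := by
      funext y
      have h3 := smul_normFam_first hk hkl hm (by omega : k - i ≤ k) y
      rw [show k - (k - i) = i by omega] at h3
      field_simp
      linear_combination h3
    rw [e]
    refine h2.congr_grad ?_
    rw [smul_sum]
    refine sum_congr rfl fun j hj => ?_
    rw [smul_smul]
    congr 1
    have h4 : X ^ (k + 1) ∣ ((k - i : ℕ) : ℂ[X]) * expPoly l k m y ^ (k - i - 1) * dS j -
        ((k - i : ℕ) : ℂ[X]) * (X ^ j * expPoly l k m y ^ (k - i)) := by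
      have h5 := (hd j (mem_range.1 hj)).mul_left
        (((k - i : ℕ) : ℂ[X]) * expPoly l k m y ^ (k - i - 1))
      refine h5.trans (dvd_of_eq ?_)
      rw [show expPoly l k m y ^ (k - i) = expPoly l k m y ^ (k - i - 1) * expPoly l k m y by
        rw [← pow_succ, Nat.sub_add_cancel (by omega)]]
      ring
    have h6 := X_pow_dvd_iff.1 h4 i hi
    rw [coeff_sub, sub_eq_zero, ← map_natCast (C : ℂ →+* ℂ[X]) (k - i), mul_assoc, coeff_C_mul,
      coeff_C_mul] at h6
    beta_reduce
    rw [← map_natCast (C : ℂ →+* ℂ[X]) (k - i), mul_assoc, coeff_C_mul, h6, mul_left_comm (X ^ j),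
      coeff_C_mul]
    field_simp
  · obtain rfl : i = k := by omega
    rw [Nat.sub_self]
    have e : normFam l i m 0 0 = fun y => (i : ℂ) * ell l i m i y :=
      funext fun y => normFam_first_zero hk hkl hm y
    rw [e]
    refine ((hasGrad_ell i y).const_mul _).congr_grad ?_
    rw [sum_eq_single_of_mem i (by simp)]
    · congr 1
      rw [pow_zero, mul_one, mul_comm, coeff_C_mul_X_pow, if_pos rfl]
    · intro j _ hj
      rw [pow_zero, mul_one, mul_comm, coeff_C_mul_X_pow, if_neg (Ne.symm hj), zero_smul]

/-- The matrix of `η` in the flat coordinates of the first family and the normalized functions of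
the other two. The normalized functions of the first family are coefficients of powers of
`expPoly`, so their differentials are Toeplitz combinations of those of `ell`; multiplying two such
matrices multiplies the powers, which matches the Hankel matrix `normGram`. -/
theorem bil_etaForm_ell {l k m : ℕ} (hk : 1 ≤ k) (hkl : k ≤ l) (hm : m ≤ l - k) (y : Pt l)
    (κ κ' : Fin 3) (i j : ℕ) (hi : i < famSize l k m κ) (hj : j < famSize l k m κ') :
    bil (etaForm l k m (gForm l k)) y
        (if κ = 0 then gradient (ell l k m i) y else gradient (normFam l k m κ i) y)
        (if κ' = 0 then gradient (ell l k m j) y else gradient (normFam l k m κ' j) y) =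
      if κ = κ' then (if κ = 0 then (if i + j = k then (k : ℂ)⁻¹ else 0)
        else 4 * (i + j + 1 : ℕ) * normFam l k m κ (i + j) y) else 0 := by
  have hk0 : (k : ℂ) ≠ 0 := by exact_mod_cast (by omega : k ≠ 0)
  refine gram_of_triangular (famSize l k m) (bil (etaForm l k m (gForm l k)) y)
    (fun κ i => gradient (normFam l k m κ (if κ = 0 then k - i else i)) y)
    (fun κ i => if κ = 0 then gradient (ell l k m i) y else gradient (normFam l k m κ i) y)
    (fun κ i j => if κ = 0 then (X ^ j * (C (k : ℂ) * expPoly l k m y ^ (k - i))).coeff i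
      else if i = j then 1 else 0) ?_ ?_ ?_
    (fun κ κ' i j => if κ = κ' then (if κ = 0 then (if i + j = k then (k : ℂ)⁻¹ else 0)
        else 4 * (i + j + 1 : ℕ) * normFam l k m κ (i + j) y) else 0) ?_ κ κ' i j hi hj
  · intro κ i j _ _ hij
    split_ifs with h1 h2
    · rw [coeff_X_pow_mul', if_neg (by omega)]
    · omega
    · rfl
  · intro κ i _
    by_cases h1 : κ = 0 <;> simp only [h1, if_true, if_false]
    · rw [coeff_X_pow_mul', if_pos le_rfl, Nat.sub_self, coeff_C_mul, coeff_zero_eq_eval_zero,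
        eval_pow, ← coeff_zero_eq_eval_zero, coeff_expPoly_zero]
      exact mul_ne_zero hk0 (pow_ne_zero _ (Complex.exp_ne_zero _))
    · exact one_ne_zero
  · intro κ i hi
    by_cases h : κ = 0
    · subst h
      simp only [if_true]
      exact gradient_normFam_first hk hkl hm y hi
    · simp [h, hi]
  · intro κ κ' i j hi hj
    rw [bil_etaForm_normFam hk hkl hm]
    by_cases h : κ = κ'
    · subst h
      simp only [if_true]
      by_cases h0 : κ = 0
      · subst h0
        replace hi : i < k + 1 := hi
        replace hj : j < k + 1 := hj
        simp only [if_true]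
        rw [show famSize l k m 0 = k + 1 from rfl,
          sum_antidiagonal_gram k i j (by omega) (by omega)]
        simp only [normGram, Matrix.cons_val]
        split_ifs with h
        · rw [smul_normFam_first hk hkl hm (by omega),
            show C (k : ℂ) * expPoly l k m y ^ (k - i) * (C (k : ℂ) * expPoly l k m y ^ (k - j)) =
              C (k : ℂ) * (C (k : ℂ) * expPoly l k m y ^ (k - i + (k - j))) by rw [pow_add]; ring,
            coeff_C_mul, coeff_C_mul, inv_mul_cancel_left₀ hk0,
            show k - (k - i + (k - j)) = i + j - k by omega]
        · rw [normFam_eq_zero (show k + 1 ≤ _ by omega), mul_zero]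
      · have e : normGram κ (fun i => normFam l k m κ i y) i j =
            4 * (i + j + 1 : ℕ) * normFam l k m κ (i + j) y := by
          revert h0
          clear hi hj
          revert κ
          rw [forall_fin_three]
          exact ⟨fun h => absurd rfl h, fun _ => rfl, fun _ => rfl⟩
        simp only [h0, if_false]
        rw [e]
        simp [hi, hj]
    · simp [h]

/-- The entries of the normal form that belong to one family with members `c s`. -/
noncomputable def zGram (l k m : ℕ) (κ : Fin 3) (c : ℕ → ℂ) (i j : ℕ) : ℂ :=
  if κ = 0 then (if i + j = k then (if i = 0 ∨ j = 0 then 1 else (k : ℂ)) else 0)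
  else if i + j < famSize l k m κ then 4 * (i + j + 1 : ℕ) * c (i + j) else 0

theorem exists_zIdx_eq {l k m j : ℕ} (h1 : 1 ≤ j)
    (hj : j ≤ l + 1) : ∃ κ i, i < famSize l k m κ ∧ zIdx l k m κ i = j := by
  by_cases h2 : j ≤ k
  · exact ⟨0, j, show j < k + 1 by omega, by
      simp only [zIdx, Matrix.cons_val]; rw [if_neg (by omega)]⟩
  by_cases h3 : j ≤ l - m
  · exact ⟨1, j - (k + 1), show _ < l - m - k by omega, by
      simp only [zIdx, Matrix.cons_val]; omega⟩
  by_cases h4 : j ≤ l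
  · exact ⟨2, j - (l - m + 1), show _ < m by omega, by simp only [zIdx, Matrix.cons_val]; omega⟩
  · exact ⟨0, 0, show 0 < k + 1 by omega, by
      simp only [zIdx, Matrix.cons_val, if_true]; omega⟩

theorem zIdx_pos_le {l k m : ℕ} (hkl : k ≤ l) (hm : m ≤ l - k) :
    ∀ κ i, i < famSize l k m κ → 1 ≤ zIdx l k m κ i ∧ zIdx l k m κ i ≤ l + 1 := by
  rw [forall_fin_three]
  simp only [famSize, zIdx, Matrix.cons_val]
  refine ⟨fun i hi => ?_, fun i hi => ?_, fun i hi => ?_⟩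
  · split_ifs <;> omega
  · omega
  · omega

theorem normalForm_zIdx {l k m : ℕ} (hk : 1 ≤ k) (hkl : k ≤ l) (hm : m ≤ l - k)
    (z : ℕ → Pt l → ℂ) (y : Pt l) : ∀ κ κ' i j, i < famSize l k m κ → j < famSize l k m κ' →
      normalForm l k m z (zIdx l k m κ i) (zIdx l k m κ' j) y =
        if κ = κ' then zGram l k m κ (fun s => z (zIdx l k m κ s) y) i j else 0 := by
  have h0 : ∀ i, zIdx l k m 0 i = l + 1 ∧ i = 0 ∨ zIdx l k m 0 i = i ∧ i ≠ 0 := by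
    intro i
    simp only [zIdx, Matrix.cons_val]
    split_ifs with h
    · exact Or.inl ⟨rfl, h⟩
    · exact Or.inr ⟨rfl, h⟩
  have h1 : ∀ i, zIdx l k m 1 i = k + 1 + i := fun i => rfl
  have h2 : ∀ i, zIdx l k m 2 i = l - m + 1 + i := fun i => rfl
  have s0 : famSize l k m 0 = k + 1 := rfl
  have s1 : famSize l k m 1 = l - m - k := rfl
  have s2 : famSize l k m 2 = m := rfl
  simp only [forall_fin_three, s0, s1, s2, normalForm, blockEntry, zGram]
  refine ⟨⟨?_, ?_, ?_⟩, ⟨?_, ?_, ?_⟩, ⟨?_, ?_, ?_⟩⟩ <;> intro i j hi hj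
  · have hi0 := h0 i
    have hj0 := h0 j
    generalize zIdx l k m 0 i = a at *
    generalize zIdx l k m 0 j = b at *
    rw [if_pos trivial, if_pos trivial]
    rcases hi0 with ⟨ha, hi0⟩ | ⟨ha, hi0⟩ <;> rcases hj0 with ⟨hb, hj0⟩ | ⟨hb, hj0⟩
    · rw [if_neg (by omega), if_neg (by omega), if_neg (by omega), if_neg (by omega),
        if_neg (by omega)]
    · rw [if_neg (by omega)]
      by_cases h : j = k
      · rw [if_pos (by omega), if_pos (by omega), if_pos (by omega)]
      · rw [if_neg (by omega), if_neg (by omega), if_neg (by omega), if_neg (by omega)]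
    · rw [if_neg (by omega)]
      by_cases h : i = k
      · rw [if_pos (by omega), if_pos (by omega), if_pos (by omega)]
      · rw [if_neg (by omega), if_neg (by omega), if_neg (by omega), if_neg (by omega)]
    · by_cases h : a < k ∧ b < k
      · rw [if_pos h, if_neg (by omega : ¬ (i = 0 ∨ j = 0)), ha, hb]
      · rw [if_neg h, if_neg (by omega), if_neg (by omega), if_neg (by omega), if_neg (by omega)]
  · have hi0 := h0 i
    have hj0 := h1 j
    generalize zIdx l k m 0 i = a at *
    generalize zIdx l k m 1 j = b at *
    rw [if_neg (by omega), if_neg (by omega), if_neg (by omega), if_neg (by omega),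
      if_neg (by decide)]
  · have hi0 := h0 i
    have hj0 := h2 j
    generalize zIdx l k m 0 i = a at *
    generalize zIdx l k m 2 j = b at *
    rw [if_neg (by omega), if_neg (by omega), if_neg (by omega), if_neg (by omega),
      if_neg (by decide)]
  · have hi0 := h1 i
    have hj0 := h0 j
    generalize zIdx l k m 1 i = a at *
    generalize zIdx l k m 0 j = b at *
    rw [if_neg (by omega), if_neg (by omega), if_neg (by omega), if_neg (by omega),
      if_neg (by decide)]
  · rw [h1, h1, h1, if_neg (by omega), if_neg (by omega), if_pos (by omega), if_pos trivial,
      if_neg (by decide : ¬ (1 : Fin 3) = 0),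
      show k + 1 + i + (k + 1 + j) - k - 1 = k + 1 + (i + j) by omega,
      show k + 1 + i + (k + 1 + j) - 2 * k - 1 = i + j + 1 by omega]
    exact if_congr (by omega) rfl rfl
  · rw [h1, h2, if_neg (by omega), if_neg (by omega), if_neg (by omega), if_neg (by omega),
      if_neg (by decide)]
  · have hi0 := h2 i
    have hj0 := h0 j
    generalize zIdx l k m 2 i = a at *
    generalize zIdx l k m 0 j = b at *
    rw [if_neg (by omega), if_neg (by omega), if_neg (by omega), if_neg (by omega),
      if_neg (by decide)]
  · rw [h1, h2, if_neg (by omega), if_neg (by omega), if_neg (by omega), if_neg (by omega),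
      if_neg (by decide)]
  · rw [h2, h2, h2, if_neg (by omega), if_neg (by omega), if_neg (by omega), if_pos (by omega),
      if_pos trivial, if_neg (by decide : ¬ (2 : Fin 3) = 0),
      show l - m + 1 + i + (l - m + 1 + j) - (l - m) - 1 = l - m + 1 + (i + j) by omega,
      show l - m + 1 + i + (l - m + 1 + j) - 2 * (l - m) - 1 = i + j + 1 by omega]
    exact if_congr (by omega) rfl rfl

theorem gradient_zNorm_zIdx {l k m : ℕ} (hk : 1 ≤ k) (hkl : k ≤ l) (hm : m ≤ l - k) (y : Pt l)
    (κ : Fin 3) (i : ℕ) (hi : i < famSize l k m κ) :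
    gradient (zNorm l k m (zIdx l k m κ i)) y =
      (if κ = 0 ∧ i ≠ 0 then (k : ℂ) else 1) •
        (if κ = 0 then gradient (ell l k m i) y else gradient (normFam l k m κ i) y) := by
  have hk0 : (k : ℂ) ≠ 0 := by exact_mod_cast (by omega : k ≠ 0)
  have hz := hasGrad_gradient (differentiableAt_zCoord (l := l) (k := k) (m := m) (normPoly k)
    (normCoef l k m) (zIdx l k m κ i) y)
  by_cases h : κ = 0
  · subst h
    simp only [true_and, if_true]
    have e : zNorm l k m (zIdx l k m 0 i) =
        fun y => (if i ≠ 0 then (k : ℂ) else 1) * ell l k m i y := by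
      funext y
      simp only [zIdx, Matrix.cons_val, ell]
      by_cases h0 : i = 0
      · simp only [h0, if_true, ne_eq, not_true_eq_false, if_false, one_mul]
        exact zNorm_last hkl y
      · simp only [h0, if_false, ne_eq, not_false_eq_true, if_true]
        rw [mul_inv_cancel_left₀ hk0]
    have h1 := (hasGrad_ell (l := l) (k := k) (m := m) i y).const_mul (if i ≠ 0 then (k : ℂ) else 1)
    rw [← e] at h1
    exact (hasGrad_gradient h1.1).unique h1
  · simp only [h, false_and, if_false, one_smul]
    congr 1
    funext y
    exact zNorm_block hk hkl hm y κ h i hi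

theorem isZ_zNorm {l k m : ℕ} (hk : 1 ≤ k) (hkl : k ≤ l) (hm : m ≤ l - k) :
    IsZ l k m (etaForm l k m (gForm l k)) (tau l k m) (zNorm l k m) := by
  have hk0 : (k : ℂ) ≠ 0 := by exact_mod_cast (by omega : k ≠ 0)
  refine ⟨⟨normPoly k, normCoef l k m, fun j h1 h2 => normPoly_spec h1 h2, rfl⟩, ?_⟩
  intro s t hs1 hs2 ht1 ht2 y
  obtain ⟨κ, i, hi, rfl⟩ := exists_zIdx_eq (k := k) (m := m) hs1 hs2
  obtain ⟨κ', j, hj, rfl⟩ := exists_zIdx_eq (k := k) (m := m) ht1 ht2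
  have hd : ∀ j, DifferentiableAt ℂ (zNorm l k m j) y :=
    fun j => differentiableAt_zCoord _ _ j y
  rw [pairing_eq_bil _ (hasGrad_gradient (hd _)) (hasGrad_gradient (hd _)),
    normalForm_zIdx hk hkl hm _ _ _ _ _ _ hi hj, gradient_zNorm_zIdx hk hkl hm y κ i hi,
    gradient_zNorm_zIdx hk hkl hm y κ' j hj, map_smul, LinearMap.map_smul, LinearMap.smul_apply,
    bil_etaForm_ell hk hkl hm y κ κ' i j hi hj]
  by_cases h : κ = κ'
  · subst h
    by_cases h0 : κ = 0
    · subst h0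
      simp only [if_true, true_and, zGram, smul_eq_mul]
      by_cases hij : i + j = k
      · simp only [hij, if_true]
        by_cases hi0 : i = 0
        · have : j ≠ 0 := by omega
          simp [hi0, this, hk0]
        · by_cases hj0 : j = 0
          · simp [hi0, hj0, hk0]
          · simp [hi0, hj0, hk0]
      · simp [hij]
    · simp only [h0, if_true, false_and, if_false, zGram, smul_eq_mul, one_mul]
      split_ifs with h1
      · rw [zNorm_block hk hkl hm y κ h0 _ h1]
      · rw [normFam_eq_zero (by omega), mul_zero]
  · simp [h]

/-! ### The polynomials `h_j` -/

/-- The polynomials in one variable in the system of equations for the flat coordinates of a block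
of size `n`: `n/(n-j) · (1 + T/(2n))^{2(n-j)}`, where the coefficient of `T` is `1`. -/
noncomputable def blockFun (n j : ℕ) : ℂ[X] :=
  C ((n : ℂ) / (n - j)) * (1 + C ((2 * n : ℂ)⁻¹) * X) ^ (2 * (n - j))

/-- The polynomials `h_s`, `b + 1 ≤ s ≤ e - 1`, of a block: the nonlinear part of the solution of
the system of equations for the flat coordinates. -/
noncomputable def blockPoly (b e s : ℕ) : MvPolynomial ℕ ℂ :=
  -triRem (fun i => MvPolynomial.X (e - i)) (blockFun (e - b)) (e - s)

/-- The polynomials `h_j` of both blocks. -/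
noncomputable def hPoly (l k m s : ℕ) : MvPolynomial ℕ ℂ :=
  if s ≤ l - m then blockPoly k (l - m) s else blockPoly (l - m) l s

theorem coeff_blockFun_one {n j : ℕ} (hj : j < n) : (blockFun n j).coeff 1 = 1 := by
  have hnj : (n : ℂ) - j ≠ 0 := sub_ne_zero.2 (by exact_mod_cast hj.ne')
  have hn0 : (n : ℂ) ≠ 0 := by exact_mod_cast (by omega : n ≠ 0)
  rw [blockFun, coeff_C_mul, coeff_one_pow]
  · rw [coeff_add, coeff_C_mul_X, coeff_one, if_neg one_ne_zero, if_pos rfl]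
    push_cast [Nat.cast_sub hj.le]
    field_simp
    ring
  · rw [coeff_add, coeff_C_mul_X, coeff_one, if_pos rfl, if_neg zero_ne_one, add_zero]

theorem aeval_blockFun (n j : ℕ) (L : ℂ[X]) :
    aeval L (blockFun n j) =
      C ((n : ℂ) / (n - j)) * (1 + C ((2 * n : ℂ)⁻¹) * L) ^ (2 * (n - j)) := by
  rw [blockFun, map_mul, map_pow, map_add, map_mul, aeval_C, aeval_C, aeval_X, map_one]
  rfl

theorem isBlockPoly_blockPoly {k b e : ℕ} {deg : ℕ → ℚ} {h : ℕ → MvPolynomial ℕ ℂ}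
    (hh : ∀ s, b + 1 ≤ s → s ≤ e - 1 → h s = blockPoly b e s)
    (hdeg : ∀ s, b + 1 < s → s < e → deg s = (k : ℚ) - k * ((s : ℚ) - b) / ((e : ℚ) - b)) :
    IsBlockPoly k b e deg h := by
  refine ⟨fun h1 => ?_, fun j h1 h2 => ⟨fun i hi => ?_, ?_⟩⟩
  · rw [hh _ h1 le_rfl, blockPoly, show e - (e - 1) = 1 by omega, triRem_one, neg_zero]
  · have hm : blockPoly b e j ∈ MvPolynomial.supported ℂ (Set.Icc (j + 1) (e - 1)) := by
      refine Subalgebra.neg_mem _ (triRem_mem _ _ _ fun s h3 h4 => ?_)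
      exact Algebra.subset_adjoin ⟨e - s, ⟨by omega, by omega⟩, rfl⟩
    rw [hh j h1 h2] at hi
    exact MvPolynomial.mem_supported.1 hm hi
  · have hbe : (e : ℚ) - b ≠ 0 := sub_ne_zero.2 (by exact_mod_cast (by omega : e ≠ b))
    have e1 : (k : ℚ) * ((e : ℚ) - j) / ((e : ℚ) - b) = (e - j) • ((k : ℚ) / ((e : ℚ) - b)) := by
      rw [nsmul_eq_mul, Nat.cast_sub (by omega)]
      ring
    rw [hh j h1 h2, blockPoly, e1, ← neg_one_mul, ← map_one MvPolynomial.C,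
      ← map_neg MvPolynomial.C]
    refine (triRem_isWeightedHomogeneous _ _ _ _ _ fun i h3 h4 => ?_).C_mul _
    have hX := MvPolynomial.isWeightedHomogeneous_X ℂ deg (e - i)
    rwa [hdeg _ (by omega) (by omega), Nat.cast_sub (by omega),
      show (k : ℚ) - k * ((e : ℚ) - i - b) / ((e : ℚ) - b) = i • ((k : ℚ) / ((e : ℚ) - b)) by
        rw [nsmul_eq_mul]; field_simp; ring] at hX

theorem isBlockPoly_hPoly_left {l k m : ℕ} :
    IsBlockPoly k k (l - m) (wDeg l k m) (hPoly l k m) := by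
  refine isBlockPoly_blockPoly (fun s h1 h2 => ?_) fun s h1 h2 => ?_
  · rw [hPoly, if_pos (by omega)]
  · rw [wDeg, if_neg (by omega), if_pos (by omega), wBlockDeg, if_neg (by omega),
      if_neg (by omega)]

theorem isBlockPoly_hPoly_right {l k m : ℕ} (hkl : k ≤ l) (hm : m ≤ l - k) :
    IsBlockPoly k (l - m) l (wDeg l k m) (hPoly l k m) := by
  refine isBlockPoly_blockPoly (fun s h1 h2 => ?_) fun s h1 h2 => ?_
  · rw [hPoly, if_neg (by omega)]
  · rw [wDeg, if_neg (by omega), if_neg (by omega), if_pos (by omega), wBlockDeg,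
      if_neg (by omega), if_neg (by omega)]

/-! ### The flat coordinates of a block -/

/-- Flat coordinates of a block, numbered from its end and normalized:
`r = t^e`, and `t^{e-j} / (2n)` for `1 ≤ j < n`. -/
noncomputable def flatBlock {l : ℕ} (b e : ℕ) (t : ℕ → Pt l → ℂ) (j : ℕ) (y : Pt l) : ℂ :=
  if j = 0 then t e y else (2 * (e - b : ℕ) : ℂ)⁻¹ * t (e - j) y

/-- The generating polynomial of the normalized flat coordinates. -/
noncomputable def blockGen {l : ℕ} (b e : ℕ) (t : ℕ → Pt l → ℂ) (y : Pt l) : ℂ[X] :=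
  ∑ j ∈ range (e - b), C (flatBlock b e t j y) * X ^ j

/-- The coordinates `z` of a block are coefficients of powers of the generating polynomial of the
flat coordinates. -/
theorem coeff_blockGen_pow {l b e : ℕ} {z w t : ℕ → Pt l → ℂ} {h : ℕ → MvPolynomial ℕ ℂ}
    {r : Pt l → ℂ} (hw : ∀ s, b + 1 ≤ s → s ≤ e → w s = wBlock b e z r s)
    (hh : ∀ s, b + 1 ≤ s → s ≤ e - 1 → h s = blockPoly b e s)
    (ht : ∀ s, b + 1 ≤ s → s ≤ e → t s = tBlock b e h w s) {y : Pt l} (hz : z e y ≠ 0)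
    (hr : r y ^ (2 * (e - b)) = z e y) {i : ℕ} (hi : i < e - b) :
    ((e - b - i : ℕ) : ℂ) * z (e - i) y =
      (e - b : ℕ) * (blockGen b e t y ^ (2 * (e - b - i))).coeff i := by
  obtain ⟨n, hn⟩ : ∃ n, n = e - b := ⟨_, rfl⟩
  have hn0 : (n : ℂ) ≠ 0 := by exact_mod_cast (by omega : n ≠ 0)
  have hr0 : r y ≠ 0 := by
    rintro h0
    rw [h0, zero_pow (by omega)] at hr
    exact hz hr.symm
  have hte : t e y = r y := by
    rw [ht e (by omega) le_rfl, tBlock, if_pos rfl, hw e (by omega) le_rfl, wBlock, if_pos rfl]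
  rw [← hn]
  rw [← hn] at hi hr
  -- the system of equations is solved for the values `v`, which differ from `w^s` for `s = b + 1`
  -- and `s = e` only
  set v : ℕ → ℂ := fun s => z s y * (r y ^ (2 * (s - b)))⁻¹ with hv
  set A : ℕ → MvPolynomial ℕ ℂ := fun i => MvPolynomial.X (e - i) with hA
  have htj : ∀ j, 1 ≤ j → j < n → t (e - j) y =
      r y * MvPolynomial.eval v (triInv A (blockFun n) j) := by
    intro j h1 h2
    have hpoly : MvPolynomial.eval (fun i => w i y) (h (e - j)) =
        -MvPolynomial.eval v (triRem A (blockFun n) j) := by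
      rw [hh _ (by omega) (by omega), blockPoly, map_neg, show e - (e - j) = j by omega, ← hn]
      congr 1
      have hm : triRem A (blockFun n) j ∈
          MvPolynomial.supported ℂ (Set.Icc (e - j + 1) (e - 1)) := by
        refine triRem_mem _ _ _ fun s h3 h4 => ?_
        exact Algebra.subset_adjoin ⟨e - s, ⟨by omega, by omega⟩, rfl⟩
      refine MvPolynomial.eval₂Hom_congr' rfl (fun s hs _ => ?_) rfl
      have hs' := MvPolynomial.mem_supported.1 hm hs
      rw [Set.mem_Icc] at hs'
      rw [hw s (by omega) (by omega), wBlock, if_neg (by omega), if_neg (by omega)]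
    have hwe : w e y = r y := by rw [hw e (by omega) le_rfl, wBlock, if_pos rfl]
    have hse : ¬ e - j = e := by omega
    rw [ht _ (by omega) (by omega), triInv_eq, map_sub]
    simp only [tBlock, hpoly, hwe, hse, if_false]
    rw [hw _ (by omega) (by omega)]
    simp only [wBlock, hse, if_false, hA, MvPolynomial.eval_X, hv]
    by_cases h3 : e - j = b + 1
    · simp only [h3, if_true]
      rw [show b + 1 - b = 1 by omega]
      field_simp
      ring
    · simp only [h3, if_false]
      ring
  have hgen : blockGen b e t y = C (r y) * (1 + C ((2 * n : ℂ)⁻¹) *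
      ∑ i ∈ Ico 1 n, C (MvPolynomial.eval v (triInv A (blockFun n) i)) * X ^ i) := by
    rw [blockGen, ← hn, range_eq_Ico, sum_eq_sum_Ico_succ_bot (by omega), flatBlock, if_pos rfl,
      hte, pow_zero, mul_one, mul_add, mul_one, mul_sum, mul_sum]
    congr 1
    refine sum_congr rfl fun j hj => ?_
    rw [mem_Ico] at hj
    rw [flatBlock, if_neg (by omega), htj j (by omega) hj.2, ← hn, C_mul, C_mul]
    ring
  have hni : ((n - i : ℕ) : ℂ) = n - i := Nat.cast_sub hi.le
  have hni0 : (n : ℂ) - i ≠ 0 := sub_ne_zero.2 (by exact_mod_cast hi.ne')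
  rcases Nat.eq_zero_or_pos i with rfl | h0
  · have hc : (blockGen b e t y).coeff 0 = r y := by
      rw [blockGen, coeff_sum_C_mul_X_pow, if_pos (mem_range.2 (by omega)), flatBlock, if_pos rfl,
        hte]
    rw [coeff_zero_eq_eval_zero, eval_pow, ← coeff_zero_eq_eval_zero, hc, Nat.sub_zero,
      Nat.sub_zero, hr]
  · have key := coeff_aeval_triInv A (blockFun n) v i (n - 1) (coeff_blockFun_one hi) h0 (by omega)
    rw [Nat.sub_add_cancel (by omega), aeval_blockFun, coeff_C_mul] at key
    rw [hgen, mul_pow, ← C_pow, coeff_C_mul, hni]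
    have hvi : MvPolynomial.eval v (A i) = z (e - i) y * (r y ^ (2 * (n - i)))⁻¹ := by
      simp only [hA, MvPolynomial.eval_X, hv]
      rw [show e - i - b = n - i by omega]
    rw [hvi] at key
    have hp : r y ^ (2 * (n - i)) ≠ 0 := pow_ne_zero _ hr0
    have hz' : z (e - i) y = r y ^ (2 * (n - i)) *
        (z (e - i) y * (r y ^ (2 * (n - i)))⁻¹) := by
      field_simp
    rw [hz', ← key]
    generalize Polynomial.coeff (R := ℂ) _ i = c
    field_simp

/-! ### Flatness -/

/-- The relation between the coordinates `z` and the flat coordinates of a block. -/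
def BlockRel {l : ℕ} (b e : ℕ) (z t : ℕ → Pt l → ℂ) (U : Set (Pt l)) : Prop :=
  ∀ y ∈ U, (b < e → t e y ≠ 0) ∧ ∀ i < e - b, ((e - b - i : ℕ) : ℂ) * z (e - i) y =
    (e - b : ℕ) * (blockGen b e t y ^ (2 * (e - b - i))).coeff i

theorem coeff_blockGen_zero {l b e : ℕ} (hbe : b < e) (t : ℕ → Pt l → ℂ) (y : Pt l) :
    (blockGen b e t y).coeff 0 = t e y := by
  rw [blockGen, coeff_sum_C_mul_X_pow, if_pos (mem_range.2 (by omega)), flatBlock, if_pos rfl]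

theorem differentiableAt_flatBlock {l b e : ℕ} {t : ℕ → Pt l → ℂ} {y : Pt l}
    (hdt : ∀ s, DifferentiableAt ℂ (t s) y) (j : ℕ) :
    DifferentiableAt ℂ (flatBlock b e t j) y := by
  unfold flatBlock
  split_ifs
  · exact hdt e
  · exact (hdt _).const_mul _

/-- The differentials of the coordinates `z` of a block in terms of those of the flat ones. -/
theorem gradient_z_block {l b e : ℕ} {z t : ℕ → Pt l → ℂ} {U : Set (Pt l)} (hU : IsOpen U)
    (hrel : BlockRel b e z t U) (hdt : ∀ y ∈ U, ∀ s, DifferentiableAt ℂ (t s) y) {y : Pt l}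
    (hy : y ∈ U) {i : ℕ} (hi : i < e - b) :
    gradient (z (e - i)) y = ∑ j ∈ range (e - b),
      (X ^ j * (C (2 * (e - b : ℕ) : ℂ) * blockGen b e t y ^ (2 * (e - b - i) - 1))).coeff i •
        gradient (flatBlock b e t j) y := by
  obtain ⟨n, hn⟩ : ∃ n, n = e - b := ⟨_, rfl⟩
  rw [← hn] at hi ⊢
  have hni : ((n - i : ℕ) : ℂ) ≠ 0 := by exact_mod_cast (by omega : n - i ≠ 0)
  have hV : HasCoeffDeriv n (fun j => gradient (flatBlock b e t j) y) (blockGen b e t)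
      (fun j => if j ∈ range n then X ^ j else 0) y := by
    have h := HasCoeffDeriv.generating (n := n) (subset_refl (range n))
      fun j _ => hasGrad_gradient (differentiableAt_flatBlock (b := b) (e := e) (hdt y hy) j)
    rw [hn] at h ⊢
    exact h
  have h1 := ((hV.pow (2 * (n - i))) i).const_mul ((n : ℂ) / (n - i : ℕ))
  have h2 : z (e - i) =ᶠ[nhds y]
      fun y => (n : ℂ) / (n - i : ℕ) * (blockGen b e t y ^ (2 * (n - i))).coeff i := by
    filter_upwards [hU.mem_nhds hy] with y' hy'
    have h3 := (hrel y' hy').2 i (by omega)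
    rw [← hn] at h3
    field_simp
    linear_combination h3
  have h4 := h1.congr_of_eventuallyEq h2
  refine (hasGrad_gradient h4.1).unique (h4.congr_grad ?_)
  rw [smul_sum]
  refine sum_congr rfl fun j hj => ?_
  rw [smul_smul]
  congr 1
  beta_reduce
  rw [if_pos hj, ← map_natCast (C : ℂ →+* ℂ[X]), mul_assoc, coeff_C_mul, mul_left_comm (X ^ j),
    coeff_C_mul, mul_comm (X ^ j), Nat.cast_mul]
  field_simp
  push_cast
  ring

/-- The first index of a block, minus one. -/
def blockStart (l k m : ℕ) (κ : Fin 3) : ℕ := ![0, k, l - m] κ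

/-- The last index of a block. -/
def blockEnd (l m : ℕ) (κ : Fin 3) : ℕ := ![0, l - m, l] κ

theorem block_spec {l k m : ℕ} (hkl : k ≤ l) (hm : m ≤ l - k) : ∀ κ, κ ≠ 0 →
    blockEnd l m κ - blockStart l k m κ = famSize l k m κ ∧
    (blockStart l k m κ ≤ blockEnd l m κ) ∧ (blockEnd l m κ ≤ l) ∧ k ≤ blockStart l k m κ ∧
    ∀ i, zIdx l k m κ i = blockStart l k m κ + 1 + i := by
  rw [forall_fin_three]
  exact ⟨fun h => absurd rfl h,
    fun _ => ⟨rfl, show k ≤ l - m by omega, Nat.sub_le l m, le_rfl, fun i => rfl⟩,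
    fun _ => ⟨show l - (l - m) = m by omega, Nat.sub_le l m, le_rfl, show k ≤ l - m by omega,
      fun i => rfl⟩⟩

/-- The flat coordinates by families, normalized. -/
noncomputable def flatFam (l k m : ℕ) (t : ℕ → Pt l → ℂ) (κ : Fin 3) (i : ℕ) : Pt l → ℂ :=
  if κ = 0 then t (zIdx l k m 0 i) else flatBlock (blockStart l k m κ) (blockEnd l m κ) t i

theorem sum_delta_mul (n : ℕ) {i j : ℕ} (hi : i < n) (hj : j < n) (A : ℕ → ℕ → ℂ) :
    ∑ p ∈ range n, ∑ q ∈ range n, (if i = p then 1 else 0) * (if j = q then 1 else 0) * A p q =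
      A i j := by
  simp [hi, hj]

/-- The matrix of `η` in the normalized flat coordinates. In the blocks the coordinates `z` are
coefficients of powers of `blockGen`, and an antidiagonal constant matrix in the flat coordinates
yields the Hankel matrix of the normal form. -/
theorem bil_etaForm_flatFam {l k m : ℕ} (hk : 1 ≤ k) (hkl : k ≤ l) (hm : m ≤ l - k)
    {z t : ℕ → Pt l → ℂ} (hz : IsZ l k m (etaForm l k m (gForm l k)) (tau l k m) z)
    {U : Set (Pt l)} (hU : IsOpen U) (ht0 : ∀ i < k + 1, t (zIdx l k m 0 i) = z (zIdx l k m 0 i))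
    (hrel : ∀ κ, κ ≠ 0 → BlockRel (blockStart l k m κ) (blockEnd l m κ) z t U)
    (hdt : ∀ y ∈ U, ∀ s, DifferentiableAt ℂ (t s) y) {y : Pt l} (hy : y ∈ U) (κ κ' : Fin 3)
    (i j : ℕ) (hi : i < famSize l k m κ) (hj : j < famSize l k m κ') :
    bil (etaForm l k m (gForm l k)) y (gradient (flatFam l k m t κ i) y)
        (gradient (flatFam l k m t κ' j) y) =
      if κ = κ' then (if i + j + 1 = famSize l k m κ then
        (if κ = 0 then (if i = 0 ∨ j = 0 then 1 else (k : ℂ)) else (famSize l k m κ : ℂ)⁻¹) else 0)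
      else 0 := by
  obtain ⟨⟨p, c, _, rfl⟩, hnf⟩ := hz
  have hpair : ∀ κ κ' i j, i < famSize l k m κ → j < famSize l k m κ' →
      bil (etaForm l k m (gForm l k)) y
        (gradient (zCoord l k m (tau l k m) p c (zIdx l k m κ i)) y)
        (gradient (zCoord l k m (tau l k m) p c (zIdx l k m κ' j)) y) =
      if κ = κ' then zGram l k m κ
        (fun s => zCoord l k m (tau l k m) p c (zIdx l k m κ s) y) i j else 0 := by
    intro κ κ' i j hi hj
    have h1 := zIdx_pos_le hkl hm κ i hi
    have h2 := zIdx_pos_le hkl hm κ' j hj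
    rw [← pairing_eq_bil _ (hasGrad_gradient (differentiableAt_zCoord p c _ y))
      (hasGrad_gradient (differentiableAt_zCoord p c _ y)), hnf _ _ h1.1 h1.2 h2.1 h2.2 y,
      normalForm_zIdx hk hkl hm _ _ _ _ _ _ hi hj]
  have hidx : ∀ κ, κ ≠ 0 → ∀ i < famSize l k m κ,
      zIdx l k m κ (famSize l k m κ - 1 - i) = blockEnd l m κ - i := by
    intro κ h0 i hi
    obtain ⟨h1, h2, h3, h4, h5⟩ := block_spec hkl hm κ h0
    rw [h5]; omega
  refine gram_of_triangular (famSize l k m) (bil (etaForm l k m (gForm l k)) y)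
    (fun κ i => gradient (zCoord l k m (tau l k m) p c (zIdx l k m κ
      (if κ = 0 then i else famSize l k m κ - 1 - i))) y)
    (fun κ i => gradient (flatFam l k m t κ i) y)
    (fun κ i j => if κ = 0 then (if i = j then 1 else 0)
      else (X ^ j * (C (2 * famSize l k m κ : ℂ) * blockGen (blockStart l k m κ) (blockEnd l m κ)
        t y ^ (2 * (famSize l k m κ - i) - 1))).coeff i) ?_ ?_ ?_
    (fun κ κ' i j => if κ = κ' then (if i + j + 1 = famSize l k m κ then
        (if κ = 0 then (if i = 0 ∨ j = 0 then 1 else (k : ℂ)) else (famSize l k m κ : ℂ)⁻¹) else 0)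
      else 0) ?_ κ κ' i j hi hj
  · intro κ i j _ _ hij
    split_ifs with h1 h2
    · omega
    · rfl
    · rw [coeff_X_pow_mul', if_neg (by omega)]
  · intro κ i hi
    by_cases h1 : κ = 0 <;> simp only [h1, if_true, if_false]
    · exact one_ne_zero
    · obtain ⟨h2, h3, h4, h5, h6⟩ := block_spec hkl hm κ h1
      have hn0 : (famSize l k m κ : ℂ) ≠ 0 := by exact_mod_cast (by omega : famSize l k m κ ≠ 0)
      rw [coeff_X_pow_mul', if_pos le_rfl, Nat.sub_self, coeff_C_mul, coeff_zero_eq_eval_zero,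
        eval_pow, ← coeff_zero_eq_eval_zero, coeff_blockGen_zero (by omega)]
      exact mul_ne_zero (mul_ne_zero two_ne_zero hn0)
        (pow_ne_zero _ ((hrel κ h1 y hy).1 (by omega)))
  · intro κ i hi
    by_cases h1 : κ = 0
    · subst h1
      simp [flatFam, ht0 i hi, hi]
    · obtain ⟨h2, h3, h4, h5, h6⟩ := block_spec hkl hm κ h1
      have h := gradient_z_block hU (hrel κ h1) hdt hy (i := i) (by omega)
      rw [h2] at h
      simp only [h1, if_false, flatFam]
      rw [hidx κ h1 i hi, h]
  · intro κ κ' i j hi hj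
    rw [hpair _ _ _ _ (by split_ifs <;> omega) (by split_ifs <;> omega)]
    by_cases h : κ = κ'
    · subst h
      simp only [if_true]
      by_cases h0 : κ = 0
      · subst h0
        simp only [if_true, zGram]
        replace hi : i < k + 1 := hi
        replace hj : j < k + 1 := hj
        rw [show famSize l k m 0 = k + 1 from rfl, sum_delta_mul (k + 1) hi hj (fun i j =>
          if i + j + 1 = k + 1 then (if i = 0 ∨ j = 0 then 1 else (k : ℂ)) else 0)]
        simp only [Nat.add_right_cancel_iff]
      · obtain ⟨h2, h3, h4, h5, h6⟩ := block_spec hkl hm κ h0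
        simp only [h0, if_false, zGram]
        obtain ⟨N, hN⟩ : ∃ N, famSize l k m κ = N + 1 := ⟨famSize l k m κ - 1, by omega⟩
        have hn0 : (famSize l k m κ : ℂ) ≠ 0 := by exact_mod_cast (by omega : famSize l k m κ ≠ 0)
        have hs := sum_antidiagonal_gram N i j (by omega) (by omega)
          (C (2 * famSize l k m κ : ℂ) * blockGen (blockStart l k m κ) (blockEnd l m κ)
            t y ^ (2 * (famSize l k m κ - i) - 1))
          (C (2 * famSize l k m κ : ℂ) * blockGen (blockStart l k m κ) (blockEnd l m κ)
            t y ^ (2 * (famSize l k m κ - j) - 1)) ((famSize l k m κ : ℂ)⁻¹)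
        rw [← hN] at hs
        have e1 : ∀ p q, (p + q + 1 = famSize l k m κ) = (p + q = N) := by
          intro p q; rw [hN]; exact propext ⟨fun h => by omega, fun h => by omega⟩
        simp only [e1]
        rw [hs]
        by_cases hij : N ≤ i + j
        · have h7 := (hrel κ h0 y hy).2 (i + j - N) (by omega)
          rw [h2] at h7
          rw [if_pos (by omega), if_pos hij,
            show famSize l k m κ - 1 - i + (famSize l k m κ - 1 - j) =
              famSize l k m κ - 1 - (i + j - N) by omega, hidx κ h0 _ (by omega),
            show famSize l k m κ - 1 - (i + j - N) + 1 = famSize l k m κ - (i + j - N) by omega,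
            mul_assoc, h7, mul_mul_mul_comm, ← C_mul, coeff_C_mul, ← pow_add,
            show 2 * (famSize l k m κ - i) - 1 + (2 * (famSize l k m κ - j) - 1) =
              2 * (famSize l k m κ - (i + j - N)) by omega]
          field_simp
          ring
        · rw [if_neg (by omega), if_neg hij]
    · simp [h]

theorem eq_of_unitriangular {b e : ℕ} {F F' : ℕ → ℂ} {c : ℕ → ℕ → ℂ}
    (h : ∀ s, b < s → s ≤ e → F s + ∑ x ∈ Icc (s + 1) e, c s x * F x =
      F' s + ∑ x ∈ Icc (s + 1) e, c s x * F' x) {s : ℕ} (hs : b < s) (hse : s ≤ e) :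
    F s = F' s := by
  obtain ⟨d, hd⟩ : ∃ d, d = e - s := ⟨_, rfl⟩
  induction d using Nat.strong_induction_on generalizing s with
  | _ d ih =>
    have h1 := h s hs hse
    have h2 : ∑ x ∈ Icc (s + 1) e, c s x * F x = ∑ x ∈ Icc (s + 1) e, c s x * F' x := by
      refine sum_congr rfl fun x hx => ?_
      rw [mem_Icc] at hx
      rw [ih (e - x) (by omega) (by omega) hx.2 rfl]
    rw [h2] at h1
    exact add_right_cancel h1

/-- Triangular coordinates determine the coordinates `τ`. -/
theorem tau_eq_of_zCoord_eq {l k m : ℕ} {p : ℕ → MvPolynomial ℕ ℂ} {c : ℕ → ℕ → ℂ} (hkl : k ≤ l)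
    (hm : m ≤ l - k) (hp : ∀ j, 1 ≤ j → j ≤ k → ∀ i ∈ (p j).vars, i < j) {y y' : Pt l}
    (h : ∀ s, 1 ≤ s → s ≤ l + 1 →
      zCoord l k m (tau l k m) p c s y = zCoord l k m (tau l k m) p c s y') :
    ∀ s, 1 ≤ s → s ≤ l + 1 → tau l k m s y = tau l k m s y' := by
  have hlast : tau l k m (l + 1) y = tau l k m (l + 1) y' := by
    have h1 := h (l + 1) (by omega) le_rfl
    simpa only [zCoord, show ¬ l + 1 ≤ k by omega, show ¬ l + 1 ≤ l - m by omega,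
      show ¬ l + 1 ≤ l by omega, if_false] using h1
  intro s h1 h2
  by_cases h3 : s ≤ k
  · induction s using Nat.strong_induction_on with
    | _ s ih =>
      have h4 := h s h1 h2
      rw [zCoord, if_pos h3, zCoord, if_pos h3] at h4
      have h5 : MvPolynomial.eval (tauVal l k m y) (p s) =
          MvPolynomial.eval (tauVal l k m y') (p s) := by
        refine MvPolynomial.eval₂Hom_congr' rfl (fun i hi _ => ?_) rfl
        rw [tauVal, tauVal]
        split_ifs with h0
        · rw [hlast]
        · have hi' := hp s h1 h3 i hi
          exact ih i hi' (by omega) (by omega) (by omega)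
      exact add_right_cancel (h4.trans (congrArg _ h5.symm))
  by_cases h4 : s ≤ l - m
  · refine eq_of_unitriangular (b := k) (e := l - m) (F := fun s => tau l k m s y)
      (F' := fun s => tau l k m s y') (c := c) (fun s hs hse => ?_) (by omega) h4
    have h5 := h s (by omega) (by omega)
    simpa only [zCoord, show ¬ s ≤ k by omega, hse, if_false, if_true] using h5
  by_cases h5 : s ≤ l
  · refine eq_of_unitriangular (b := l - m) (e := l) (F := fun s => tau l k m s y)
      (F' := fun s => tau l k m s y') (c := c) (fun s hs hse => ?_) (by omega) h5
    have h5 := h s (by omega) (by omega)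
    simpa only [zCoord, show ¬ s ≤ k by omega, show ¬ s ≤ l - m by omega, hse, if_false, if_true]
      using h5
  · rw [show s = l + 1 by omega]
    exact hlast

/-- A matrix is invertible if each column meets a row in the only nonzero entry of that row. -/
theorem det_ne_zero_of_single_entries {ι : Type*} [Fintype ι] [DecidableEq ι] (A : Matrix ι ι ℂ)
    (h : ∀ j, ∃ i, A i j ≠ 0 ∧ ∀ j', j' ≠ j → A i j' = 0) : A.det ≠ 0 := by
  intro h0
  obtain ⟨v, hv, hv0⟩ := Matrix.exists_mulVec_eq_zero_iff.2 h0
  apply hv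
  funext j
  obtain ⟨i, hij, hi⟩ := h j
  have h1 := congrFun hv0 i
  rw [Matrix.mulVec, dotProduct, Fintype.sum_eq_single j fun j' hj' => by
    rw [hi j' hj', zero_mul]] at h1
  exact (mul_eq_zero.1 h1).resolve_left hij

/-- The indices of the flat coordinates of a family. -/
def tIdx (l k m : ℕ) (κ : Fin 3) (i : ℕ) : ℕ :=
  if κ = 0 then zIdx l k m 0 i else blockEnd l m κ - i

theorem exists_tIdx_eq {l k m s : ℕ} (hkl : k ≤ l) (hm : m ≤ l - k) (h1 : 1 ≤ s)
    (hs : s ≤ l + 1) : ∃ κ i, i < famSize l k m κ ∧ tIdx l k m κ i = s := by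
  obtain ⟨κ, i, hi, rfl⟩ := exists_zIdx_eq (k := k) (m := m) h1 hs
  by_cases h0 : κ = 0
  · subst h0
    exact ⟨0, i, hi, if_pos rfl⟩
  · obtain ⟨h2, h3, h4, h5, h6⟩ := block_spec hkl hm κ h0
    exact ⟨κ, famSize l k m κ - 1 - i, by omega, by rw [tIdx, if_neg h0, h6]; omega⟩

theorem tIdx_pos_le {l k m : ℕ} (hkl : k ≤ l) (hm : m ≤ l - k) (κ : Fin 3) (i : ℕ)
    (hi : i < famSize l k m κ) : 1 ≤ tIdx l k m κ i ∧ tIdx l k m κ i ≤ l + 1 := by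
  by_cases h0 : κ = 0
  · subst h0
    exact zIdx_pos_le hkl hm 0 i hi
  · obtain ⟨h2, h3, h4, h5, h6⟩ := block_spec hkl hm κ h0
    rw [tIdx, if_neg h0]
    omega

/-- The normalizing factors of the flat coordinates. -/
noncomputable def tScale (l k m : ℕ) (κ : Fin 3) (i : ℕ) : ℂ :=
  if κ = 0 ∨ i = 0 then 1 else 2 * famSize l k m κ

theorem t_eq_tScale_mul {l k m : ℕ} (hkl : k ≤ l) (hm : m ≤ l - k) (t : ℕ → Pt l → ℂ) (κ : Fin 3)
    (i : ℕ) (hi : i < famSize l k m κ) :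
    t (tIdx l k m κ i) = fun y => tScale l k m κ i * flatFam l k m t κ i y := by
  funext y
  by_cases h0 : κ = 0
  · subst h0
    rw [tIdx, if_pos rfl, tScale, if_pos (Or.inl rfl), flatFam, if_pos rfl, one_mul]
  · obtain ⟨h2, h3, h4, h5, h6⟩ := block_spec hkl hm κ h0
    have hn0 : (famSize l k m κ : ℂ) ≠ 0 := by exact_mod_cast (by omega : famSize l k m κ ≠ 0)
    by_cases hi0 : i = 0
    · rw [tIdx, if_neg h0, tScale, if_pos (Or.inr hi0), flatFam, if_neg h0, flatBlock, if_pos hi0,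
        one_mul, hi0, Nat.sub_zero]
    · rw [tIdx, if_neg h0, tScale, if_neg (by tauto), flatFam, if_neg h0, flatBlock, if_neg hi0, h2,
        mul_inv_cancel_left₀ (mul_ne_zero two_ne_zero hn0)]

theorem tScale_ne_zero {l k m : ℕ} {κ : Fin 3} {i : ℕ} (hi : i < famSize l k m κ) :
    tScale l k m κ i ≠ 0 := by
  have hn0 : (famSize l k m κ : ℂ) ≠ 0 := by exact_mod_cast (by omega : famSize l k m κ ≠ 0)
  rw [tScale]
  split_ifs
  · exact one_ne_zero
  · exact mul_ne_zero two_ne_zero hn0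

/-- The functions `t` are flat coordinates: by their relation to the coordinates `z`, the matrix of
`η` is constant, with one nonzero entry in each row; the coordinates `z`, hence `τ` and `y`, are
functions of them. -/
theorem isFlatCoordinates_of_blockRel {l k m : ℕ} (hk : 1 ≤ k) (hkl : k ≤ l) (hm : m ≤ l - k)
    {z t : ℕ → Pt l → ℂ} (hz : IsZ l k m (etaForm l k m (gForm l k)) (tau l k m) z)
    {U : Set (Pt l)} (hU : IsOpen U) (ht0 : ∀ i < k + 1, t (zIdx l k m 0 i) = z (zIdx l k m 0 i))
    (hrel : ∀ κ, κ ≠ 0 → BlockRel (blockStart l k m κ) (blockEnd l m κ) z t U)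
    (hdt : ∀ y ∈ U, ∀ s, DifferentiableAt ℂ (t s) y) :
    IsFlatCoordinates (etaForm l k m (gForm l k)) U t := by
  have hk0 : (k : ℂ) ≠ 0 := by exact_mod_cast (by omega : k ≠ 0)
  -- the constant entries of the matrix
  let E : Fin 3 → Fin 3 → ℕ → ℕ → ℂ := fun κ κ' i j =>
    tScale l k m κ i * (tScale l k m κ' j * if κ = κ' then (if i + j + 1 = famSize l k m κ then
        (if κ = 0 then (if i = 0 ∨ j = 0 then 1 else (k : ℂ)) else (famSize l k m κ : ℂ)⁻¹) else 0)
      else 0)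
  have hpair : ∀ y ∈ U, ∀ κ κ' i j, i < famSize l k m κ → j < famSize l k m κ' →
      pairing (etaForm l k m (gForm l k)) (t (tIdx l k m κ i)) (t (tIdx l k m κ' j)) y =
        E κ κ' i j := by
    intro y hy κ κ' i j hi hj
    have hg : ∀ κ i, HasGrad (flatFam l k m t κ i) (gradient (flatFam l k m t κ i) y) y := by
      intro κ i
      refine hasGrad_gradient ?_
      unfold flatFam
      split_ifs
      · exact hdt y hy _
      · exact differentiableAt_flatBlock (hdt y hy) i
    have h1 := (hg κ i).const_mul (tScale l k m κ i)
    have h2 := (hg κ' j).const_mul (tScale l k m κ' j)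
    rw [← t_eq_tScale_mul hkl hm t κ i hi] at h1
    rw [← t_eq_tScale_mul hkl hm t κ' j hj] at h2
    rw [pairing_eq_bil _ h1 h2, map_smul, LinearMap.map_smul, LinearMap.smul_apply,
      bil_etaForm_flatFam hk hkl hm hz hU ht0 hrel hdt hy κ κ' i j hi hj, smul_eq_mul, smul_eq_mul,
      mul_left_comm]
  have hinj : Set.InjOn (fun y (i : Fin (l + 1)) => t (i.val + 1) y) U := by
    intro y hy y' hy' hyy
    have ht : ∀ s, 1 ≤ s → s ≤ l + 1 → t s y = t s y' := by
      intro s h1 h2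
      have h3 := congrFun hyy (⟨s - 1, by omega⟩ : Fin (l + 1))
      simp only [show s - 1 + 1 = s by omega] at h3
      exact h3
    have hzz : ∀ s, 1 ≤ s → s ≤ l + 1 → z s y = z s y' := by
      intro s h1 h2
      obtain ⟨κ, i, hi, rfl⟩ := exists_tIdx_eq hkl hm h1 h2
      by_cases h0 : κ = 0
      · subst h0
        rw [tIdx, if_pos rfl, ← ht0 i hi]
        rw [tIdx, if_pos rfl] at h1 h2
        exact ht _ h1 h2
      · obtain ⟨h3, h4, h5, h6, h7⟩ := block_spec hkl hm κ h0
        have hV : blockGen (blockStart l k m κ) (blockEnd l m κ) t y =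
            blockGen (blockStart l k m κ) (blockEnd l m κ) t y' := by
          refine sum_congr rfl fun j hj => ?_
          rw [mem_range] at hj
          congr 2
          rw [flatBlock, flatBlock, ht _ (by omega) (by omega), ht _ (by omega) (by omega)]
        have e1 := (hrel κ h0 y hy).2 i (by omega)
        have e2 := (hrel κ h0 y' hy').2 i (by omega)
        rw [hV, ← e2] at e1
        have hn : ((blockEnd l m κ - blockStart l k m κ - i : ℕ) : ℂ) ≠ 0 := by
          exact_mod_cast (by omega : blockEnd l m κ - blockStart l k m κ - i ≠ 0)
        rw [tIdx, if_neg h0]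
        exact mul_left_cancel₀ hn e1
    obtain ⟨⟨p, c, hp, rfl⟩, _⟩ := hz
    exact tau_injective hk hkl hm (tau_eq_of_zCoord_eq hkl hm (fun j h1 h2 => (hp j h1 h2).1) hzz)
  refine ⟨fun i y hy => (hdt y hy _).differentiableWithinAt, hinj, ?_⟩
  rcases U.eq_empty_or_nonempty with rfl | ⟨y₀, hy₀⟩
  · exact ⟨fun y hy => absurd hy (Set.notMem_empty y), 1, by simp,
      fun y hy => absurd hy (Set.notMem_empty y)⟩
  let A : Matrix (Fin (l + 1)) (Fin (l + 1)) ℂ := Matrix.of fun i j =>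
    pairing (etaForm l k m (gForm l k)) (t (i.val + 1)) (t (j.val + 1)) y₀
  have hA : A.det ≠ 0 := by
    refine det_ne_zero_of_single_entries A fun j => ?_
    obtain ⟨κ, s, hs, hj⟩ := exists_tIdx_eq hkl hm (by omega : 1 ≤ j.val + 1) (by omega)
    have hs' : famSize l k m κ - 1 - s < famSize l k m κ := by omega
    have h1 := tIdx_pos_le hkl hm κ _ hs'
    refine ⟨⟨tIdx l k m κ (famSize l k m κ - 1 - s) - 1, by omega⟩, ?_, fun j' hj' => ?_⟩
    · simp only [A, Matrix.of_apply]
      rw [Nat.sub_add_cancel h1.1, ← hj, hpair y₀ hy₀ _ _ _ _ hs' hs]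
      simp only [E, if_true]
      rw [if_pos (by omega)]
      refine mul_ne_zero (tScale_ne_zero hs') (mul_ne_zero (tScale_ne_zero hs) ?_)
      split_ifs
      · exact one_ne_zero
      · exact hk0
      · exact inv_ne_zero (by exact_mod_cast (by omega : famSize l k m κ ≠ 0))
    · obtain ⟨κ', s', hs'', hj''⟩ := exists_tIdx_eq hkl hm (by omega : 1 ≤ j'.val + 1) (by omega)
      simp only [A, Matrix.of_apply]
      rw [Nat.sub_add_cancel h1.1, ← hj'', hpair y₀ hy₀ _ _ _ _ hs' hs'']
      simp only [E]
      by_cases hκ : κ = κ'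
      · subst hκ
        have hss : s' ≠ s := by
          rintro rfl
          exact hj' (Fin.ext (by omega))
        rw [if_neg (by omega : ¬ famSize l k m κ - 1 - s + s' + 1 = famSize l k m κ)]
        simp
      · simp [hκ]
  have hconst : ∀ y ∈ U, ∀ i j : Fin (l + 1),
      pairing (etaForm l k m (gForm l k)) (t (i.val + 1)) (t (j.val + 1)) y = A i j := by
    intro y hy i j
    obtain ⟨κ, s, hs, hi⟩ := exists_tIdx_eq hkl hm (by omega : 1 ≤ i.val + 1) (by omega)
    obtain ⟨κ', s', hs', hj⟩ := exists_tIdx_eq hkl hm (by omega : 1 ≤ j.val + 1) (by omega)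
    simp only [A, Matrix.of_apply]
    rw [← hi, ← hj, hpair y hy _ _ _ _ hs hs', hpair y₀ hy₀ _ _ _ _ hs hs']
  refine ⟨fun y hy hdet => hA ?_, A, hA, hconst⟩
  -- the matrix of the form in the coordinates `t` factors through the Jacobian matrix
  have hfac : A = (Matrix.of fun i a : Fin (l + 1) => pd (t (i.val + 1)) a y) *
      (Matrix.of (fun a b => etaForm l k m (gForm l k) a b y) *
        (Matrix.of fun i a : Fin (l + 1) => pd (t (i.val + 1)) a y).transpose) := by
    ext i j
    rw [← hconst y hy i j, pairing]
    simp only [Matrix.mul_apply, Matrix.of_apply, Matrix.transpose_apply, mul_sum]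
    refine sum_congr rfl fun a _ => sum_congr rfl fun b _ => ?_
    ring
  rw [hfac, Matrix.det_mul, hdet, zero_mul]

/-! ### Algebraic functions -/

section Algebraic

variable {l : ℕ} {τ : ℕ → Pt l → ℂ} {U : Set (Pt l)} {f f' : Pt l → ℂ}

/-- The evaluation of polynomials in `e^{τ^{l+1}}, τ^1, …, τ^{l+1}` on `U`. -/
noncomputable def evalOn (l : ℕ) (τ : ℕ → Pt l → ℂ) (U : Set (Pt l)) :
    MvPolynomial (Fin (l + 2)) ℂ →+* (U → ℂ) :=
  RingHom.pi fun y => MvPolynomial.eval fun i : Fin (l + 2) =>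
    if i.val = 0 then Complex.exp (τ (l + 1) y) else τ i.val y

theorem isAlgebraicOn_iff :
    IsAlgebraicOn l τ U f ↔
      letI := (evalOn l τ U).toAlgebra
      IsAlgebraic (MvPolynomial (Fin (l + 2)) ℂ) (fun y : U => f y) := by
  let := (evalOn l τ U).toAlgebra
  refine exists_congr fun Q => and_congr_right fun _ => ?_
  have h : ∀ y : U, (aeval (fun y : U => f y) Q) y =
      (Q.map (MvPolynomial.eval fun i : Fin (l + 2) =>
        if i.val = 0 then Complex.exp (τ (l + 1) y) else τ i.val y)).eval (f y) := by
    intro y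
    rw [eval_map, aeval_def]
    exact hom_eval₂ Q (evalOn l τ U) (Pi.evalRingHom (fun _ : U => ℂ) y) _
  constructor
  · intro hQ
    funext y
    rw [h y]
    exact hQ y y.2
  · intro hQ y hy
    rw [← h ⟨y, hy⟩, hQ]
    rfl

theorem IsAlgebraicOn.add (hf : IsAlgebraicOn l τ U f) (hf' : IsAlgebraicOn l τ U f') :
    IsAlgebraicOn l τ U fun y => f y + f' y := by
  let := (evalOn l τ U).toAlgebra
  rw [isAlgebraicOn_iff] at *
  exact hf.add hf'

theorem IsAlgebraicOn.mul (hf : IsAlgebraicOn l τ U f) (hf' : IsAlgebraicOn l τ U f') :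
    IsAlgebraicOn l τ U fun y => f y * f' y := by
  let := (evalOn l τ U).toAlgebra
  rw [isAlgebraicOn_iff] at *
  exact hf.mul hf'

theorem isAlgebraicOn_of_eq_eval (P : MvPolynomial (Fin (l + 2)) ℂ)
    (h : ∀ y ∈ U, f y = MvPolynomial.eval (fun i : Fin (l + 2) =>
      if i.val = 0 then Complex.exp (τ (l + 1) y) else τ i.val y) P) :
    IsAlgebraicOn l τ U f := by
  refine ⟨X - C P, X_sub_C_ne_zero P, fun y hy => ?_⟩
  rw [Polynomial.map_sub, map_X, map_C, eval_sub, eval_X, eval_C, h y hy, sub_self]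

theorem isAlgebraicOn_const (c : ℂ) : IsAlgebraicOn l τ U fun _ => c :=
  isAlgebraicOn_of_eq_eval (MvPolynomial.C c) fun _ _ => (MvPolynomial.eval_C c).symm

theorem IsAlgebraicOn.congr (hf : IsAlgebraicOn l τ U f) (h : ∀ y ∈ U, f' y = f y) :
    IsAlgebraicOn l τ U f' := by
  obtain ⟨Q, hQ, hQ'⟩ := hf
  exact ⟨Q, hQ, fun y hy => by rw [h y hy]; exact hQ' y hy⟩

theorem IsAlgebraicOn.pow (hf : IsAlgebraicOn l τ U f) (n : ℕ) :
    IsAlgebraicOn l τ U fun y => f y ^ n := by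
  induction n with
  | zero => simpa using isAlgebraicOn_const 1
  | succ n ih => simpa only [pow_succ] using ih.mul hf

theorem IsAlgebraicOn.sum {ι : Type*} (s : Finset ι) {F : ι → Pt l → ℂ}
    (h : ∀ i ∈ s, IsAlgebraicOn l τ U (F i)) : IsAlgebraicOn l τ U fun y => ∑ i ∈ s, F i y := by
  classical
  induction s using Finset.induction_on with
  | empty => simpa using isAlgebraicOn_const 0
  | insert i s hi ih =>
    simp only [sum_insert hi]
    exact (h i (mem_insert_self i s)).add (ih fun j hj => h j (mem_insert_of_mem hj))

theorem isAlgebraicOn_eval {v : Pt l → ℕ → ℂ} (hv : ∀ i, IsAlgebraicOn l τ U fun y => v y i)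
    (P : MvPolynomial ℕ ℂ) : IsAlgebraicOn l τ U fun y => MvPolynomial.eval (v y) P := by
  induction P using MvPolynomial.induction_on with
  | C a => simpa using isAlgebraicOn_const a
  | add P Q hP hQ => simpa only [map_add] using hP.add hQ
  | mul_X P i hP => simpa only [map_mul, MvPolynomial.eval_X] using hP.mul (hv i)

/-- Roots of algebraic functions are algebraic. -/
theorem IsAlgebraicOn.of_pow {n : ℕ} (hn : 0 < n) (hf : IsAlgebraicOn l τ U fun y => f y ^ n) :
    IsAlgebraicOn l τ U f := by
  let := (evalOn l τ U).toAlgebra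
  rw [isAlgebraicOn_iff] at *
  exact IsAlgebraic.of_pow hn hf

/-- The inverse of an algebraic function is a root of the reversed polynomial. -/
theorem IsAlgebraicOn.inv (hf : IsAlgebraicOn l τ U f) (h0 : ∀ y ∈ U, f y ≠ 0) :
    IsAlgebraicOn l τ U fun y => (f y)⁻¹ := by
  obtain ⟨Q, hQ, hQ'⟩ := hf
  refine ⟨Q.reverse, by rwa [Ne, reverse_eq_zero], fun y hy => ?_⟩
  let := invertibleOfNonzero (h0 y hy)
  have h := hQ' y hy
  rw [eval_map] at h ⊢
  beta_reduce
  rw [← invOf_eq_inv]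
  exact (eval₂_reverse_eq_zero_iff _ (f y) Q).2 h

end Algebraic

theorem isAlgebraicOn_tau {l k : ℕ} (hkl : k ≤ l) (m : ℕ) (U : Set (Pt l)) (i : ℕ) :
    IsAlgebraicOn l (tau l k m) U (tau l k m i) := by
  by_cases h : 1 ≤ i ∧ i ≤ l + 1
  · refine isAlgebraicOn_of_eq_eval (MvPolynomial.X ⟨i, by omega⟩) fun y _ => ?_
    rw [MvPolynomial.eval_X, if_neg (show ¬ i = 0 by omega)]
  · have e : tau l k m i = fun _ => 0 := by
      funext y
      rw [tau]
      split_ifs <;> first | rfl | omega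
    rw [e]
    exact isAlgebraicOn_const 0

theorem isAlgebraicOn_zCoord {l k m : ℕ} (hkl : k ≤ l) (p : ℕ → MvPolynomial ℕ ℂ) (c : ℕ → ℕ → ℂ)
    (U : Set (Pt l)) (j : ℕ) :
    IsAlgebraicOn l (tau l k m) U (zCoord l k m (tau l k m) p c j) := by
  have hτ := isAlgebraicOn_tau hkl m U
  have hs : ∀ t : Finset ℕ, IsAlgebraicOn l (tau l k m) U fun y => ∑ s ∈ t, c j s * tau l k m s y :=
    fun t => IsAlgebraicOn.sum t fun s _ => (isAlgebraicOn_const _).mul (hτ s)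
  unfold zCoord
  split_ifs
  · refine (hτ j).add (isAlgebraicOn_eval (fun i => ?_) _)
    split_ifs
    · refine isAlgebraicOn_of_eq_eval (MvPolynomial.X 0) fun y _ => ?_
      rw [MvPolynomial.eval_X]
      rfl
    · exact hτ i
  · exact (hτ j).add (hs _)
  · exact (hτ j).add (hs _)
  · exact hτ j

/-! ### The coordinates `w` and `t` on the domain of a branch -/

theorem IsBranch.ne_zero {l b e : ℕ} {z : ℕ → Pt l → ℂ} {U : Set (Pt l)} {r : Pt l → ℂ}
    (h : IsBranch b e z U r) (hbe : b < e) {y : Pt l} (hy : y ∈ U) : r y ≠ 0 := by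
  intro h0
  obtain ⟨h1, h2⟩ := (h hbe).2 y hy
  rw [h0, zero_pow (by omega)] at h2
  exact h1 h2.symm

theorem IsBranch.isAlgebraicOn {l b e : ℕ} {τ z : ℕ → Pt l → ℂ} {U : Set (Pt l)} {r : Pt l → ℂ}
    (h : IsBranch b e z U r) (hbe : b < e) (hz : IsAlgebraicOn l τ U (z e)) :
    IsAlgebraicOn l τ U r :=
  IsAlgebraicOn.of_pow (n := 2 * (e - b)) (by omega) (hz.congr fun y hy => ((h hbe).2 y hy).2)

/-- A class of functions that contains the coordinates `z`, the branches and their inverses, and is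
closed under multiplication, contains the coordinates `w`. -/
theorem wCoord_induction {l k m : ℕ} {z : ℕ → Pt l → ℂ} {r₁ r₂ : Pt l → ℂ}
    (Q : (Pt l → ℂ) → Prop) (hmul : ∀ f f' : Pt l → ℂ, Q f → Q f' → Q fun y => f y * f' y)
    (hz : ∀ s, Q (z s)) (h₁ : k < l - m → Q r₁ ∧ ∀ n : ℕ, Q fun y => (r₁ y ^ n)⁻¹)
    (h₂ : l - m < l → Q r₂ ∧ ∀ n : ℕ, Q fun y => (r₂ y ^ n)⁻¹) (s : ℕ) :
    Q (wCoord l k m z r₁ r₂ s) := by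
  unfold wCoord
  split_ifs with a1 a2 a3
  · exact hz s
  · obtain ⟨a4, a5⟩ := h₁ (by omega)
    unfold wBlock
    split_ifs
    · exact a4
    · exact hmul _ _ (hz s) (by simpa using a5 1)
    · exact hmul _ _ (hz s) (a5 _)
  · obtain ⟨a4, a5⟩ := h₂ (by omega)
    unfold wBlock
    split_ifs
    · exact a4
    · exact hmul _ _ (hz s) (by simpa using a5 1)
    · exact hmul _ _ (hz s) (a5 _)
  · exact hz s

/-- A class of functions that contains the coordinates `w` and is closed under polynomial
expressions contains the functions `t`. -/
theorem tCoord_induction {l k m : ℕ} {h : ℕ → MvPolynomial ℕ ℂ} {w : ℕ → Pt l → ℂ}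
    (Q : (Pt l → ℂ) → Prop) (hmul : ∀ f f' : Pt l → ℂ, Q f → Q f' → Q fun y => f y * f' y)
    (hadd : ∀ f f' : Pt l → ℂ, Q f → Q f' → Q fun y => f y + f' y) (hw : ∀ s, Q (w s))
    (heval : ∀ P : MvPolynomial ℕ ℂ, Q fun y => MvPolynomial.eval (fun i => w i y) P) (s : ℕ) :
    Q (tCoord l k m h w s) := by
  have hb : ∀ b e, Q (tBlock b e h w s) := by
    intro b e
    unfold tBlock
    split_ifs
    · exact hw e
    · exact hadd _ _ (hw s) (hmul _ _ (hw e) (heval _))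
    · exact hmul _ _ (hw e) (hadd _ _ (hw s) (heval _))
  unfold tCoord
  split_ifs
  · exact hw s
  · exact hb _ _
  · exact hb _ _
  · exact hw s

theorem isAlgebraicOn_tCoord {l k m : ℕ} (hkl : k ≤ l) {z : ℕ → Pt l → ℂ}
    (p : ℕ → MvPolynomial ℕ ℂ)
    (c : ℕ → ℕ → ℂ) (hz : z = zCoord l k m (tau l k m) p c) {U : Set (Pt l)} {r₁ r₂ : Pt l → ℂ}
    (h₁ : IsBranch k (l - m) z U r₁) (h₂ : IsBranch (l - m) l z U r₂) (h : ℕ → MvPolynomial ℕ ℂ)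
    (s : ℕ) : IsAlgebraicOn l (tau l k m) U (tCoord l k m h (wCoord l k m z r₁ r₂) s) := by
  have hz' : ∀ s, IsAlgebraicOn l (tau l k m) U (z s) :=
    fun s => hz ▸ isAlgebraicOn_zCoord hkl p c U s
  have hr : ∀ {b e : ℕ} {r : Pt l → ℂ}, IsBranch b e z U r → b < e →
      IsAlgebraicOn l (tau l k m) U r ∧
        ∀ n : ℕ, IsAlgebraicOn l (tau l k m) U fun y => (r y ^ n)⁻¹ := by
    intro b e r hb hbe
    have h3 := hb.isAlgebraicOn hbe (hz' e)
    exact ⟨h3, fun n => (h3.pow n).inv fun y hy => pow_ne_zero _ (hb.ne_zero hbe hy)⟩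
  have hw := wCoord_induction (l := l) (k := k) (m := m) (IsAlgebraicOn l (tau l k m) U)
    (fun _ _ h h' => h.mul h') hz' (hr h₁) (hr h₂)
  exact tCoord_induction _ (fun _ _ h h' => h.mul h') (fun _ _ h h' => h.add h') hw
    (isAlgebraicOn_eval hw) s

theorem differentiableAt_tCoord {l k m : ℕ} {z : ℕ → Pt l → ℂ} {U : Set (Pt l)} (hU : IsOpen U)
    {r₁ r₂ : Pt l → ℂ} (h₁ : IsBranch k (l - m) z U r₁) (h₂ : IsBranch (l - m) l z U r₂)
    (h : ℕ → MvPolynomial ℕ ℂ) {y : Pt l} (hy : y ∈ U) (hz : ∀ s, DifferentiableAt ℂ (z s) y)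
    (s : ℕ) : DifferentiableAt ℂ (tCoord l k m h (wCoord l k m z r₁ r₂) s) y := by
  have hr : ∀ {b e : ℕ} {r : Pt l → ℂ}, IsBranch b e z U r → b < e →
      DifferentiableAt ℂ r y ∧ ∀ n : ℕ, DifferentiableAt ℂ (fun y => (r y ^ n)⁻¹) y := by
    intro b e r hb hbe
    have h3 := (hb hbe).1.differentiableAt (hU.mem_nhds hy)
    exact ⟨h3, fun n => (h3.fun_pow n).fun_inv (pow_ne_zero _ (hb.ne_zero hbe hy))⟩
  have hw := wCoord_induction (l := l) (k := k) (m := m) (fun f => DifferentiableAt ℂ f y)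
    (fun _ _ h h' => h.fun_mul h') hz (hr h₁) (hr h₂)
  exact tCoord_induction (fun f => DifferentiableAt ℂ f y) (fun _ _ h h' => h.fun_mul h')
    (fun _ _ h h' => h.fun_add h') hw (differentiableAt_eval_mvPolynomial hw) s

theorem blockRel_of_isBranch {l b e : ℕ} {z w t : ℕ → Pt l → ℂ} {h : ℕ → MvPolynomial ℕ ℂ}
    {r : Pt l → ℂ} {U : Set (Pt l)} (hb : IsBranch b e z U r)
    (hw : ∀ s, b + 1 ≤ s → s ≤ e → w s = wBlock b e z r s)
    (hh : ∀ s, b + 1 ≤ s → s ≤ e - 1 → h s = blockPoly b e s)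
    (ht : ∀ s, b + 1 ≤ s → s ≤ e → t s = tBlock b e h w s) : BlockRel b e z t U := by
  refine fun y hy => ⟨fun hbe => ?_, fun i hi => ?_⟩
  · rw [ht e (by omega) le_rfl, tBlock, if_pos rfl, hw e (by omega) le_rfl, wBlock, if_pos rfl]
    exact hb.ne_zero hbe hy
  · obtain ⟨h1, h2⟩ := (hb (by omega)).2 y hy
    exact coeff_blockGen_pow hw hh ht h1 h2 hi

theorem blockRel_tCoord {l k m : ℕ} (hkl : k ≤ l) (hm : m ≤ l - k) {z : ℕ → Pt l → ℂ}
    {U : Set (Pt l)} {r₁ r₂ : Pt l → ℂ} (h₁ : IsBranch k (l - m) z U r₁)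
    (h₂ : IsBranch (l - m) l z U r₂) : ∀ κ, κ ≠ 0 → BlockRel (blockStart l k m κ) (blockEnd l m κ) z
      (tCoord l k m (hPoly l k m) (wCoord l k m z r₁ r₂)) U := by
  rw [forall_fin_three]
  refine ⟨fun h => absurd rfl h, fun _ => ?_, fun _ => ?_⟩
  · refine blockRel_of_isBranch (w := wCoord l k m z r₁ r₂) (h := hPoly l k m) h₁
      (fun s a1 a2 => ?_) (fun s a1 a2 => ?_) fun s a1 a2 => ?_
    all_goals simp only [blockStart, blockEnd, Matrix.cons_val] at a1 a2
    · funext y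
      rw [wCoord, if_neg (by omega), if_pos a2]
      rfl
    · rw [hPoly, if_pos (by omega)]
      rfl
    · funext y
      rw [tCoord, if_neg (by omega), if_pos a2]
      rfl
  · refine blockRel_of_isBranch (w := wCoord l k m z r₁ r₂) (h := hPoly l k m) h₂
      (fun s a1 a2 => ?_) (fun s a1 a2 => ?_) fun s a1 a2 => ?_
    all_goals simp only [blockStart, blockEnd, Matrix.cons_val] at a1 a2
    · funext y
      rw [wCoord, if_neg (by omega), if_neg (by omega), if_pos a2]
      rfl
    · rw [hPoly, if_neg (by omega)]
      rfl
    · funext y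
      rw [tCoord, if_neg (by omega), if_neg (by omega), if_pos a2]
      rfl

theorem tCoord_zIdx_zero {l k m : ℕ} (hkl : k ≤ l) (z : ℕ → Pt l → ℂ)
    (h : ℕ → MvPolynomial ℕ ℂ) (r₁ r₂ : Pt l → ℂ) (i : ℕ) (hi : i < k + 1) :
    tCoord l k m h (wCoord l k m z r₁ r₂) (zIdx l k m 0 i) = z (zIdx l k m 0 i) := by
  funext y
  simp only [zIdx, Matrix.cons_val]
  split_ifs with h0
  · rw [tCoord, if_neg (by omega), if_neg (by omega), if_neg (by omega), wCoord, if_neg (by omega),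
      if_neg (by omega), if_neg (by omega)]
  · rw [tCoord, if_pos (by omega), wCoord, if_pos (by omega)]

/-- Near a point where `z^e` does not vanish there is a holomorphic branch of its root. -/
theorem exists_branch {l b e : ℕ} {z : ℕ → Pt l → ℂ} (hz : ∀ y, DifferentiableAt ℂ (z e) y)
    (y₀ : Pt l) (h0 : b < e → z e y₀ ≠ 0) :
    ∃ (U : Set (Pt l)) (r : Pt l → ℂ), IsOpen U ∧ y₀ ∈ U ∧ ∀ V ⊆ U, IsBranch b e z V r := by
  by_cases hbe : b < e
  · have h1 := h0 hbe
    have hcont : Continuous fun y => z e y / z e y₀ :=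
      continuous_iff_continuousAt.2 fun y => ((hz y).continuousAt).div_const _
    have hN : ((2 * (e - b) : ℕ) : ℂ) ≠ 0 := by exact_mod_cast (by omega : 2 * (e - b) ≠ 0)
    obtain ⟨c, hc⟩ := IsAlgClosed.exists_pow_nat_eq (z e y₀) (by omega : 0 < 2 * (e - b))
    refine ⟨(fun y => z e y / z e y₀) ⁻¹' Complex.slitPlane,
      fun y => c * Complex.exp (Complex.log (z e y / z e y₀) * ((2 * (e - b) : ℕ) : ℂ)⁻¹),
      Complex.isOpen_slitPlane.preimage hcont, ?_, fun V hV _ => ⟨fun y hy => ?_, fun y hy => ?_⟩⟩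
    · simp only [Set.mem_preimage, div_self h1]
      exact Complex.one_mem_slitPlane
    · have hd : DifferentiableAt ℂ (fun y => z e y / z e y₀) y := by
        simp only [div_eq_mul_inv]
        exact (hz y).mul_const _
      exact (((hd.clog (hV hy)).mul_const _).cexp.const_mul c).differentiableWithinAt
    · have hq : z e y / z e y₀ ≠ 0 := Complex.slitPlane_ne_zero (hV hy)
      refine ⟨fun h2 => hq (by rw [h2, zero_div]), ?_⟩
      rw [mul_pow, hc, ← Complex.exp_nat_mul, mul_left_comm, mul_inv_cancel₀ hN, mul_one,
        Complex.exp_log hq, mul_div_cancel₀ _ h1]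
  · exact ⟨Set.univ, 0, isOpen_univ, Set.mem_univ _, fun V _ h => absurd h hbe⟩

end ExtAffineC

theorem mainTheorem5 (l k m : ℕ) (hk : 1 ≤ k) (hkl : k ≤ l) (hm : m ≤ l - k) :
    ∃ (g : ExtAffineC.Tensor2 l) (τ : ℕ → ExtAffineC.Pt l → ℂ),
      ExtAffineC.IsIntersectionForm l k g ∧ ExtAffineC.IsTau l k m τ ∧
      (∃ z, ExtAffineC.IsZ l k m (ExtAffineC.etaForm l k m g) τ z) ∧
      ∃ h : ℕ → MvPolynomial ℕ ℂ,
        ExtAffineC.IsBlockPoly k k (l - m) (ExtAffineC.wDeg l k m) h ∧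
        ExtAffineC.IsBlockPoly k (l - m) l (ExtAffineC.wDeg l k m) h ∧
        ∀ z, ExtAffineC.IsZ l k m (ExtAffineC.etaForm l k m g) τ z →
          (∀ y₀, (k < l - m → z (l - m) y₀ ≠ 0) → (l - m < l → z l y₀ ≠ 0) →
            ∃ (U : Set (ExtAffineC.Pt l)) (r₁ r₂ : ExtAffineC.Pt l → ℂ), IsOpen U ∧ y₀ ∈ U ∧
              ExtAffineC.IsBranch k (l - m) z U r₁ ∧ ExtAffineC.IsBranch (l - m) l z U r₂) ∧
          ∀ (U : Set (ExtAffineC.Pt l)) (r₁ r₂ : ExtAffineC.Pt l → ℂ), IsOpen U →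
            ExtAffineC.IsBranch k (l - m) z U r₁ → ExtAffineC.IsBranch (l - m) l z U r₂ →
            ExtAffineC.IsFlatCoordinates (ExtAffineC.etaForm l k m g) U
              (ExtAffineC.tCoord l k m h (ExtAffineC.wCoord l k m z r₁ r₂)) ∧
            ∀ i, 1 ≤ i → i ≤ l + 1 →
              ExtAffineC.IsAlgebraicOn l τ U
                (ExtAffineC.tCoord l k m h (ExtAffineC.wCoord l k m z r₁ r₂) i) := by
  refine ⟨ExtAffineC.gForm l k, ExtAffineC.tau l k m, ExtAffineC.isIntersectionForm_gForm hk,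
    ExtAffineC.isTau_tau hk hkl hm, ⟨_, ExtAffineC.isZ_zNorm hk hkl hm⟩, ExtAffineC.hPoly l k m,
    ExtAffineC.isBlockPoly_hPoly_left, ExtAffineC.isBlockPoly_hPoly_right hkl hm, fun z hz => ?_⟩
  obtain ⟨p, c, hp, hzc⟩ := hz.1
  have hdz : ∀ y s, DifferentiableAt ℂ (z s) y :=
    fun y s => hzc ▸ ExtAffineC.differentiableAt_zCoord p c s y
  refine ⟨fun y₀ h1 h2 => ?_, fun U r₁ r₂ hU h₁ h₂ => ⟨?_, fun i _ _ =>
    ExtAffineC.isAlgebraicOn_tCoord hkl p c hzc h₁ h₂ _ i⟩⟩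
  · obtain ⟨U₁, r₁, a1, a2, a3⟩ :=
      ExtAffineC.exists_branch (b := k) (e := l - m) (fun y => hdz y _) y₀ h1
    obtain ⟨U₂, r₂, b1, b2, b3⟩ :=
      ExtAffineC.exists_branch (b := l - m) (e := l) (fun y => hdz y _) y₀ h2
    exact ⟨U₁ ∩ U₂, r₁, r₂, a1.inter b1, ⟨a2, b2⟩, a3 _ Set.inter_subset_left,
      b3 _ Set.inter_subset_right⟩
  · exact ExtAffineC.isFlatCoordinates_of_blockRel hk hkl hm hz hU
      (ExtAffineC.tCoord_zIdx_zero hkl z _ r₁ r₂) (ExtAffineC.blockRel_tCoord hkl hm h₁ h₂)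
      fun y hy s => ExtAffineC.differentiableAt_tCoord hU h₁ h₂ _ hy (hdz y) s
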